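/- Work in the complex projective plane $\mathbf P^2$. Let $C=L_1\cup L_2\cup L_3$ be the union of three distinct lines through one point $o$, and let $n\ge 4$ be an integer divisible neither by $2$ nor by $3$. Put $\chi_n(t)=t^{n+1}-2t^n+2t-1$, and let $\delta_n$ be its largest real root. Conventions. For a birational map $f:\mathbf P^2\dashrightarrow\mathbf P^2$ with indeterminacy locus $I(f)$ and a set $V\subset \mathbf P^2$, $f(V)$ denotes the Zariski closure of the image of $V\setminus I(f)$. The map $f$ *properly fixes* $C$ if $f(C)=C$ and $o\notin I(f)\cup I(f^{-1})$. A quadratic map is *basic* if $f=T^-\circ J\circ (T^+)^{-1}$ with $T^\pm\in \mathrm{Aut}(\mathbf P^2)$ and $J[x_1:x_2:x_3]=[x_2x_3:x_1x_3:x_1x_2]$; then $I(f)=\{p_1,p_2,p_3\}$ with $p_i=T^+e_i$ ($e_1,e_2,e_3$ the coordinate points), and the exceptional lines are $E_i=T^+\{x_i=0\}$. Such a map, with $p_i\in L_i$ for $i=1,2,3$, has *orbit data* $(n,n,n;\sigma)$, $\sigma\in S_3$, if for each $i$ the sets $f(E_i),\dots,f^n(E_i)$ are single points, of which the first $n-1$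 are not in $I(f)$, and $f^n(E_i)=p_{\sigma(i)}$. The *base locus* of $f$ is the set of the points $f^j(E_i)$, $1\le j\le n$, $i=1,2,3$. The dynamical degree is $\lim_{k\to\infty}(\deg f^k)^{1/k}$. *Coordinates on $C$* are the parametrizations $\gamma_i(t)=[tz+w_i]$ ($t\in\mathbf C$) of $L_i\setminus\{o\}$, $i=1,2,3$, given by a vector $z$ that represents $o$ and vectors $w_i$, not multiples of $z$, with $w_1+w_2+w_3=0$ and $[w_i]\in L_i$. For $\alpha\in\mathbf C$, the map $f$ is *normalized with multiplier $\alpha$* in these coordinates if for some permutation $\tau\in S_3$ it sends $\gamma_i(t)$ to $\gamma_{\tau(i)}(\alpha(t-1)+1)$ for all $i$ and $t$ with $\gamma_i(t)\notin I(f)$. Theorem. (a) Every quadratic birational map properly fixing $C$ is basic, and its points of indeterminacy can be labelled so that $p_i\in L_i$. (b) Coordinates on $C$ exist, and every quadratic birational map properly fixing $C$ with orbit data $(n,n,n;\sigma)$ for some $\sigma\in S_3$ is, in suitable coordinates on $C$, normalized with some multiplier $\alpha$ that is a root of $\chi_n$ and not a root of unity. (c) One has $\delta_n>1$. Fix coordinates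 on $C$ and a root $\alpha\in\mathbf C$ of $\chi_n$ that is not a root of unity. Then for each $\sigma\in S_3$ there is exactly one quadratic birational map $f_\sigma$ properly fixing $C$ with orbit data $(n,n,n;\sigma)$ that is normalized with multiplier $\alpha$. The six maps $f_\sigma$ are pairwise distinct, have the same base locus and the same indeterminacy locus, and all have dynamical degree $\delta_n$. -/

import Mathlib

open MvPolynomial Filter Topology
open scoped LinearAlgebra.Projectivization

noncomputable section

namespace PlaneCremona

/-- Homogeneous coordinate vectors. -/
abbrev Vec : Type := Fin 3 → ℂ

/-- The complex projective plane. -/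
abbrev P2 : Type := ℙ ℂ Vec

/-- A triple of polynomials in the homogeneous coordinates. -/
abbrev Triple : Type := Fin 3 → MvPolynomial (Fin 3) ℂ

/-- Two triples are proportional over the field of rational functions
(for nonzero triples: they define the same rational map). -/
def Proportional (F G : Triple) : Prop := ∀ i j, F i * G j = F j * G i

/-- The triple `G ∘ F`. -/
def tripleComp (G F : Triple) : Triple := fun i => bind₁ F (G i)

/-- The triple of linear forms `x ↦ M x`. -/
def linearTriple (M : Matrix (Fin 3) (Fin 3) ℂ) : Triple :=
  fun i => ∑ j, C (M i j) * X j

/-- The standard Cremona involution `[x₁ : x₂ : x₃] ↦ [x₂x₃ : x₁x₃ : x₁x₂]`. -/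
def cremonaTriple : Triple := ![X 1 * X 2, X 0 * X 2, X 0 * X 1]

/-- The degree of the rational map defined by a nonzero homogeneous triple: the least degree of
a homogeneous triple that defines it (the degree left after removing common factors). -/
def tripleDegree (F : Triple) : ℕ :=
  sInf {e : ℕ | ∃ G : Triple, (∀ i, (G i).IsHomogeneous e) ∧ G ≠ 0 ∧ Proportional G F}

/-- A representative of a rational self-map of the projective plane: a nonzero triple of homogeneous
polynomials of the same degree (common factors are allowed). -/
structure PlaneMap where
  coord : Triple
  deg : ℕ
  homogeneous : ∀ i, (coord i).IsHomogeneous deg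
  ne_zero : coord ≠ 0

namespace PlaneMap

/-- Equality as rational maps. -/
def Same (f g : PlaneMap) : Prop := Proportional f.coord g.coord

/-- The degree of a rational map. -/
def degree (f : PlaneMap) : ℕ := tripleDegree f.coord

/-- `f` is defined at `p` and `f(p) = q`: some representative of `f` does not vanish at `p`,
and its value there is `q`. -/
def Sends (f : PlaneMap) (p q : P2) : Prop :=
  ∃ g : PlaneMap, g.Same f ∧
    ∃ h : (fun i => eval p.rep (g.coord i) : Vec) ≠ 0, Projectivization.mk ℂ _ h = q

/-- The indeterminacy locus. -/
def indet (f : PlaneMap) : Set P2 := {p | ∀ q, ¬ f.Sends p q}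

/-- `g ∘ f = id` and `f ∘ g = id` as rational maps. -/
def IsInverse (f g : PlaneMap) : Prop :=
  (∃ h : MvPolynomial (Fin 3) ℂ, h ≠ 0 ∧ ∀ i, tripleComp g.coord f.coord i = h * X i) ∧
  (∃ h : MvPolynomial (Fin 3) ℂ, h ≠ 0 ∧ ∀ i, tripleComp f.coord g.coord i = h * X i)

/-- A quadratic birational map. -/
def IsQuadraticBirational (f : PlaneMap) : Prop := f.degree = 2 ∧ ∃ g, f.IsInverse g

/-- The coordinates of the `k`-th iterate (before removing common factors). -/
def iterTriple (f : PlaneMap) : ℕ → Triple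
  | 0 => fun i => X i
  | k + 1 => tripleComp f.coord (iterTriple f k)

/-- `d` is the dynamical degree `lim (deg fᵏ)^(1/k)`; the action of `fᵏ` on
`Pic(ℙ²) = ℤ` is multiplication by `deg fᵏ`. -/
def HasDynamicalDegree (f : PlaneMap) (d : ℝ) : Prop :=
  Tendsto (fun k : ℕ => ((tripleDegree (f.iterTriple k) : ℕ) : ℝ) ^ (1 / (k : ℝ))) atTop (𝓝 d)

end PlaneMap

/-- The Zariski closure of a subset of the projective plane. -/
def zariskiClosure (S : Set P2) : Set P2 :=
  {q | ∀ (e : ℕ) (P : MvPolynomial (Fin 3) ℂ), P.IsHomogeneous e →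
    (∀ p ∈ S, eval p.rep P = 0) → eval q.rep P = 0}

/-- The set of points of the projective plane on a linear subspace of `ℂ³`. -/
def pointsOf (W : Submodule ℂ Vec) : Set P2 := {p | p.submodule ≤ W}

namespace PlaneMap

/-- The strict transform: the Zariski closure of `f(V ∖ I(f))`. -/
def strictImage (f : PlaneMap) (V : Set P2) : Set P2 :=
  zariskiClosure {q | ∃ p ∈ V, f.Sends p q}

end PlaneMap

/-- The matrix `T` applied to the `i`-th standard basis vector is not zero. -/
theorem mulVec_single_ne_zero (T : GL (Fin 3) ℂ) (i : Fin 3) :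
    (T : Matrix (Fin 3) (Fin 3) ℂ).mulVec (Pi.single i 1) ≠ 0 := by
  intro h
  have h1 : ((T⁻¹ : GL (Fin 3) ℂ) : Matrix (Fin 3) (Fin 3) ℂ).mulVec
      ((T : Matrix (Fin 3) (Fin 3) ℂ).mulVec (Pi.single i 1)) = Pi.single i (1 : ℂ) := by
    rw [Matrix.mulVec_mulVec, ← Units.val_mul, inv_mul_cancel, Units.val_one, Matrix.one_mulVec]
  rw [h, Matrix.mulVec_zero] at h1
  have h2 := congrFun h1 i
  simp at h2

/-- The point `T eᵢ`. -/
def imagePoint (T : GL (Fin 3) ℂ) (i : Fin 3) : P2 :=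
  Projectivization.mk ℂ _ (mulVec_single_ne_zero T i)

/-- The line `T {xᵢ = 0}`. -/
def imageLine (T : GL (Fin 3) ℂ) (i : Fin 3) : Set P2 :=
  {p | (((T⁻¹ : GL (Fin 3) ℂ) : Matrix (Fin 3) (Fin 3) ℂ).mulVec p.rep) i = 0}

namespace PlaneMap

/-- `f = T⁻ ∘ J ∘ (T⁺)⁻¹` with `J` the standard Cremona involution, that is, `f` is basic. -/
def IsBasicVia (f : PlaneMap) (Tp Tm : GL (Fin 3) ℂ) : Prop :=
  Proportional f.coord
    (tripleComp (linearTriple (Tm : Matrix (Fin 3) (Fin 3) ℂ))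
      (tripleComp cremonaTriple
        (linearTriple ((Tp⁻¹ : GL (Fin 3) ℂ) : Matrix (Fin 3) (Fin 3) ℂ))))

/-- The curve `E` has orbit length `N` under `f` and its orbit ends at `p`: the strict transforms
`f(E), …, f^N(E)` are points, `f^N(E) = p` is indeterminate, and no earlier one is. -/
def HasOrbitLength (f : PlaneMap) (E : Set P2) (N : ℕ) (p : P2) : Prop :=
  1 ≤ N ∧ f.strictImage^[N] E = {p} ∧ p ∈ f.indet ∧
    ∀ j, 1 ≤ j → j < N → ∃ q, q ∉ f.indet ∧ f.strictImage^[j] E = {q}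

/-- `f` is basic, its points of indeterminacy are `p₁, p₂, p₃`, and with this labelling
(so that the exceptional line `Eᵢ` contains the `pⱼ`, `j ≠ i`) its orbit data are
`N₁, N₂, N₃` and `σ`, that is, `f^(Nᵢ)(Eᵢ) = p_(σ(i))`. -/
def HasOrbitData (f : PlaneMap) (p : Fin 3 → P2) (N : Fin 3 → ℕ) (σ : Equiv.Perm (Fin 3)) :
    Prop :=
  ∃ Tp Tm : GL (Fin 3) ℂ, f.IsBasicVia Tp Tm ∧ (∀ i, imagePoint Tp i = p i) ∧
    ∀ i, f.HasOrbitLength (imageLine Tp i) (N i) (p (σ i))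

/-- The union of the forward orbits `f(E), f²(E), …` of the exceptional lines `E` of `f`.
An orbit stops when it meets the indeterminacy locus, the strict transform of an
indeterminate point being empty. -/
def baseLocus (f : PlaneMap) : Set P2 :=
  {q | ∃ W : Submodule ℂ Vec, Module.finrank ℂ W = 2 ∧
    (∃ r, f.strictImage (pointsOf W) = {r}) ∧
    ∃ j : ℕ, 1 ≤ j ∧ f.strictImage^[j] (pointsOf W) = {q}}

end PlaneMap

/-- Three distinct lines of the projective plane (planes of `ℂ³`) through a common point. -/
structure IsConcurrentTriple (L : Fin 3 → Submodule ℂ Vec) : Prop where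
  finrank_eq : ∀ i, Module.finrank ℂ (L i) = 2
  injective : Function.Injective L
  concurrent : ∃ z : Vec, z ≠ 0 ∧ ∀ i, z ∈ L i

/-- The cubic `L₁ ∪ L₂ ∪ L₃`. -/
def cubic (L : Fin 3 → Submodule ℂ Vec) : Set P2 := {p | ∃ i, p ∈ pointsOf (L i)}

/-- `f` properly fixes the cubic: `f(C) = C`, and the common point of the three lines is
indeterminate neither for `f` nor for its inverse. -/
def PlaneMap.ProperlyFixes (f : PlaneMap) (L : Fin 3 → Submodule ℂ Vec) : Prop :=
  f.strictImage (cubic L) = cubic L ∧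
    ∀ o : P2, (∀ i, o ∈ pointsOf (L i)) →
      o ∉ f.indet ∧ ∀ g, f.IsInverse g → o ∉ g.indet

/-- Linear coordinates on three concurrent lines: a vector `z` spanning the common point, and
vectors `wᵢ` with sum zero such that `Lᵢ` is spanned by `z` and `wᵢ`. -/
structure LineCoords (L : Fin 3 → Submodule ℂ Vec) where
  z : Vec
  w : Fin 3 → Vec
  z_ne_zero : z ≠ 0
  z_mem : ∀ i, z ∈ L i
  w_mem : ∀ i, w i ∈ L i
  w_notMem : ∀ i, w i ∉ Submodule.span ℂ {z}
  w_sum : w 0 + w 1 + w 2 = 0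

namespace LineCoords

variable {L : Fin 3 → Submodule ℂ Vec}

theorem vec_ne_zero (γ : LineCoords L) (i : Fin 3) (t : ℂ) : t • γ.z + γ.w i ≠ 0 := by
  intro h
  refine γ.w_notMem i (Submodule.mem_span_singleton.2 ⟨-t, ?_⟩)
  rw [neg_smul]
  exact (eq_neg_of_add_eq_zero_right h).symm

/-- The point `(t, i) = [t z + wᵢ]` of the line `Lᵢ`. With `z = (1,0,0)`, `w₁ = (0,-1,-1)`,
`w₂ = (0,1,0)`, `w₃ = (0,0,1)` these are `[-t:1:1]`, `[t:1:0]`, `[t:0:1]`. -/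
def pt (γ : LineCoords L) (i : Fin 3) (t : ℂ) : P2 :=
  Projectivization.mk ℂ _ (γ.vec_ne_zero i t)

end LineCoords

/-- In the coordinates `γ`, the restriction of `f` to the cubic is
`(t, i) ↦ (α (t - 1) + 1, τ(i))` for some permutation `τ` of the lines. -/
def PlaneMap.IsNormalizedOn (f : PlaneMap) {L : Fin 3 → Submodule ℂ Vec} (γ : LineCoords L)
    (α : ℂ) : Prop :=
  ∃ τ : Equiv.Perm (Fin 3), ∀ i t, γ.pt i t ∉ f.indet →
    f.Sends (γ.pt i t) (γ.pt (τ i) (α * (t - 1) + 1))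

/-- `f` is a quadratic birational map properly fixing `L₁ ∪ L₂ ∪ L₃` with orbit data
`n, n, n` and `σ`, the points of indeterminacy being labelled by the lines: `pᵢ ∈ Lᵢ`. -/
def PlaneMap.Realizes (f : PlaneMap) (L : Fin 3 → Submodule ℂ Vec) (n : ℕ)
    (σ : Equiv.Perm (Fin 3)) : Prop :=
  f.IsQuadraticBirational ∧ f.ProperlyFixes L ∧
    ∃ p : Fin 3 → P2, (∀ i, p i ∈ pointsOf (L i)) ∧ f.HasOrbitData p (fun _ => n) σ

/-- `x` is a root of `t^(n+1) - 2 t^n + 2 t - 1`. -/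
def IsChiRoot {K : Type*} [Field K] (n : ℕ) (x : K) : Prop :=
  x ^ (n + 1) - 2 * x ^ n + 2 * x - 1 = 0

end PlaneCremona

end

open MvPolynomial Filter Topology
open scoped LinearAlgebra.Projectivization

noncomputable section

namespace PlaneCremona

/-! ### Homogeneous polynomials and their factors -/

section Homogeneous

variable {R : Type*} [CommRing R] [Algebra ℂ R]

/-! Put T = Σ tᵢ and S = Σ sᵢ. Since the wᵢ sum to zero, the matrix with columns tᵢ z + w_(τ i)
sends (1,1,1) to T z. So if A has columns tᵢ z + wᵢ and B has columns sᵢ z + w_(τ i), with T and S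
nonzero, then B ∘ J ∘ A⁻¹ fixes o, is indeterminate exactly at the points γᵢ(tᵢ), contracts the
opposite lines to γ_(τ i)(sᵢ), and carries Lᵢ to L_(τ i) by an affine map of slope −S/T, the same
for all i (`ev_stdTriple_vec`).

Every quadratic map properly fixing C has this form (`exists_std`). On Lᵢ it is a quotient of a
quadratic by a nonzero linear polynomial; birationality makes it injective off a finite set, so
numerator and denominator have a common zero, which is a point of indeterminacy. The three points
obtained are not collinear, and in the frame they span all squares disappear from the quadratic
triple, which leaves J followed by a linear map.

Orbit data thus become conditions on the parameters (`orb_of_realizes`), among them τⁿ = σ. As n² ≡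
1 mod 6, this means τ = σⁿ. Summing the three orbits removes τ and gives χₙ(α) = 0 for the slope α.
Kronecker's theorem leaves only ±1 as possible roots of unity, and these two contradict the
prescribed orbit lengths. Hence f has an invariant section of the three lines, and moving it to the
parameter 1 normalizes f. For a normalized map the condition on the tᵢ is an affine recursion
twisted by σ with factor αⁿ. Since α⁶ⁿ ≠ 1, the tᵢ are all equal, and then t = α⁻¹ − 1 and s = α − 1
for every σ (`params_of_isNormalizedOn`). The six maps differ only in τ, which a base locus
consisting of whole triples of points does not see.

For the dynamical degree, the degree of the reduced iterate is followed together with its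
multiplicities along the orbits (`exists_basic_step`). The result is a linear recursion with
characteristic polynomial χₙ, starting from powers of 2. Dividing χₙ by (t − 1)(t − δ⁻¹) leaves a
recursion with nonnegative coefficients, so comparison with multiples of δᵏ gives δᵏ ≤ deg fᵏ ≤ c δᵏ
(`degree_bounds`). -/

theorem aeval_mul_of_isHomogeneous {P : MvPolynomial (Fin 3) ℂ} {d : ℕ} (hP : P.IsHomogeneous d)
    (c : R) (a : Fin 3 → R) : aeval (fun i => c * a i) P = c ^ d * aeval a P := by
  rw [aeval_def, aeval_def, eval₂_eq', eval₂_eq', Finset.mul_sum]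
  refine Finset.sum_congr rfl fun s hs => ?_
  have hd : d = ∑ i, s i := by
    rw [hP.degree_eq_sum_deg_support hs]
    exact Finset.sum_subset (Finset.subset_univ _) fun i _ hi => by simpa using hi
  rw [show (∏ i, (c * a i) ^ s i) = c ^ d * ∏ i, a i ^ s i by
    rw [hd, ← Finset.prod_pow_eq_pow_sum, ← Finset.prod_mul_distrib]
    exact Finset.prod_congr rfl fun i _ => mul_pow _ _ _]
  ring

/-- The substitution `xᵢ ↦ ε xᵢ`. -/
def scaleVars : MvPolynomial (Fin 3) ℂ →ₐ[ℂ] Polynomial (MvPolynomial (Fin 3) ℂ) :=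
  aeval fun i => Polynomial.X * Polynomial.C (X i)

theorem aeval_C_X (P : MvPolynomial (Fin 3) ℂ) :
    aeval (fun i => (Polynomial.C (X i) : Polynomial (MvPolynomial (Fin 3) ℂ))) P =
      Polynomial.C P := by
  induction P using MvPolynomial.induction_on with
  | C a => simp [Polynomial.algebraMap_apply, algebraMap_eq]
  | add p q hp hq => simp [hp, hq]
  | mul_X p i hp => simp [hp]

theorem scaleVars_of_isHomogeneous {P : MvPolynomial (Fin 3) ℂ} {d : ℕ} (hP : P.IsHomogeneous d) :
    scaleVars P = Polynomial.X ^ d * Polynomial.C P := by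
  rw [scaleVars, aeval_mul_of_isHomogeneous hP]
  congr 1
  exact aeval_C_X P

theorem eval_one_scaleVars (P : MvPolynomial (Fin 3) ℂ) : (scaleVars P).eval 1 = P := by
  induction P using MvPolynomial.induction_on with
  | C a => simp [scaleVars, Polynomial.algebraMap_apply, algebraMap_eq]
  | add p q hp hq => simp [hp, hq]
  | mul_X p i hp =>
    rw [map_mul, Polynomial.eval_mul, hp]
    simp [scaleVars]

theorem coeff_scaleVars (P : MvPolynomial (Fin 3) ℂ) (k : ℕ) :
    (scaleVars P).coeff k = homogeneousComponent k P := by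
  conv_lhs => rw [← sum_homogeneousComponent P, map_sum, Polynomial.finsetSum_coeff]
  simp_rw [scaleVars_of_isHomogeneous (homogeneousComponent_isHomogeneous _ P),
    Polynomial.coeff_X_pow_mul', Polynomial.coeff_C]
  by_cases hk : k ∈ Finset.range (P.totalDegree + 1)
  · rw [Finset.sum_eq_single_of_mem k hk]
    · simp
    · intro b _ hb
      split_ifs <;> first | rfl | omega
  · rw [homogeneousComponent_eq_zero]
    · refine Finset.sum_eq_zero fun b hb => ?_
      simp only [Finset.mem_range] at hk hb
      split_ifs <;> first | rfl | omega
    · simp only [Finset.mem_range] at hk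
      omega

theorem scaleVars_ne_zero {P : MvPolynomial (Fin 3) ℂ} (hP : P ≠ 0) : scaleVars P ≠ 0 := by
  intro h
  apply hP
  rw [← eval_one_scaleVars P, h, Polynomial.eval_zero]

/-- Factors of a nonzero homogeneous polynomial are homogeneous. -/
theorem isHomogeneous_of_mul {a b : MvPolynomial (Fin 3) ℂ} {d : ℕ}
    (h : (a * b).IsHomogeneous d) (h0 : a * b ≠ 0) :
    ∃ e, a.IsHomogeneous e ∧ e ≤ d := by
  have ha := scaleVars_ne_zero (left_ne_zero_of_mul h0)
  have hb := scaleVars_ne_zero (right_ne_zero_of_mul h0)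
  have hab := scaleVars_of_isHomogeneous h
  rw [map_mul] at hab
  -- Degree and trailing degree in ε are both additive over a domain. They agree for the product, a
  -- monomial in ε, hence for each factor.
  have h1 := Polynomial.natDegree_mul ha hb
  have h2 := Polynomial.natTrailingDegree_mul ha hb
  have h3 : (scaleVars a * scaleVars b).natDegree = d := by
    rw [hab, mul_comm, Polynomial.natDegree_C_mul_X_pow d _ h0]
  have h4 : (scaleVars a * scaleVars b).natTrailingDegree = d := by
    rw [hab, mul_comm, Polynomial.C_mul_X_pow_eq_monomial,
      Polynomial.natTrailingDegree_monomial h0]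
  have h5 := Polynomial.natTrailingDegree_le_natDegree (scaleVars a)
  have h6 := Polynomial.natTrailingDegree_le_natDegree (scaleVars b)
  refine ⟨(scaleVars a).natDegree, ?_, by omega⟩
  have h7 : scaleVars a = Polynomial.C ((scaleVars a).coeff (scaleVars a).natDegree) *
      Polynomial.X ^ (scaleVars a).natDegree := by
    ext k : 1
    rw [Polynomial.coeff_C_mul, Polynomial.coeff_X_pow]
    split_ifs with hk
    · rw [hk, mul_one]
    · rw [mul_zero]
      rcases lt_or_gt_of_ne hk with hk | hk
      · exact Polynomial.coeff_eq_zero_of_lt_natTrailingDegree (by omega)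
      · exact Polynomial.coeff_eq_zero_of_natDegree_lt hk
  have h8 := congrArg (Polynomial.eval 1) h7
  rw [eval_one_scaleVars, coeff_scaleVars] at h8
  have h9 := homogeneousComponent_isHomogeneous (scaleVars a).natDegree a
  rw [Polynomial.eval_mul, Polynomial.eval_C, Polynomial.eval_pow, Polynomial.eval_X, one_pow,
    mul_one] at h8
  rwa [← h8] at h9

/-- A cofactor of a homogeneous polynomial in a homogeneous polynomial is homogeneous. -/
theorem isHomogeneous_right_of_mul {a b : MvPolynomial (Fin 3) ℂ} {d e : ℕ}
    (h : (a * b).IsHomogeneous (e + d)) (ha : a.IsHomogeneous e) (h0 : a ≠ 0) :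
    b.IsHomogeneous d := by
  by_cases hb : b = 0
  · rw [hb]
    exact isHomogeneous_zero _ _ _
  · rw [mul_comm] at h
    obtain ⟨k, hk, -⟩ := isHomogeneous_of_mul h (mul_ne_zero hb h0)
    have := (hk.mul ha).inj_right h (mul_ne_zero hb h0)
    obtain rfl : k = d := by omega
    exact hk

end Homogeneous

/-! ### Triples without common factor -/

section Reduced

/-- The entries of the triple have no common factor. -/
def Reduced (F : Triple) : Prop := ∀ h, (∀ i, h ∣ F i) → IsUnit h

theorem Reduced.exists_ne_zero {F : Triple} (hF : Reduced F) : ∃ i, F i ≠ 0 := by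
  by_contra! h
  exact not_isUnit_zero (hF 0 fun i => by rw [h i])

theorem Reduced.ne_zero {F : Triple} (hF : Reduced F) : F ≠ 0 := by
  obtain ⟨i, hi⟩ := hF.exists_ne_zero
  rintro rfl
  exact hi rfl

/-- The gcd of the products is b times the gcd of the entries, and the latter is a unit. -/
theorem Reduced.dvd_of_forall_dvd_mul {F : Triple} (hF : Reduced F) {a b : MvPolynomial (Fin 3) ℂ}
    (h : ∀ i, a ∣ b * F i) : a ∣ b := by
  let _ : GCDMonoid (MvPolynomial (Fin 3) ℂ) := UniqueFactorizationMonoid.toGCDMonoid _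
  have h1 : IsUnit (gcd (F 0) (gcd (F 1) (F 2))) := by
    refine hF _ fun i => ?_
    fin_cases i
    · exact gcd_dvd_left _ _
    · exact (gcd_dvd_right _ _).trans (gcd_dvd_left _ _)
    · exact (gcd_dvd_right _ _).trans (gcd_dvd_right _ _)
  have h2 : a ∣ b * gcd (F 0) (gcd (F 1) (F 2)) := by
    rw [← (gcd_mul_left' b _ _).dvd_iff_dvd_right]
    refine dvd_gcd (h 0) ?_
    rw [← ((gcd_mul_left' b _ _)).dvd_iff_dvd_right]
    exact dvd_gcd (h 1) (h 2)
  exact (h1.dvd_mul_right).1 h2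

/-- A reduced triple is the minimal representative of its rational map. This makes degree,
definedness and values at points computable from a single triple. -/
theorem Reduced.exists_eq_mul {F G : Triple} (hF : Reduced F) (h : Proportional G F) :
    ∃ c, ∀ i, G i = c * F i := by
  obtain ⟨i, hi⟩ := hF.exists_ne_zero
  obtain ⟨c, hc⟩ := hF.dvd_of_forall_dvd_mul (a := F i) (b := G i) fun j =>
    ⟨G j, by rw [h i j, mul_comm]⟩
  refine ⟨c, fun j => mul_right_cancel₀ hi ?_⟩
  rw [h j i, hc]
  ring

theorem exists_reduced {F : Triple} {d : ℕ} (hF : F ≠ 0) (hd : ∀ i, (F i).IsHomogeneous d) :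
    ∃ (D : MvPolynomial (Fin 3) ℂ) (G : Triple) (e k : ℕ), D ≠ 0 ∧ D.IsHomogeneous k ∧ k + e = d ∧
      Reduced G ∧ (∀ i, (G i).IsHomogeneous e) ∧ ∀ i, F i = D * G i := by
  let _ : NormalizedGCDMonoid (MvPolynomial (Fin 3) ℂ) :=
    Classical.arbitrary _
  obtain ⟨G, hG, hG1⟩ := Finset.extract_gcd F (s := Finset.univ) Finset.univ_nonempty
  have hD : Finset.univ.gcd F ≠ 0 := by
    intro h
    exact hF (funext fun i => Finset.gcd_eq_zero_iff.1 h i (Finset.mem_univ i))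
  obtain ⟨i, hi⟩ := Function.ne_iff.1 hF
  have hi' := hG i (Finset.mem_univ i)
  obtain ⟨k, hk, hkd⟩ := isHomogeneous_of_mul (hi' ▸ hd i) (hi' ▸ hi)
  refine ⟨_, G, d - k, k, hD, hk, by omega, ?_, fun j => ?_, fun j => hG j (Finset.mem_univ j)⟩
  · intro h hh
    refine isUnit_of_dvd_one (hG1 ▸ Finset.dvd_gcd fun j _ => hh j)
  · refine isHomogeneous_right_of_mul ?_ hk hD
    rw [← hG j (Finset.mem_univ j), show k + (d - k) = d by omega]
    exact hd j

theorem Proportional.symm {F G : Triple} (h : Proportional F G) : Proportional G F :=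
  fun i j => by rw [mul_comm, h j i, mul_comm]

theorem proportional_of_eq_mul {F G : Triple} {c : MvPolynomial (Fin 3) ℂ}
    (h : ∀ i, G i = c * F i) : Proportional G F := fun i j => by rw [h i, h j]; ring

/-- The middle triple must be nonzero, because the zero triple is proportional to every triple. -/
theorem Proportional.trans {F G H : Triple} (h : Proportional F G) (h' : Proportional G H)
    (hG : G ≠ 0) : Proportional F H := by
  obtain ⟨k, hk⟩ := Function.ne_iff.1 hG
  intro i j
  apply mul_right_cancel₀ hk
  apply mul_right_cancel₀ hk
  calc F i * H j * G k * G k = (F i * G k) * (G k * H j) := by ring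
    _ = (F k * G i) * (G j * H k) := by rw [h i k, h' k j]
    _ = (F k * G j) * (G i * H k) := by ring
    _ = (F j * G k) * (G k * H i) := by rw [h k j, h' i k]
    _ = _ := by ring

theorem Reduced.tripleDegree_eq {F H : Triple} {d : ℕ} (hF : Reduced F)
    (hd : ∀ i, (F i).IsHomogeneous d) {h : MvPolynomial (Fin 3) ℂ} (h0 : h ≠ 0)
    (hH : ∀ i, H i = h * F i) : tripleDegree H = d := by
  have hH0 : H ≠ 0 := by
    obtain ⟨i, hi⟩ := hF.exists_ne_zero
    intro h1
    exact mul_ne_zero h0 hi ((hH i).symm.trans (congrFun h1 i))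
  refine le_antisymm (Nat.sInf_le ⟨F, hd, hF.ne_zero, (proportional_of_eq_mul hH).symm⟩) ?_
  refine le_csInf ⟨d, F, hd, hF.ne_zero, (proportional_of_eq_mul hH).symm⟩ ?_
  rintro e ⟨G, hG, hG0, hGH⟩
  obtain ⟨c, hc⟩ := hF.exists_eq_mul (hGH.trans (proportional_of_eq_mul hH) hH0)
  obtain ⟨i, hi⟩ := Function.ne_iff.1 hG0
  have h1 := (hG i).totalDegree hi
  have h2 : c ≠ 0 ∧ F i ≠ 0 := by
    rw [← mul_ne_zero_iff, ← hc i]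
    exact hi
  rw [hc i, totalDegree_mul_of_isDomain h2.1 h2.2, (hd i).totalDegree h2.2] at h1
  omega

end Reduced

/-! ### Triples as polynomial maps of ℂ³, and linear substitutions -/

section Evaluation

/-- The values of the entries of a triple. -/
def ev (F : Triple) (x : Vec) : Vec := fun i => eval x (F i)

theorem aeval_complex (x : Vec) (P : MvPolynomial (Fin 3) ℂ) : aeval x P = eval x P := by
  rw [← coe_aeval_eq_eval]
  rfl

@[simp] theorem ev_tripleComp (G F : Triple) (x : Vec) :
    ev (tripleComp G F) x = ev G (ev F x) := by
  funext i
  simp only [ev, tripleComp, ← aeval_complex, aeval_bind₁]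
  rfl

@[simp] theorem ev_linearTriple (M : Matrix (Fin 3) (Fin 3) ℂ) (x : Vec) :
    ev (linearTriple M) x = M.mulVec x := by
  funext i
  simp [ev, linearTriple, Matrix.mulVec, dotProduct]

theorem ev_cremonaTriple (x : Vec) :
    ev cremonaTriple x = ![x 1 * x 2, x 0 * x 2, x 0 * x 1] := by
  funext i
  fin_cases i <;> simp [ev, cremonaTriple]

theorem eval_smul_of_isHomogeneous {P : MvPolynomial (Fin 3) ℂ} {d : ℕ} (h : P.IsHomogeneous d)
    (c : ℂ) (x : Vec) : eval (c • x) P = c ^ d * eval x P := by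
  rw [← aeval_complex, ← aeval_complex, ← aeval_mul_of_isHomogeneous h]
  rfl

theorem ev_smul {F : Triple} {d : ℕ} (h : ∀ i, (F i).IsHomogeneous d) (c : ℂ) (x : Vec) :
    ev F (c • x) = c ^ d • ev F x := by
  funext i
  exact eval_smul_of_isHomogeneous (h i) c x

theorem tripleComp_assoc (H G F : Triple) :
    tripleComp (tripleComp H G) F = tripleComp H (tripleComp G F) := by
  funext i
  exact bind₁_bind₁ _ _ _

theorem IsHomogeneous.bind₁ {P : MvPolynomial (Fin 3) ℂ} {F : Triple} {d e : ℕ}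
    (hP : P.IsHomogeneous d) (hF : ∀ i, (F i).IsHomogeneous e) :
    (MvPolynomial.bind₁ F P).IsHomogeneous (e * d) :=
  hP.aeval F hF

theorem bind₁_mul_triple {P h : MvPolynomial (Fin 3) ℂ} {F : Triple} {d : ℕ}
    (hP : P.IsHomogeneous d) :
    MvPolynomial.bind₁ (fun i => h * F i) P = h ^ d * MvPolynomial.bind₁ F P :=
  aeval_mul_of_isHomogeneous hP h F

theorem ext_ev {F G : Triple} (h : ∀ x, ev F x = ev G x) : F = G := by
  funext i
  apply MvPolynomial.funext
  intro x
  exact congrFun (h x) i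

end Evaluation

section Linear

theorem bind₁_linearTriple_comp (A B : Matrix (Fin 3) (Fin 3) ℂ) :
    tripleComp (linearTriple A) (linearTriple B) = linearTriple (A * B) := by
  apply ext_ev
  intro x
  simp

theorem linearTriple_one : linearTriple 1 = fun i => X i := by
  apply ext_ev
  intro x
  rw [ev_linearTriple, Matrix.one_mulVec]
  funext i
  simp [ev]

theorem linearTriple_isHomogeneous (A : Matrix (Fin 3) (Fin 3) ℂ) (i : Fin 3) :
    (linearTriple A i).IsHomogeneous 1 :=
  IsHomogeneous.sum _ _ _ fun _ _ => isHomogeneous_C_mul_X _ _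

/-- The linear substitution `x ↦ A x` as an automorphism of the polynomial ring. -/
def linEquiv (A : GL (Fin 3) ℂ) : MvPolynomial (Fin 3) ℂ ≃ₐ[ℂ] MvPolynomial (Fin 3) ℂ :=
  AlgEquiv.ofAlgHom
    (bind₁ (linearTriple (A : Matrix (Fin 3) (Fin 3) ℂ)))
    (bind₁ (linearTriple ((A⁻¹ : GL (Fin 3) ℂ) : Matrix (Fin 3) (Fin 3) ℂ)))
    (by
      ext i : 1
      have h := congrFun (bind₁_linearTriple_comp ((A⁻¹ : GL (Fin 3) ℂ) : Matrix _ _ ℂ)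
        (A : Matrix _ _ ℂ)) i
      rw [← Units.val_mul, inv_mul_cancel, Units.val_one, linearTriple_one] at h
      simpa [tripleComp] using h)
    (by
      ext i : 1
      have h := congrFun (bind₁_linearTriple_comp (A : Matrix _ _ ℂ)
        ((A⁻¹ : GL (Fin 3) ℂ) : Matrix _ _ ℂ)) i
      rw [← Units.val_mul, mul_inv_cancel, Units.val_one, linearTriple_one] at h
      simpa [tripleComp] using h)

theorem linEquiv_apply (A : GL (Fin 3) ℂ) (P : MvPolynomial (Fin 3) ℂ) :
    linEquiv A P = bind₁ (linearTriple (A : Matrix (Fin 3) (Fin 3) ℂ)) P := rfl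

theorem inv_mulVec_mulVec (A : GL (Fin 3) ℂ) (x : Vec) :
    ((A⁻¹ : GL (Fin 3) ℂ) : Matrix (Fin 3) (Fin 3) ℂ).mulVec
      ((A : Matrix (Fin 3) (Fin 3) ℂ).mulVec x) = x := by
  rw [Matrix.mulVec_mulVec, ← Units.val_mul, inv_mul_cancel, Units.val_one, Matrix.one_mulVec]

theorem mulVec_inv_mulVec (A : GL (Fin 3) ℂ) (x : Vec) :
    (A : Matrix (Fin 3) (Fin 3) ℂ).mulVec
      (((A⁻¹ : GL (Fin 3) ℂ) : Matrix (Fin 3) (Fin 3) ℂ).mulVec x) = x := by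
  rw [Matrix.mulVec_mulVec, ← Units.val_mul, mul_inv_cancel, Units.val_one, Matrix.one_mulVec]

theorem mulVec_eq_zero_iff (A : GL (Fin 3) ℂ) (x : Vec) :
    (A : Matrix (Fin 3) (Fin 3) ℂ).mulVec x = 0 ↔ x = 0 := by
  constructor
  · intro h
    rw [← inv_mulVec_mulVec A x, h, Matrix.mulVec_zero]
  · rintro rfl
    exact Matrix.mulVec_zero _

theorem Reduced.comp_linear {F : Triple} (hF : Reduced F) (A : GL (Fin 3) ℂ) :
    Reduced (tripleComp F (linearTriple (A : Matrix (Fin 3) (Fin 3) ℂ))) := by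
  intro h hh
  have := hF ((linEquiv A).symm h) fun i => by
    have := map_dvd (linEquiv A).symm (hh i)
    rwa [show tripleComp F (linearTriple (A : Matrix (Fin 3) (Fin 3) ℂ)) i = linEquiv A (F i)
      from rfl, AlgEquiv.symm_apply_apply] at this
  simpa using this

theorem Reduced.linear_comp {F : Triple} (hF : Reduced F) (B : GL (Fin 3) ℂ) :
    Reduced (tripleComp (linearTriple (B : Matrix (Fin 3) (Fin 3) ℂ)) F) := by
  intro h hh
  apply hF h
  intro i
  have h1 : F = tripleComp (linearTriple ((B⁻¹ : GL (Fin 3) ℂ) : Matrix (Fin 3) (Fin 3) ℂ))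
      (tripleComp (linearTriple (B : Matrix (Fin 3) (Fin 3) ℂ)) F) := by
    apply ext_ev
    intro x
    simp only [ev_tripleComp, ev_linearTriple, inv_mulVec_mulVec]
  rw [h1]
  simp only [tripleComp, linearTriple, map_sum, map_mul]
  refine Finset.dvd_sum fun j _ => Dvd.dvd.mul_left ?_ _
  rw [bind₁_X_right]
  simpa [tripleComp, linearTriple] using hh j

end Linear

/-! ### Basic quadratic maps and their inverses -/

section Basic

/-- The values of the standard Cremona involution. -/
def cremona (x : Vec) : Vec := ![x 1 * x 2, x 0 * x 2, x 0 * x 1]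

theorem cremonaTriple_isHomogeneous (i : Fin 3) : (cremonaTriple i).IsHomogeneous 2 := by
  fin_cases i <;> exact (isHomogeneous_X ℂ _).mul (isHomogeneous_X ℂ _)

theorem reduced_cremonaTriple : Reduced cremonaTriple := by
  intro h hh
  by_contra hu
  have h0 : h ≠ 0 := by
    rintro rfl
    have := hh 0
    rw [zero_dvd_iff] at this
    exact mul_ne_zero (X_ne_zero _) (X_ne_zero _) this
  obtain ⟨p, hp, hph⟩ := WfDvdMonoid.exists_irreducible_factor hu h0
  have hp' := hp.prime
  have key : ∀ i j k : Fin 3, p ∣ X i → p ∣ X j * X k → i ≠ j → i ≠ k → False := by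
    intro i j k h1 h2 hij hik
    have h3 : X i ∣ p := (hp.dvd_comm (X_prime (i := i) (R := ℂ)).irreducible).1 h1
    rcases (X_prime (i := i) (R := ℂ)).dvd_or_dvd (h3.trans h2) with h4 | h4
    · exact hij (X_dvd_X.1 h4)
    · exact hik (X_dvd_X.1 h4)
  have h12 : p ∣ X 1 * X 2 := hph.trans (hh 0)
  have h02 : p ∣ X 0 * X 2 := hph.trans (hh 1)
  have h01 : p ∣ X 0 * X 1 := hph.trans (hh 2)
  rcases hp'.dvd_or_dvd h12 with h | h
  · exact key 1 0 2 h h02 (by decide) (by decide)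
  · exact key 2 0 1 h h01 (by decide) (by decide)

/-- The triple of the basic map `B ∘ J ∘ A⁻¹`. -/
def basicTriple (A B : GL (Fin 3) ℂ) : Triple :=
  tripleComp (linearTriple (B : Matrix (Fin 3) (Fin 3) ℂ))
    (tripleComp cremonaTriple
      (linearTriple ((A⁻¹ : GL (Fin 3) ℂ) : Matrix (Fin 3) (Fin 3) ℂ)))

theorem ev_basicTriple (A B : GL (Fin 3) ℂ) (x : Vec) :
    ev (basicTriple A B) x = (B : Matrix (Fin 3) (Fin 3) ℂ).mulVec
      (cremona (((A⁻¹ : GL (Fin 3) ℂ) : Matrix (Fin 3) (Fin 3) ℂ).mulVec x)) := by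
  simp only [basicTriple, ev_tripleComp, ev_linearTriple, ev_cremonaTriple, cremona]

theorem basicTriple_isHomogeneous (A B : GL (Fin 3) ℂ) (i : Fin 3) :
    (basicTriple A B i).IsHomogeneous 2 :=
  IsHomogeneous.bind₁ (linearTriple_isHomogeneous _ i) fun j =>
    IsHomogeneous.bind₁ (cremonaTriple_isHomogeneous j) (linearTriple_isHomogeneous _)

theorem reduced_basicTriple (A B : GL (Fin 3) ℂ) : Reduced (basicTriple A B) :=
  (reduced_cremonaTriple.comp_linear A⁻¹).linear_comp B

/-- The product of the linear forms of the exceptional lines of a basic map. -/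
def axisProd (A : GL (Fin 3) ℂ) : MvPolynomial (Fin 3) ℂ :=
  ∏ i, linearTriple ((A⁻¹ : GL (Fin 3) ℂ) : Matrix (Fin 3) (Fin 3) ℂ) i

theorem linearTriple_ne_zero (A : GL (Fin 3) ℂ) (i : Fin 3) :
    linearTriple (A : Matrix (Fin 3) (Fin 3) ℂ) i ≠ 0 := by
  have : linearTriple (A : Matrix (Fin 3) (Fin 3) ℂ) i = linEquiv A (X i) := by
    rw [linEquiv_apply, bind₁_X_right]
  rw [this]
  simp

theorem axisProd_ne_zero (A : GL (Fin 3) ℂ) : axisProd A ≠ 0 :=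
  Finset.prod_ne_zero_iff.2 fun i _ => linearTriple_ne_zero A⁻¹ i

theorem eval_axisProd (A : GL (Fin 3) ℂ) (x : Vec) : eval x (axisProd A) =
    ∏ i, ((A⁻¹ : GL (Fin 3) ℂ) : Matrix (Fin 3) (Fin 3) ℂ).mulVec x i := by
  rw [axisProd, map_prod]
  exact Finset.prod_congr rfl fun i _ => congrFun (ev_linearTriple _ x) i

theorem cremona_cremona (x : Vec) : cremona (cremona x) = (∏ i, x i) • x := by
  funext i
  fin_cases i <;> simp [cremona, Fin.prod_univ_three] <;> ring

theorem ev_basicTriple_ev_basicTriple (A B : GL (Fin 3) ℂ) (x : Vec) :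
    ev (basicTriple B A) (ev (basicTriple A B) x) = eval x (axisProd A) • x := by
  rw [ev_basicTriple, ev_basicTriple, inv_mulVec_mulVec, cremona_cremona, Matrix.mulVec_smul,
    mulVec_inv_mulVec, eval_axisProd]

theorem basicTriple_comp_basicTriple (A B : GL (Fin 3) ℂ) :
    tripleComp (basicTriple B A) (basicTriple A B) = fun i => axisProd A * X i := by
  apply ext_ev
  intro x
  rw [ev_tripleComp, ev_basicTriple_ev_basicTriple]
  funext i
  simp [ev]

/-- A basic map is dominant: every vector off the exceptional lines of the inverse is a value of the
triple, so a polynomial that pulls back to zero vanishes there. -/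
theorem bind₁_basicTriple_ne_zero (A B : GL (Fin 3) ℂ) {P : MvPolynomial (Fin 3) ℂ} (hP : P ≠ 0) :
    bind₁ (basicTriple A B) P ≠ 0 := by
  intro h
  apply mul_ne_zero hP (axisProd_ne_zero B)
  apply MvPolynomial.funext
  intro y
  rw [map_mul, map_zero]
  by_cases hy : eval y (axisProd B) = 0
  · rw [hy, mul_zero]
  · obtain ⟨s, hs⟩ := IsAlgClosed.exists_pow_nat_eq (eval y (axisProd B))⁻¹ (n := 2) (by norm_num)
    have h1 : eval (ev (basicTriple A B) (s • ev (basicTriple B A) y)) P = 0 := by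
      have := congrArg (eval (s • ev (basicTriple B A) y)) h
      rw [← aeval_complex, aeval_bind₁, map_zero] at this
      rw [← aeval_complex, ← this]
      congr
    rw [ev_smul (basicTriple_isHomogeneous A B), hs, ev_basicTriple_ev_basicTriple, smul_smul,
      inv_mul_cancel₀ hy, one_smul] at h1
    rw [h1, zero_mul]

/-- The basic map `B ∘ J ∘ A⁻¹`. -/
def basicMap (A B : GL (Fin 3) ℂ) : PlaneMap where
  coord := basicTriple A B
  deg := 2
  homogeneous := basicTriple_isHomogeneous A B
  ne_zero := (reduced_basicTriple A B).ne_zero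

theorem basicMap_isInverse (A B : GL (Fin 3) ℂ) : (basicMap A B).IsInverse (basicMap B A) :=
  ⟨⟨axisProd A, axisProd_ne_zero A, fun i => congrFun (basicTriple_comp_basicTriple A B) i⟩,
    ⟨axisProd B, axisProd_ne_zero B, fun i => congrFun (basicTriple_comp_basicTriple B A) i⟩⟩

theorem basicMap_isQuadraticBirational (A B : GL (Fin 3) ℂ) :
    (basicMap A B).IsQuadraticBirational :=
  ⟨(reduced_basicTriple A B).tripleDegree_eq (basicTriple_isHomogeneous A B) one_ne_zero
    fun i => by rw [one_mul]; rfl, _, basicMap_isInverse A B⟩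

/-- Uniqueness of the inverse: substitute the known inverse triple into the identity g ∘ f = h · id
and cancel the nonzero factors. -/
theorem proportional_basicTriple_of_isInverse {A B : GL (Fin 3) ℂ} {f g : PlaneMap}
    (hf : Proportional f.coord (basicTriple A B)) (hg : f.IsInverse g) :
    Proportional g.coord (basicTriple B A) := by
  obtain ⟨⟨h, h0, hh⟩, -⟩ := hg
  obtain ⟨c, hc⟩ := (reduced_basicTriple A B).exists_eq_mul hf
  have hc0 : c ≠ 0 := by
    rintro rfl
    exact f.ne_zero (funext fun i => by rw [hc i, zero_mul]; rfl)
  have h1 : ∀ i, bind₁ (basicTriple B A) c ^ g.deg * axisProd B ^ g.deg * g.coord i =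
      bind₁ (basicTriple B A) h * basicTriple B A i := by
    intro i
    have h2 := hh i
    rw [tripleComp, show f.coord = fun i => c * basicTriple A B i from funext hc,
      bind₁_mul_triple (g.homogeneous i)] at h2
    have h3 := congrArg (bind₁ (basicTriple B A)) h2
    rw [map_mul, map_pow, map_mul, bind₁_X_right, bind₁_bind₁] at h3
    rw [← h3, mul_assoc]
    congr 1
    have h4 : (fun i => bind₁ (basicTriple B A) (basicTriple A B i)) = _ :=
      basicTriple_comp_basicTriple B A
    rw [h4, bind₁_mul_triple (g.homogeneous i)]
    congr 1
    exact (aeval_X_left_apply _).symm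
  have h5 : bind₁ (basicTriple B A) c ^ g.deg * axisProd B ^ g.deg ≠ 0 :=
    mul_ne_zero (pow_ne_zero _ (bind₁_basicTriple_ne_zero B A hc0))
      (pow_ne_zero _ (axisProd_ne_zero B))
  intro i j
  apply mul_left_cancel₀ h5
  calc _ = (bind₁ (basicTriple B A) c ^ g.deg * axisProd B ^ g.deg * g.coord i) *
        basicTriple B A j := by ring
    _ = (bind₁ (basicTriple B A) c ^ g.deg * axisProd B ^ g.deg * g.coord j) *
        basicTriple B A i := by rw [h1, h1]; ring
    _ = _ := by ring

end Basic

/-! ### Values, indeterminacy and Zariski closures -/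

section Points

theorem mk_mem_pointsOf {W : Submodule ℂ Vec} {v : Vec} (hv : v ≠ 0) :
    Projectivization.mk ℂ v hv ∈ pointsOf W ↔ v ∈ W := by
  rw [pointsOf, Set.mem_ofPred_eq, Projectivization.submodule_mk,
    Submodule.span_singleton_le_iff_mem]

theorem mem_pointsOf {W : Submodule ℂ Vec} {p : P2} : p ∈ pointsOf W ↔ p.rep ∈ W := by
  rw [pointsOf, Set.mem_ofPred_eq, Projectivization.submodule_eq,
    Submodule.span_singleton_le_iff_mem]

theorem exists_rep_eq_smul {v : Vec} (hv : v ≠ 0) :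
    ∃ a : ℂ, a ≠ 0 ∧ (Projectivization.mk ℂ v hv).rep = a • v := by
  obtain ⟨a, ha⟩ := Projectivization.exists_smul_eq_mk_rep ℂ v hv
  exact ⟨a, a.ne_zero, ha.symm⟩

theorem eval_mk_rep_eq_zero_iff {v : Vec} (hv : v ≠ 0) {P : MvPolynomial (Fin 3) ℂ} {d : ℕ}
    (hP : P.IsHomogeneous d) : eval (Projectivization.mk ℂ v hv).rep P = 0 ↔ eval v P = 0 := by
  obtain ⟨a, ha, h⟩ := exists_rep_eq_smul hv
  rw [h, eval_smul_of_isHomogeneous hP, mul_eq_zero_iff_left (pow_ne_zero _ ha)]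

theorem mk_eq_mk_of_smul {v w : Vec} {hv : v ≠ 0} {hw : w ≠ 0} (a : ℂ) (h : v = a • w) :
    Projectivization.mk ℂ v hv = Projectivization.mk ℂ w hw :=
  (Projectivization.mk_eq_mk_iff' ℂ v w hv hw).2 ⟨a, h.symm⟩

/-- Any other representative is a polynomial multiple of the reduced one, so it cannot be defined at
more points or take other values. -/
theorem PlaneMap.sends_mk_iff {f : PlaneMap} {F : Triple} {d : ℕ} (hF : Reduced F)
    (hd : ∀ i, (F i).IsHomogeneous d) (hf : Proportional f.coord F) {v : Vec} (hv : v ≠ 0) {q : P2} :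
    f.Sends (Projectivization.mk ℂ v hv) q ↔
      ∃ h : ev F v ≠ 0, Projectivization.mk ℂ (ev F v) h = q := by
  obtain ⟨a, ha, hr⟩ := exists_rep_eq_smul hv
  constructor
  · rintro ⟨g, hg, h, rfl⟩
    obtain ⟨c, hc⟩ := hF.exists_eq_mul (Proportional.trans hg hf f.ne_zero)
    have h1 : (fun i => eval (Projectivization.mk ℂ v hv).rep (g.coord i) : Vec) =
        (eval (a • v) c * a ^ d) • ev F v := by
      rw [mul_smul, ← ev_smul hd]
      funext i
      rw [hr, hc i, map_mul]
      rfl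
    have h2 : ev F v ≠ 0 := by
      intro h3
      rw [h3, smul_zero] at h1
      exact h h1
    refine ⟨h2, (mk_eq_mk_of_smul _ h1).symm⟩
  · rintro ⟨h, rfl⟩
    have h1 : (fun i => eval (Projectivization.mk ℂ v hv).rep (F i) : Vec) = a ^ d • ev F v := by
      rw [← ev_smul hd, ← hr]
      rfl
    have h2 : (fun i => eval (Projectivization.mk ℂ v hv).rep (F i) : Vec) ≠ 0 := by
      rw [h1]
      exact smul_ne_zero (pow_ne_zero _ ha) h
    exact ⟨⟨F, d, hd, hF.ne_zero⟩, hf.symm, h2, mk_eq_mk_of_smul _ h1⟩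

theorem PlaneMap.mk_mem_indet_iff {f : PlaneMap} {F : Triple} {d : ℕ} (hF : Reduced F)
    (hd : ∀ i, (F i).IsHomogeneous d) (hf : Proportional f.coord F) {v : Vec} (hv : v ≠ 0) :
    Projectivization.mk ℂ v hv ∈ f.indet ↔ ev F v = 0 := by
  constructor
  · intro h
    by_contra h1
    exact h _ ((sends_mk_iff hF hd hf hv).2 ⟨h1, rfl⟩)
  · intro h q hq
    obtain ⟨h1, -⟩ := (sends_mk_iff hF hd hf hv).1 hq
    exact h1 h

theorem subset_zariskiClosure (S : Set P2) : S ⊆ zariskiClosure S :=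
  fun p hp _ _ _ h => h p hp

theorem zariskiClosure_empty : zariskiClosure ∅ = ∅ := by
  ext q
  simp only [Set.mem_empty_iff_false, iff_false]
  intro h
  have := h 0 1 (isHomogeneous_one _ _) (fun p hp => hp.elim)
  simp at this

theorem zariskiClosure_singleton (p : P2) : zariskiClosure {p} = {p} := by
  refine Set.Subset.antisymm (fun q hq => ?_) (subset_zariskiClosure _)
  rw [Set.mem_singleton_iff, ← p.mk_rep, ← q.mk_rep]
  have h : ∀ i j, p.rep i * q.rep j = p.rep j * q.rep i := by
    intro i j
    have := hq 1 (C (p.rep i) * X j - C (p.rep j) * X i)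
      ((isHomogeneous_C_mul_X _ _).sub (isHomogeneous_C_mul_X _ _)) (by
        rintro _ rfl
        simp
        ring)
    simpa [sub_eq_zero] using this
  obtain ⟨i, hi⟩ := Function.ne_iff.1 p.rep_nonzero
  refine mk_eq_mk_of_smul (q.rep i / p.rep i) (funext fun j => ?_)
  have hi' : p.rep i ≠ 0 := hi
  have := h i j
  simp only [Pi.smul_apply, smul_eq_mul]
  field_simp
  linear_combination this

theorem PlaneMap.strictImage_empty (f : PlaneMap) : f.strictImage ∅ = ∅ := by
  simp [PlaneMap.strictImage, zariskiClosure_empty]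

theorem PlaneMap.strictImage_singleton_of_mem_indet {f : PlaneMap} {p : P2} (h : p ∈ f.indet) :
    f.strictImage {p} = ∅ := by
  rw [PlaneMap.strictImage, show {q | ∃ p' ∈ ({p} : Set P2), f.Sends p' q} = ∅ by
    ext q
    simpa using h q, zariskiClosure_empty]

end Points

/-! ### The lines contracted by a basic map -/

section Exceptional

variable {A B : GL (Fin 3) ℂ}

theorem cremona_of_apply_eq_zero {x : Vec} {i : Fin 3} (h : x i = 0) :
    cremona x = cremona x i • Pi.single i 1 := by
  funext j
  fin_cases i <;> fin_cases j <;> simp_all [cremona]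

theorem exists_apply_eq_zero_cremona_ne_zero (i : Fin 3) :
    ∃ x : Vec, x i = 0 ∧ cremona x ≠ 0 := by
  refine ⟨fun j => if j = i then 0 else 1, if_pos rfl, fun h => ?_⟩
  have := congrFun h i
  fin_cases i <;> simp [cremona] at this

theorem cremona_ne_zero_of_forall {x : Vec} (h : ∀ i, x i ≠ 0) : cremona x ≠ 0 := by
  intro h1
  have := congrFun h1 0
  simp [cremona, h 1, h 2] at this

theorem mk_mem_imageLine {v : Vec} (hv : v ≠ 0) (i : Fin 3) :
    Projectivization.mk ℂ v hv ∈ imageLine A i ↔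
      ((A⁻¹ : GL (Fin 3) ℂ) : Matrix (Fin 3) (Fin 3) ℂ).mulVec v i = 0 := by
  obtain ⟨a, ha, h⟩ := exists_rep_eq_smul hv
  rw [imageLine, Set.mem_ofPred_eq, h, Matrix.mulVec_smul, Pi.smul_apply, smul_eq_mul,
    mul_eq_zero_iff_left ha]

/-- The exceptional line `A {xᵢ = 0}` is contracted to the point `B eᵢ`. -/
theorem strictImage_imageLine {f : PlaneMap} (hf : Proportional f.coord (basicTriple A B))
    (i : Fin 3) : f.strictImage (imageLine A i) = {imagePoint B i} := by
  rw [PlaneMap.strictImage, ← zariskiClosure_singleton]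
  congr 1
  ext q
  simp only [Set.mem_ofPred_eq, Set.mem_singleton_iff]
  have key : ∀ v : Vec, ((A⁻¹ : GL (Fin 3) ℂ) : Matrix (Fin 3) (Fin 3) ℂ).mulVec v i = 0 →
      ev (basicTriple A B) v = cremona (((A⁻¹ : GL (Fin 3) ℂ) : Matrix (Fin 3) (Fin 3) ℂ).mulVec v) i •
        (B : Matrix (Fin 3) (Fin 3) ℂ).mulVec (Pi.single i 1) := by
    intro v hv
    rw [ev_basicTriple, cremona_of_apply_eq_zero hv, Matrix.mulVec_smul]
    simp
  constructor
  · rintro ⟨p, hp, hpq⟩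
    induction p using Projectivization.ind with | h v hv => ?_
    rw [mk_mem_imageLine] at hp
    obtain ⟨h1, rfl⟩ := (PlaneMap.sends_mk_iff (reduced_basicTriple A B)
      (basicTriple_isHomogeneous A B) hf hv).1 hpq
    exact mk_eq_mk_of_smul _ (key v hp)
  · rintro rfl
    obtain ⟨x, hx, hx'⟩ := exists_apply_eq_zero_cremona_ne_zero i
    have h1 : ev (basicTriple A B) ((A : Matrix (Fin 3) (Fin 3) ℂ).mulVec x) ≠ 0 := by
      rwa [ev_basicTriple, inv_mulVec_mulVec, Ne, mulVec_eq_zero_iff]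
    have hv : (A : Matrix (Fin 3) (Fin 3) ℂ).mulVec x ≠ 0 := by
      rw [Ne, mulVec_eq_zero_iff]
      rintro rfl
      apply hx'
      funext j
      fin_cases j <;> simp [cremona]
    have hx2 : ((A⁻¹ : GL (Fin 3) ℂ) : Matrix (Fin 3) (Fin 3) ℂ).mulVec
        ((A : Matrix (Fin 3) (Fin 3) ℂ).mulVec x) i = 0 := by rwa [inv_mulVec_mulVec]
    refine ⟨Projectivization.mk ℂ _ hv, (mk_mem_imageLine hv i).2 hx2, ?_⟩
    rw [PlaneMap.sends_mk_iff (reduced_basicTriple A B) (basicTriple_isHomogeneous A B) hf hv]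
    exact ⟨h1, mk_eq_mk_of_smul _ (key _ hx2)⟩

/-- The plane of `ℂ³` over the exceptional line `A {xᵢ = 0}`. -/
def exceptionalPlane (A : GL (Fin 3) ℂ) (i : Fin 3) : Submodule ℂ Vec :=
  LinearMap.ker ((LinearMap.proj i : Vec →ₗ[ℂ] ℂ) ∘ₗ
    Matrix.mulVecLin ((A⁻¹ : GL (Fin 3) ℂ) : Matrix (Fin 3) (Fin 3) ℂ))

theorem mem_exceptionalPlane {i : Fin 3} {v : Vec} : v ∈ exceptionalPlane A i ↔
    ((A⁻¹ : GL (Fin 3) ℂ) : Matrix (Fin 3) (Fin 3) ℂ).mulVec v i = 0 := by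
  rw [exceptionalPlane, LinearMap.mem_ker]
  rfl

theorem pointsOf_exceptionalPlane (A : GL (Fin 3) ℂ) (i : Fin 3) :
    pointsOf (exceptionalPlane A i) = imageLine A i := by
  ext p
  rw [mem_pointsOf, mem_exceptionalPlane]
  rfl

theorem finrank_ker_of_ne_zero {φ : Vec →ₗ[ℂ] ℂ} (h : φ ≠ 0) :
    Module.finrank ℂ (LinearMap.ker φ) = 2 := by
  have h1 := LinearMap.finrank_range_add_finrank_ker φ
  rw [LinearMap.range_eq_top.2 (LinearMap.surjective h), finrank_top, Module.finrank_self] at h1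
  simp at h1
  omega

theorem finrank_exceptionalPlane (A : GL (Fin 3) ℂ) (i : Fin 3) :
    Module.finrank ℂ (exceptionalPlane A i) = 2 := by
  apply finrank_ker_of_ne_zero
  intro h
  have := LinearMap.congr_fun h ((A : Matrix (Fin 3) (Fin 3) ℂ).mulVec (Pi.single i 1))
  simp only [LinearMap.comp_apply, Matrix.mulVecLin_apply, inv_mulVec_mulVec] at this
  simp at this

/-- Only the exceptional lines are contracted. -/
theorem exists_eq_exceptionalPlane {f : PlaneMap} (hf : Proportional f.coord (basicTriple A B))
    {W : Submodule ℂ Vec} (hW : Module.finrank ℂ W = 2) {r : P2}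
    (h : f.strictImage (pointsOf W) = {r}) : ∃ i, W = exceptionalPlane A i := by
  by_contra! hne
  have hlt : ∀ i, ∃ w ∈ W, ((A⁻¹ : GL (Fin 3) ℂ) : Matrix (Fin 3) (Fin 3) ℂ).mulVec w i ≠ 0 := by
    intro i
    by_contra! h1
    exact hne i (Submodule.eq_of_le_of_finrank_eq (fun w hw => mem_exceptionalPlane.2 (h1 w hw))
      (by rw [hW, finrank_exceptionalPlane]))
  obtain ⟨b, hb⟩ : ∃ b : Fin 2 → Vec, Submodule.span ℂ (Set.range b) = W ∧
      LinearIndependent ℂ b := by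
    let b := Module.finBasisOfFinrankEq ℂ W hW
    refine ⟨fun i => b i, ?_, b.linearIndependent.map' W.subtype (Submodule.ker_subtype W)⟩
    have := congrArg (Submodule.map W.subtype) b.span_eq
    rw [Submodule.map_span, Submodule.map_top, Submodule.range_subtype, ← Set.range_comp] at this
    exact this
  set ξ : Vec → Fin 3 → ℂ :=
    fun v => ((A⁻¹ : GL (Fin 3) ℂ) : Matrix (Fin 3) (Fin 3) ℂ).mulVec v with hξ
  have hξadd : ∀ s i, ξ (b 0 + s • b 1) i = ξ (b 0) i + s * ξ (b 1) i := by
    intro s i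
    simp [hξ, Matrix.mulVec_add, Matrix.mulVec_smul]
  have hfin : ∀ i, {s : ℂ | ξ (b 0 + s • b 1) i = 0}.Finite := by
    intro i
    by_cases h1 : ξ (b 1) i = 0
    · have h0 : ξ (b 0) i ≠ 0 := by
        intro h0
        obtain ⟨w, hw, hw'⟩ := hlt i
        apply hw'
        rw [← hb.1] at hw
        have : Submodule.span ℂ (Set.range b) ≤ exceptionalPlane A i := by
          rw [Submodule.span_le]
          rintro _ ⟨k, rfl⟩
          fin_cases k
          · exact mem_exceptionalPlane.2 h0
          · exact mem_exceptionalPlane.2 h1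
        exact mem_exceptionalPlane.1 (this hw)
      convert Set.finite_empty
      ext s
      simp [hξadd, h1, h0]
    · refine (Set.finite_singleton (-ξ (b 0) i / ξ (b 1) i)).subset fun s hs => ?_
      rw [Set.mem_ofPred_eq, hξadd] at hs
      rw [Set.mem_singleton_iff]
      field_simp
      linear_combination hs
  -- All but finitely many points of a non-exceptional line avoid the three exceptional lines. Two
  -- of them are taken and compared.
  have hinf : (⋃ i, {s : ℂ | ξ (b 0 + s • b 1) i = 0})ᶜ.Infinite :=
    (Set.finite_iUnion hfin).infinite_compl
  obtain ⟨s, hs, s', hs', hss⟩ := hinf.nontrivial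
  have key : ∀ s ∈ (⋃ i, {s : ℂ | ξ (b 0 + s • b 1) i = 0})ᶜ,
      ev (basicTriple A B) (b 0 + s • b 1) ≠ 0 ∧ eval (b 0 + s • b 1) (axisProd A) ≠ 0 ∧
      ∃ h : ev (basicTriple A B) (b 0 + s • b 1) ≠ 0, Projectivization.mk ℂ _ h = r := by
    intro s hs
    simp only [Set.mem_compl_iff, Set.mem_iUnion, Set.mem_ofPred_eq, not_exists] at hs
    have hv : b 0 + s • b 1 ≠ 0 := by
      intro h0
      apply hs 0
      rw [h0, hξ]
      simp
    have h1 : ev (basicTriple A B) (b 0 + s • b 1) ≠ 0 := by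
      rw [ev_basicTriple, Ne, mulVec_eq_zero_iff]
      exact cremona_ne_zero_of_forall hs
    refine ⟨h1, ?_, h1, ?_⟩
    · rw [eval_axisProd]
      exact Finset.prod_ne_zero_iff.2 fun i _ => hs i
    · rw [← Set.mem_singleton_iff, ← h]
      apply subset_zariskiClosure
      refine ⟨Projectivization.mk ℂ _ hv, ?_, ?_⟩
      · rw [mk_mem_pointsOf, ← hb.1]
        exact Submodule.add_mem _ (Submodule.subset_span ⟨0, rfl⟩)
          (Submodule.smul_mem _ _ (Submodule.subset_span ⟨1, rfl⟩))
      · exact (PlaneMap.sends_mk_iff (reduced_basicTriple A B) (basicTriple_isHomogeneous A B)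
          hf hv).2 ⟨h1, rfl⟩
  obtain ⟨-, g1, e1, k1⟩ := key s hs
  obtain ⟨-, g2, e2, k2⟩ := key s' hs'
  rw [← k2] at k1
  obtain ⟨a, ha⟩ := (Projectivization.mk_eq_mk_iff' ℂ _ _ e1 e2).1 k1
  -- Off the exceptional lines the inverse triple returns a nonzero multiple of the point, so two
  -- points with the same image would be proportional.
  have h2 := congrArg (ev (basicTriple B A)) ha
  rw [ev_smul (basicTriple_isHomogeneous B A), ev_basicTriple_ev_basicTriple,
    ev_basicTriple_ev_basicTriple, smul_smul] at h2
  have h3 := LinearIndependent.pair_iff.1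
    (show LinearIndependent ℂ ![b 0, b 1] from by
      convert hb.2
      ext k
      fin_cases k <;> rfl)
    (a ^ 2 * eval (b 0 + s' • b 1) (axisProd A) - eval (b 0 + s • b 1) (axisProd A))
    (a ^ 2 * eval (b 0 + s' • b 1) (axisProd A) * s' - eval (b 0 + s • b 1) (axisProd A) * s)
    (by
      rw [smul_add, smul_add] at h2
      rw [← sub_eq_zero] at h2
      rw [← h2]
      module)
  apply hss
  apply mul_left_cancel₀ g1
  linear_combination s' * h3.1 - h3.2

end Exceptional

section Closure

/-- The restriction of a polynomial to the affine line `y ↦ y u + v`. -/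
def lineRestrict (u v : Vec) (P : MvPolynomial (Fin 3) ℂ) : Polynomial ℂ :=
  aeval (fun k => Polynomial.X * Polynomial.C (u k) + Polynomial.C (v k)) P

theorem eval_lineRestrict (u v : Vec) (P : MvPolynomial (Fin 3) ℂ) (y : ℂ) :
    (lineRestrict u v P).eval y = eval (y • u + v) P := by
  rw [lineRestrict]
  induction P using MvPolynomial.induction_on with
  | C a => simp
  | add p q hp hq => rw [map_add, map_add, Polynomial.eval_add, hp, hq]
  | mul_X p i hp =>
    rw [map_mul, map_mul, Polynomial.eval_mul, hp]
    simp [mul_comm y]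

theorem exists_linear_form_polynomial (φ : Vec →ₗ[ℂ] ℂ) :
    ∃ P : MvPolynomial (Fin 3) ℂ, P.IsHomogeneous 1 ∧ ∀ v, eval v P = φ v := by
  refine ⟨∑ j, C (φ (Pi.single j 1)) * X j,
    IsHomogeneous.sum _ _ _ fun j _ => isHomogeneous_C_mul_X _ _, fun v => ?_⟩
  rw [LinearMap.pi_apply_eq_sum_univ φ v]
  simp only [map_sum, map_mul, eval_C, eval_X, smul_eq_mul]
  refine Finset.sum_congr rfl fun j _ => ?_
  rw [mul_comm]
  congr 2
  ext k
  simp [Pi.single_apply, eq_comm]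

/-- The product of linear forms vanishing on the planes W i cuts out a closed set. The index set T
allows one line to be left out, which is how an image lying in only two of the lines is excluded
later. -/
theorem zariskiClosure_subset_iUnion {S : Set P2} {T : Finset (Fin 3)}
    {W : Fin 3 → Submodule ℂ Vec} (hS : ∀ p ∈ S, ∃ i ∈ T, p ∈ pointsOf (W i)) {q : P2}
    (hq : q ∈ zariskiClosure S) : ∃ i ∈ T, q ∈ pointsOf (W i) := by
  by_contra! h
  have h1 : ∀ i, ∃ P : MvPolynomial (Fin 3) ℂ, P.IsHomogeneous 1 ∧ (∀ v ∈ W i, eval v P = 0) ∧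
      (i ∈ T → eval q.rep P ≠ 0) := by
    intro i
    by_cases hi : i ∈ T
    · obtain ⟨φ, hφ, hW⟩ := Submodule.exists_le_ker_of_notMem (fun h1 => h i hi (mem_pointsOf.2 h1))
      obtain ⟨P, hP, hPv⟩ := exists_linear_form_polynomial φ
      exact ⟨P, hP, fun v hv => by rw [hPv]; exact hW hv, fun _ => by rw [hPv]; exact hφ⟩
    · exact ⟨0, isHomogeneous_zero _ _ _, fun v _ => map_zero _, fun h => absurd h hi⟩
  choose P hP hPW hPq using h1
  have := hq (∑ i ∈ T, 1) (∏ i ∈ T, P i) (IsHomogeneous.prod _ _ _ fun i _ => hP i)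
    (fun p hp => by
      obtain ⟨i, hi, hpi⟩ := hS p hp
      rw [map_prod]
      exact Finset.prod_eq_zero hi (hPW i _ (mem_pointsOf.1 hpi)))
  rw [map_prod, Finset.prod_eq_zero_iff] at this
  obtain ⟨i, hi, h2⟩ := this
  exact hPq i hi h2

end Closure

theorem cremona_eq_zero {y : Vec} (h : cremona y = 0) : ∃ (i : Fin 3) (c : ℂ),
    y = c • Pi.single i 1 := by
  have h0 := congrFun h 0
  have h1 := congrFun h 1
  have h2 := congrFun h 2
  simp [cremona] at h0 h1 h2
  by_cases hy0 : y 0 = 0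
  · by_cases hy1 : y 1 = 0
    · refine ⟨2, y 2, funext fun j => ?_⟩
      fin_cases j <;> simp [hy0, hy1]
    · refine ⟨1, y 1, funext fun j => ?_⟩
      fin_cases j <;> simp_all
  · refine ⟨0, y 0, funext fun j => ?_⟩
    fin_cases j <;> simp_all

/-- The points of indeterminacy of a basic map. -/
theorem indet_eq_range_imagePoint {A B : GL (Fin 3) ℂ} {f : PlaneMap}
    (hf : Proportional f.coord (basicTriple A B)) : f.indet = Set.range (imagePoint A) := by
  ext p
  induction p using Projectivization.ind with | h v hv => ?_
  rw [PlaneMap.mk_mem_indet_iff (reduced_basicTriple A B) (basicTriple_isHomogeneous A B) hf hv,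
    ev_basicTriple, mulVec_eq_zero_iff]
  constructor
  · intro h
    obtain ⟨i, c, hc⟩ := cremona_eq_zero h
    refine ⟨i, ?_⟩
    have h1 : v = c • (A : Matrix (Fin 3) (Fin 3) ℂ).mulVec (Pi.single i 1) := by
      rw [← mulVec_inv_mulVec A v, hc, Matrix.mulVec_smul]
    exact (mk_eq_mk_of_smul c h1).symm
  · rintro ⟨i, hi⟩
    obtain ⟨a, ha⟩ := (Projectivization.mk_eq_mk_iff' ℂ _ _ hv (mulVec_single_ne_zero A i)).1 hi.symm
    rw [← ha, Matrix.mulVec_smul, inv_mulVec_mulVec]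
    funext j
    fin_cases i <;> fin_cases j <;> simp [cremona]

/-! ### Standard maps in coordinates on the three lines -/

namespace LineCoords

variable {L : Fin 3 → Submodule ℂ Vec} (γ : LineCoords L)

/-- The vector `t z + wᵢ`. -/
def vec (i : Fin 3) (t : ℂ) : Vec := t • γ.z + γ.w i

theorem vec_ne_zero' (i : Fin 3) (t : ℂ) : γ.vec i t ≠ 0 := γ.vec_ne_zero i t

theorem pt_eq_mk (i : Fin 3) (t : ℂ) : γ.pt i t = Projectivization.mk ℂ (γ.vec i t)
  (γ.vec_ne_zero' i t) := rfl

theorem vec_mem (i : Fin 3) (t : ℂ) : γ.vec i t ∈ L i :=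
  (L i).add_mem ((L i).smul_mem _ (γ.z_mem i)) (γ.w_mem i)

theorem linearIndependent_pair (i : Fin 3) {a b : ℂ} (h : a • γ.z + b • γ.w i = 0) :
    a = 0 ∧ b = 0 := by
  have hb : b = 0 := by
    by_contra hb
    apply γ.w_notMem i
    refine Submodule.mem_span_singleton.2 ⟨-(b⁻¹ * a), ?_⟩
    have h1 := congrArg (b⁻¹ • ·) h
    simp only [smul_add, smul_smul, inv_mul_cancel₀ hb, one_smul, smul_zero] at h1
    rw [neg_smul]
    exact (eq_neg_of_add_eq_zero_right h1).symm
  rw [hb, zero_smul, add_zero] at h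
  exact ⟨(smul_eq_zero.1 h).resolve_right γ.z_ne_zero, hb⟩

theorem mem_iff (hL : IsConcurrentTriple L) (i : Fin 3) {v : Vec} :
    v ∈ L i ↔ ∃ a b : ℂ, v = a • γ.z + b • γ.w i := by
  constructor
  · intro hv
    have h1 : LinearIndependent ℂ ![γ.z, γ.w i] :=
      LinearIndependent.pair_iff.2 fun a b h => γ.linearIndependent_pair i h
    have h2 : Submodule.span ℂ (Set.range ![γ.z, γ.w i]) = L i := by
      apply Submodule.eq_of_le_of_finrank_eq
      · rw [Submodule.span_le]
        rintro _ ⟨k, rfl⟩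
        fin_cases k
        · exact γ.z_mem i
        · exact γ.w_mem i
      · rw [finrank_span_eq_card h1, hL.finrank_eq i]
        rfl
    rw [← h2] at hv
    simp only [Matrix.range_cons, Matrix.range_empty, Set.union_empty, Set.singleton_union] at hv
    obtain ⟨a, b, h⟩ := Submodule.mem_span_pair.1 hv
    exact ⟨a, b, h.symm⟩
  · rintro ⟨a, b, rfl⟩
    exact (L i).add_mem ((L i).smul_mem _ (γ.z_mem i)) ((L i).smul_mem _ (γ.w_mem i))

theorem linearIndependent_zw (hL : IsConcurrentTriple L) {a b c : ℂ}
    (h : a • γ.z + b • γ.w 0 + c • γ.w 1 = 0) : a = 0 ∧ b = 0 ∧ c = 0 := by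
  have hc : c = 0 := by
    by_contra hc
    have h1 : γ.w 1 ∈ L 0 := by
      rw [γ.mem_iff hL]
      refine ⟨-(c⁻¹ * a), -(c⁻¹ * b), ?_⟩
      have h1 := congrArg (c⁻¹ • ·) h
      simp only [smul_add, smul_smul, inv_mul_cancel₀ hc, one_smul, smul_zero] at h1
      rw [eq_neg_of_add_eq_zero_right h1]
      module
    have h2 : L 1 ≤ L 0 := by
      intro v hv
      obtain ⟨a, b, rfl⟩ := (γ.mem_iff hL 1).1 hv
      exact (L 0).add_mem ((L 0).smul_mem _ (γ.z_mem 0)) ((L 0).smul_mem _ h1)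
    have h3 := hL.injective (Submodule.eq_of_le_of_finrank_eq h2 (by
      rw [hL.finrank_eq, hL.finrank_eq]))
    simp at h3
  rw [hc, zero_smul, add_zero] at h
  obtain ⟨h1, h2⟩ := γ.linearIndependent_pair 0 h
  exact ⟨h1, h2, hc⟩

/-- Up to scaling, w₁ + w₂ + w₃ = 0 is the only linear relation between z and the wᵢ, since z, w₁,
w₂ are independent. -/
theorem eq_of_sum_eq_zero (hL : IsConcurrentTriple L) {a : ℂ} {b : Fin 3 → ℂ}
    (h : a • γ.z + ∑ i, b i • γ.w i = 0) : a = 0 ∧ ∀ i j, b i = b j := by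
  rw [Fin.sum_univ_three, show γ.w 2 = -γ.w 0 - γ.w 1 by
    linear_combination (exp := 1) γ.w_sum] at h
  obtain ⟨h1, h2, h3⟩ := γ.linearIndependent_zw hL (a := a) (b := b 0 - b 2) (c := b 1 - b 2) (by
    rw [← h]; module)
  refine ⟨h1, ?_⟩
  have h4 : ∀ i, b i = b 2 := by
    intro i
    fin_cases i
    · exact sub_eq_zero.1 h2
    · exact sub_eq_zero.1 h3
    · rfl
  intro i j
  rw [h4 i, h4 j]

theorem smul_vec_mem_iff (hL : IsConcurrentTriple L) {i j : Fin 3} {a b : ℂ} (hij : i ≠ j) :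
    a • γ.z + b • γ.w i ∈ L j ↔ b = 0 := by
  constructor
  · intro h
    obtain ⟨a', b', h'⟩ := (γ.mem_iff hL j).1 h
    have h1 := (γ.eq_of_sum_eq_zero hL (a := a - a')
      (b := fun k => (if k = i then b else 0) - (if k = j then b' else 0)) (by
        simp only [sub_smul, ite_smul, zero_smul, Finset.sum_sub_distrib, Finset.sum_ite_eq',
          Finset.mem_univ, if_true]
        rw [← sub_eq_zero] at h'
        rw [← h']
        module)).2
    obtain ⟨k, hki, hkj⟩ : ∃ k : Fin 3, k ≠ i ∧ k ≠ j := by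
      clear h h' h1 hij
      decide +revert
    simpa [hki, hkj, hij] using h1 i k
  · rintro rfl
    rw [zero_smul, add_zero]
    exact (L j).smul_mem _ (γ.z_mem j)

theorem vec_mem_iff (hL : IsConcurrentTriple L) {i j : Fin 3} {x : ℂ} :
    γ.vec i x ∈ L j ↔ i = j := by
  constructor
  · intro h
    by_contra hij
    rw [vec, ← one_smul ℂ (γ.w i), γ.smul_vec_mem_iff hL hij] at h
    exact one_ne_zero h
  · rintro rfl
    exact γ.vec_mem i x

theorem pt_eq_pt_iff (hL : IsConcurrentTriple L) {i j : Fin 3} {x y : ℂ} :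
    γ.pt i x = γ.pt j y ↔ i = j ∧ x = y := by
  constructor
  · intro h
    obtain ⟨a, ha⟩ := (Projectivization.mk_eq_mk_iff' ℂ _ _ (γ.vec_ne_zero' i x)
      (γ.vec_ne_zero' j y)).1 h
    have hij : i = j := by
      rw [← γ.vec_mem_iff hL (x := x), ← ha]
      exact (L j).smul_mem _ (γ.vec_mem j y)
    subst hij
    refine ⟨rfl, ?_⟩
    obtain ⟨h1, h2⟩ := γ.linearIndependent_pair i (a := a * y - x) (b := a - 1) (by
      rw [← sub_eq_zero] at ha
      rw [← ha, vec, vec]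
      module)
    linear_combination y * h2 - h1
  · rintro ⟨rfl, rfl⟩
    rfl

/-- The common point of the three lines. -/
def center : P2 := Projectivization.mk ℂ γ.z γ.z_ne_zero

theorem eq_center_or_eq_pt (hL : IsConcurrentTriple L) {i : Fin 3} {p : P2}
    (hp : p ∈ pointsOf (L i)) : p = γ.center ∨ ∃ x, p = γ.pt i x := by
  induction p using Projectivization.ind with | h v hv => ?_
  rw [mk_mem_pointsOf] at hp
  obtain ⟨a, b, h⟩ := (γ.mem_iff hL i).1 hp
  by_cases hb : b = 0
  · left
    rw [hb, zero_smul, add_zero] at h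
    exact mk_eq_mk_of_smul a h
  · right
    refine ⟨b⁻¹ * a, mk_eq_mk_of_smul b ?_⟩
    rw [h, smul_add, smul_smul, mul_inv_cancel_left₀ hb]

theorem eq_center (hL : IsConcurrentTriple L) {p : P2} (hp : ∀ i, p ∈ pointsOf (L i)) :
    p = γ.center := by
  rcases γ.eq_center_or_eq_pt hL (hp 0) with h | ⟨x, rfl⟩
  · exact h
  · have h1 := hp 1
    rw [pt_eq_mk, mk_mem_pointsOf, γ.vec_mem_iff hL] at h1
    simp at h1

theorem center_mem (i : Fin 3) : γ.center ∈ pointsOf (L i) :=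
  (mk_mem_pointsOf γ.z_ne_zero).2 (γ.z_mem i)

theorem pt_mem (i : Fin 3) (x : ℂ) : γ.pt i x ∈ pointsOf (L i) :=
  (mk_mem_pointsOf (γ.vec_ne_zero' i x)).2 (γ.vec_mem i x)

theorem pt_ne_center (i : Fin 3) (x : ℂ) : γ.pt i x ≠ γ.center := by
  intro h
  obtain ⟨a, ha⟩ := (Projectivization.mk_eq_mk_iff' ℂ _ _ (γ.vec_ne_zero' i x) γ.z_ne_zero).1 h
  obtain ⟨-, h2⟩ := γ.linearIndependent_pair i (a := a - x) (b := -1) (by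
    rw [sub_smul, ha, vec]
    module)
  norm_num at h2

/-- The matrix with columns `tᵢ z + w_(τ i)`. -/
def frame (τ : Equiv.Perm (Fin 3)) (t : Fin 3 → ℂ) : Matrix (Fin 3) (Fin 3) ℂ :=
  Matrix.of fun r i => γ.vec (τ i) (t i) r

theorem frame_mulVec (τ : Equiv.Perm (Fin 3)) (t x : Fin 3 → ℂ) :
    (γ.frame τ t).mulVec x = ∑ i, x i • γ.vec (τ i) (t i) := by
  funext r
  simp [frame, Matrix.mulVec, dotProduct, mul_comm]

theorem frame_mulVec' (τ : Equiv.Perm (Fin 3)) (t x : Fin 3 → ℂ) :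
    (γ.frame τ t).mulVec x = (∑ i, x i * t i) • γ.z + ∑ i, x (τ⁻¹ i) • γ.w i := by
  rw [frame_mulVec, ← Equiv.sum_comp τ (fun i => x (τ⁻¹ i) • γ.w i)]
  simp [vec, Finset.sum_add_distrib, smul_smul, Finset.sum_smul]

theorem sum_w : ∑ i, γ.w i = 0 := by
  rw [Fin.sum_univ_three]
  exact γ.w_sum

/-- The wᵢ cancel on the diagonal. Every frame therefore carries the fixed point (1,1,1) of J to the
common point of the lines. -/
theorem frame_mulVec_const (τ : Equiv.Perm (Fin 3)) (t : Fin 3 → ℂ) (r : ℂ) :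
    (γ.frame τ t).mulVec (fun _ => r) = (r * ∑ i, t i) • γ.z := by
  rw [frame_mulVec', ← Finset.smul_sum, γ.sum_w, smul_zero, add_zero, Finset.mul_sum]

theorem frame_mulVec_single (τ : Equiv.Perm (Fin 3)) (t : Fin 3 → ℂ) (i : Fin 3) :
    (γ.frame τ t).mulVec (Pi.single i 1) = γ.vec (τ i) (t i) := by
  rw [frame_mulVec, Finset.sum_eq_single i]
  · simp
  · intro j _ hj
    simp [hj]
  · simp

theorem det_frame_ne_zero (hL : IsConcurrentTriple L) {τ : Equiv.Perm (Fin 3)} {t : Fin 3 → ℂ}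
    (ht : ∑ i, t i ≠ 0) : (γ.frame τ t).det ≠ 0 := by
  intro h
  obtain ⟨x, hx, h0⟩ := Matrix.exists_mulVec_eq_zero_iff.2 h
  rw [frame_mulVec'] at h0
  obtain ⟨h1, h2⟩ := γ.eq_of_sum_eq_zero hL h0
  apply hx
  have h3 : ∀ i, x i = x 0 := fun i => by simpa using h2 (τ i) (τ 0)
  have h4 : x 0 = 0 := by
    simp_rw [h3, ← Finset.mul_sum] at h1
    exact (mul_eq_zero.1 h1).resolve_right ht
  funext i
  rw [h3 i, h4]
  rfl

/-- The invertible matrix with columns `tᵢ z + w_(τ i)`. -/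
def frameGL (hL : IsConcurrentTriple L) (τ : Equiv.Perm (Fin 3)) (t : Fin 3 → ℂ)
    (ht : ∑ i, t i ≠ 0) : GL (Fin 3) ℂ :=
  Matrix.GeneralLinearGroup.mkOfDetNeZero (γ.frame τ t) (γ.det_frame_ne_zero hL ht)

theorem coe_frameGL (hL : IsConcurrentTriple L) (τ : Equiv.Perm (Fin 3)) (t : Fin 3 → ℂ)
    (ht : ∑ i, t i ≠ 0) : (γ.frameGL hL τ t ht : Matrix (Fin 3) (Fin 3) ℂ) = γ.frame τ t := rfl

theorem imagePoint_frameGL (hL : IsConcurrentTriple L) (τ : Equiv.Perm (Fin 3)) (t : Fin 3 → ℂ)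
    (ht : ∑ i, t i ≠ 0) (i : Fin 3) : imagePoint (γ.frameGL hL τ t ht) i = γ.pt (τ i) (t i) :=
  mk_eq_mk_of_smul 1 (by rw [one_smul, coe_frameGL, frame_mulVec_single]; rfl)

/-- In the frame, Lᵢ is the line joining eᵢ to (1,1,1). -/
theorem inv_frameGL_mulVec_vec (hL : IsConcurrentTriple L) (t : Fin 3 → ℂ)
    (ht : ∑ i, t i ≠ 0) (i : Fin 3) (x : ℂ) :
    (((γ.frameGL hL 1 t ht)⁻¹ : GL (Fin 3) ℂ) : Matrix (Fin 3) (Fin 3) ℂ).mulVec (γ.vec i x) =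
      Pi.single i 1 + fun _ => (x - t i) / ∑ j, t j := by
  rw [← inv_mulVec_mulVec (γ.frameGL hL 1 t ht) (Pi.single i 1 + fun _ => (x - t i) / ∑ j, t j)]
  congr 1
  rw [Matrix.mulVec_add, coe_frameGL, frame_mulVec_single, frame_mulVec_const,
    div_mul_cancel₀ _ ht, Equiv.Perm.one_apply, vec, vec]
  module

theorem inv_frameGL_mulVec_z (hL : IsConcurrentTriple L) (τ : Equiv.Perm (Fin 3)) (t : Fin 3 → ℂ)
    (ht : ∑ i, t i ≠ 0) :
    (((γ.frameGL hL τ t ht)⁻¹ : GL (Fin 3) ℂ) : Matrix (Fin 3) (Fin 3) ℂ).mulVec γ.z =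
      fun _ => (∑ j, t j)⁻¹ := by
  rw [← inv_mulVec_mulVec (γ.frameGL hL τ t ht) (fun _ => (∑ j, t j)⁻¹)]
  congr 1
  rw [coe_frameGL, frame_mulVec_const, inv_mul_cancel₀ ht, one_smul]

/-- J preserves the line joining eᵢ to (1,1,1). The quadratic form acquires the common factor r,
which is why the induced map of the line has degree one. -/
theorem cremona_single_add_const (i : Fin 3) (r : ℂ) :
    cremona (Pi.single i 1 + fun _ => r) = r • ((fun _ => r + 1) - Pi.single i 1) := by
  funext j
  fin_cases i <;> fin_cases j <;> simp [cremona, -mul_eq_mul_left_iff, -mul_eq_left₀] <;> ring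

/-- The affine maps by which the standard maps act on the lines. -/
def next (t s : Fin 3 → ℂ) (i : Fin 3) (x : ℂ) : ℂ :=
  s i - (∑ j, s j) - (∑ j, s j) / (∑ j, t j) * (x - t i)

section Standard

variable (hL : IsConcurrentTriple L) (τ : Equiv.Perm (Fin 3)) (t s : Fin 3 → ℂ)
  (ht : ∑ i, t i ≠ 0) (hs : ∑ i, s i ≠ 0)

/-- The triple of the basic map that is indeterminate at `γ.pt i (t i)`, contracts the opposite
exceptional line to `γ.pt (τ i) (s i)`, and fixes the center. -/
def stdTriple : Triple := basicTriple (γ.frameGL hL 1 t ht) (γ.frameGL hL τ s hs)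

theorem reduced_stdTriple : Reduced (γ.stdTriple hL τ t s ht hs) := reduced_basicTriple _ _

theorem stdTriple_isHomogeneous (i : Fin 3) : (γ.stdTriple hL τ t s ht hs i).IsHomogeneous 2 :=
  basicTriple_isHomogeneous _ _ _

theorem ev_stdTriple_vec (i : Fin 3) (x : ℂ) : ev (γ.stdTriple hL τ t s ht hs) (γ.vec i x) =
    (-((x - t i) / ∑ j, t j)) • γ.vec (τ i) (next t s i x) := by
  rw [stdTriple, ev_basicTriple, inv_frameGL_mulVec_vec, cremona_single_add_const,
    Matrix.mulVec_smul, Matrix.mulVec_sub, coe_frameGL, frame_mulVec_const, frame_mulVec_single,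
    neg_smul, ← smul_neg]
  congr 1
  rw [vec, vec, next]
  module

theorem ev_stdTriple_z : ev (γ.stdTriple hL τ t s ht hs) γ.z =
    ((∑ j, t j)⁻¹ ^ 2 * ∑ j, s j) • γ.z := by
  rw [stdTriple, ev_basicTriple, inv_frameGL_mulVec_z]
  have : cremona (fun _ => (∑ j, t j)⁻¹) = fun _ => (∑ j, t j)⁻¹ ^ 2 := by
    funext i
    fin_cases i <;> simp [cremona, sq]
  rw [this, coe_frameGL, frame_mulVec_const]

variable {f : PlaneMap} (hf : Proportional f.coord (γ.stdTriple hL τ t s ht hs))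
include hf

theorem std_sends_iff {v : Vec} (hv : v ≠ 0) {q : P2} :
    f.Sends (Projectivization.mk ℂ v hv) q ↔
      ∃ h : ev (γ.stdTriple hL τ t s ht hs) v ≠ 0, Projectivization.mk ℂ _ h = q :=
  PlaneMap.sends_mk_iff (γ.reduced_stdTriple hL τ t s ht hs)
    (γ.stdTriple_isHomogeneous hL τ t s ht hs) hf hv

theorem std_indet : f.indet = Set.range fun i => γ.pt i (t i) := by
  rw [indet_eq_range_imagePoint hf]
  congr 1
  funext i
  rw [imagePoint_frameGL]
  rfl

theorem std_pt_mem_indet_iff {i : Fin 3} {x : ℂ} : γ.pt i x ∈ f.indet ↔ x = t i := by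
  rw [γ.std_indet hL τ t s ht hs hf]
  constructor
  · rintro ⟨j, hj⟩
    obtain ⟨rfl, rfl⟩ := (γ.pt_eq_pt_iff hL).1 hj
    rfl
  · rintro rfl
    exact ⟨i, rfl⟩

theorem std_center_notMem_indet : γ.center ∉ f.indet := by
  rw [γ.std_indet hL τ t s ht hs hf]
  rintro ⟨j, hj⟩
  exact γ.pt_ne_center j _ hj

theorem std_sends_pt {i : Fin 3} {x : ℂ} (hx : x ≠ t i) :
    f.Sends (γ.pt i x) (γ.pt (τ i) (next t s i x)) := by
  have h := γ.ev_stdTriple_vec hL τ t s ht hs i x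
  refine (γ.std_sends_iff hL τ t s ht hs hf (γ.vec_ne_zero' i x)).2 ⟨?_, mk_eq_mk_of_smul _ h⟩
  rw [h]
  exact smul_ne_zero (neg_ne_zero.2 (div_ne_zero (sub_ne_zero.2 hx) ht)) (γ.vec_ne_zero' _ _)

theorem std_sends_unique {p q q' : P2} (h : f.Sends p q) (h' : f.Sends p q') : q = q' := by
  induction p using Projectivization.ind with | h v hv => ?_
  obtain ⟨-, rfl⟩ := (γ.std_sends_iff hL τ t s ht hs hf hv).1 h
  obtain ⟨-, rfl⟩ := (γ.std_sends_iff hL τ t s ht hs hf hv).1 h'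
  rfl

theorem std_strictImage_pt {i : Fin 3} {x : ℂ} (hx : x ≠ t i) :
    f.strictImage {γ.pt i x} = {γ.pt (τ i) (next t s i x)} := by
  rw [PlaneMap.strictImage, ← zariskiClosure_singleton (γ.pt (τ i) (next t s i x))]
  congr 1
  ext q
  simp only [Set.mem_singleton_iff, exists_eq_left, Set.mem_ofPred_eq]
  have h := γ.std_sends_pt hL τ t s ht hs hf hx
  exact ⟨fun h1 => γ.std_sends_unique hL τ t s ht hs hf h1 h, fun h1 => h1 ▸ h⟩

theorem std_sends_center : f.Sends γ.center γ.center := by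
  have h := γ.ev_stdTriple_z hL τ t s ht hs
  refine (γ.std_sends_iff hL τ t s ht hs hf γ.z_ne_zero).2 ⟨?_, mk_eq_mk_of_smul _ h⟩
  rw [h]
  exact smul_ne_zero (mul_ne_zero (pow_ne_zero _ (inv_ne_zero ht)) hs) γ.z_ne_zero

theorem std_strictImage_cubic : f.strictImage (cubic L) = cubic L := by
  apply Set.Subset.antisymm
  · intro q hq
    obtain ⟨i, -, hi⟩ := zariskiClosure_subset_iUnion (T := Finset.univ) (W := L) (by
      rintro q ⟨p, ⟨i, hi⟩, hpq⟩
      rcases γ.eq_center_or_eq_pt hL hi with rfl | ⟨x, rfl⟩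
      · rw [γ.std_sends_unique hL τ t s ht hs hf hpq (γ.std_sends_center hL τ t s ht hs hf)]
        exact ⟨0, Finset.mem_univ _, γ.center_mem 0⟩
      · have hx : x ≠ t i := by
          rintro rfl
          exact (γ.std_pt_mem_indet_iff hL τ t s ht hs hf).2 rfl _ hpq
        rw [γ.std_sends_unique hL τ t s ht hs hf hpq (γ.std_sends_pt hL τ t s ht hs hf hx)]
        exact ⟨τ i, Finset.mem_univ _, γ.pt_mem _ _⟩) hq
    exact ⟨i, hi⟩
  · rintro q ⟨i, hi⟩
    rcases γ.eq_center_or_eq_pt hL hi with rfl | ⟨y, rfl⟩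
    · exact subset_zariskiClosure _ ⟨γ.center, ⟨0, γ.center_mem 0⟩,
        γ.std_sends_center hL τ t s ht hs hf⟩
    · intro e P hP h
      rw [pt_eq_mk, eval_mk_rep_eq_zero_iff _ hP]
      set Q := lineRestrict γ.z (γ.w i) P
      have hQe : ∀ y, Q.eval y = eval (γ.vec i y) P := eval_lineRestrict _ _ P
      rw [← hQe]
      suffices h0 : Q = 0 by rw [h0, Polynomial.eval_zero]
      -- The value of `next` at the point of indeterminacy need not be attained, but all other
      -- points of the line are; a polynomial vanishing at those vanishes on the whole line.
      apply Polynomial.eq_zero_of_infinite_isRoot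
      refine (Set.finite_singleton (next t s (τ⁻¹ i) (t (τ⁻¹ i)))).infinite_compl.mono ?_
      intro y hy
      rw [Set.mem_compl_singleton_iff] at hy
      rw [Set.mem_ofPred_eq, Polynomial.IsRoot, hQe,
        ← eval_mk_rep_eq_zero_iff (γ.vec_ne_zero' i y) hP]
      set x := t (τ⁻¹ i) - (y - s (τ⁻¹ i) + ∑ j, s j) * (∑ j, t j) / ∑ j, s j with hx
      have hxy : next t s (τ⁻¹ i) x = y := by
        rw [next, hx]
        field_simp
        ring
      have hne : x ≠ t (τ⁻¹ i) := by
        intro h1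
        apply hy
        rw [← hxy, h1]
      have h2 := γ.std_sends_pt hL τ t s ht hs hf hne
      rw [hxy] at h2
      rw [← Equiv.Perm.mul_apply, mul_inv_cancel, Equiv.Perm.one_apply] at h2
      exact h _ ⟨_, ⟨_, γ.pt_mem _ _⟩, h2⟩

theorem std_properlyFixes : f.ProperlyFixes L := by
  refine ⟨γ.std_strictImage_cubic hL τ t s ht hs hf, fun o ho => ?_⟩
  obtain rfl := γ.eq_center hL ho
  refine ⟨γ.std_center_notMem_indet hL τ t s ht hs hf, fun g hg => ?_⟩
  have h1 := proportional_basicTriple_of_isInverse hf hg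
  rw [center, PlaneMap.mk_mem_indet_iff (reduced_basicTriple _ _) (basicTriple_isHomogeneous _ _)
    h1, ev_basicTriple, mulVec_eq_zero_iff, inv_frameGL_mulVec_z]
  exact cremona_ne_zero_of_forall fun i => inv_ne_zero hs

theorem std_strictImage_imageLine (i : Fin 3) :
    f.strictImage (imageLine (γ.frameGL hL 1 t ht) i) = {γ.pt (τ i) (s i)} := by
  rw [strictImage_imageLine hf, imagePoint_frameGL]

end Standard

/-- The parameters of the points of the forward orbit of the `i`-th exceptional line. -/
def orb (τ : Equiv.Perm (Fin 3)) (t s : Fin 3 → ℂ) (i : Fin 3) : ℕ → ℂ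
  | 0 => s i
  | j + 1 => next t s ((τ ^ (j + 1)) i) (orb τ t s i j)

/-! ### Orbits of the exceptional lines -/

section Orbit

variable (hL : IsConcurrentTriple L) (τ : Equiv.Perm (Fin 3)) (t s : Fin 3 → ℂ)
  (ht : ∑ i, t i ≠ 0) (hs : ∑ i, s i ≠ 0) {f : PlaneMap}
  (hf : Proportional f.coord (γ.stdTriple hL τ t s ht hs))
include hf

theorem std_iterate (i : Fin 3) (j : ℕ)
    (h : ∀ k < j, orb τ t s i k ≠ t ((τ ^ (k + 1)) i)) :
    f.strictImage^[j + 1] (imageLine (γ.frameGL hL 1 t ht) i) =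
      {γ.pt ((τ ^ (j + 1)) i) (orb τ t s i j)} := by
  induction j with
  | zero => simpa [orb] using γ.std_strictImage_imageLine hL τ t s ht hs hf i
  | succ j ih =>
    rw [Function.iterate_succ_apply', ih fun k hk => h k (by omega),
      γ.std_strictImage_pt hL τ t s ht hs hf (h j (by omega)), orb, pow_succ' τ (j + 1)]
    rfl

theorem std_hasOrbitLength_iff (i j : Fin 3) (m : ℕ) :
    f.HasOrbitLength (imageLine (γ.frameGL hL 1 t ht) i) (m + 1) (γ.pt j (t j)) ↔
      (∀ k < m, orb τ t s i k ≠ t ((τ ^ (k + 1)) i)) ∧ (τ ^ (m + 1)) i = j ∧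
        orb τ t s i m = t j := by
  constructor
  · rintro ⟨-, h1, h2, h3⟩
    -- Induction is needed because the formula for an iterate presupposes that the earlier points
    -- are not indeterminate.
    have h4 : ∀ k ≤ m, ∀ l < k, orb τ t s i l ≠ t ((τ ^ (l + 1)) i) := by
      intro k
      induction k with
      | zero => intro _ l hl; omega
      | succ k ih =>
        intro hk l hl
        rcases Nat.lt_succ_iff_lt_or_eq.1 hl with hl | rfl
        · exact ih (by omega) l hl
        · obtain ⟨q, hq, hq'⟩ := h3 (l + 1) (by omega) (by omega)
          rw [γ.std_iterate hL τ t s ht hs hf i l (ih (by omega)), Set.singleton_eq_singleton_iff]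
            at hq'
          rw [← hq', γ.std_pt_mem_indet_iff hL τ t s ht hs hf] at hq
          exact hq
    rw [γ.std_iterate hL τ t s ht hs hf i m (h4 m le_rfl), Set.singleton_eq_singleton_iff,
      γ.pt_eq_pt_iff hL] at h1
    exact ⟨h4 m le_rfl, h1⟩
  · rintro ⟨h1, h2, h3⟩
    refine ⟨by omega, ?_, (γ.std_pt_mem_indet_iff hL τ t s ht hs hf).2 rfl, ?_⟩
    · rw [γ.std_iterate hL τ t s ht hs hf i m h1, h2, h3]
    · intro k hk hk'
      obtain ⟨l, rfl⟩ : ∃ l, k = l + 1 := ⟨k - 1, by omega⟩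
      refine ⟨_, ?_, γ.std_iterate hL τ t s ht hs hf i l fun k hk => h1 k (by omega)⟩
      rw [γ.std_pt_mem_indet_iff hL τ t s ht hs hf]
      exact h1 l (by omega)

end Orbit

end LineCoords

/-! ### Quadratic triples, planes and rational functions of one variable -/

section Polarization

/-- A quadratic form on a linear combination of three vectors. -/
theorem eval_polarization {P : MvPolynomial (Fin 3) ℂ} (hP : P.IsHomogeneous 2) (u v w : Vec)
    (a b c : ℂ) : eval (a • u + b • v + c • w) P =
      a ^ 2 * eval u P + b ^ 2 * eval v P + c ^ 2 * eval w P +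
      a * b * (eval (u + v) P - eval u P - eval v P) +
      a * c * (eval (u + w) P - eval u P - eval w P) +
      b * c * (eval (v + w) P - eval v P - eval w P) := by
  simp only [eval_eq', Finset.mul_sum, ← Finset.sum_sub_distrib, ← Finset.sum_add_distrib]
  refine Finset.sum_congr rfl fun s hs => ?_
  have hd := hP.degree_eq_sum_deg_support hs
  rw [Finset.sum_subset (Finset.subset_univ _) fun i _ hi => by simpa using hi,
    Fin.sum_univ_three] at hd
  simp only [Fin.prod_univ_three, Pi.add_apply, Pi.smul_apply, smul_eq_mul]
  have h0 : s 0 ≤ 2 := by omega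
  have h1 : s 1 ≤ 2 := by omega
  have h2 : s 2 = 2 - s 0 - s 1 := by omega
  rw [h2]
  generalize s 0 = m at *
  generalize s 1 = k at *
  interval_cases m <;> interval_cases k <;> first | omega | (norm_num; ring)

variable {F : Triple} (hF : ∀ i, (F i).IsHomogeneous 2)
include hF

theorem ev_polarization (u v w : Vec) (a b c : ℂ) : ev F (a • u + b • v + c • w) =
      a ^ 2 • ev F u + b ^ 2 • ev F v + c ^ 2 • ev F w +
      (a * b) • (ev F (u + v) - ev F u - ev F v) +
      (a * c) • (ev F (u + w) - ev F u - ev F w) +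
      (b * c) • (ev F (v + w) - ev F v - ev F w) :=
  funext fun i => eval_polarization (hF i) u v w a b c

theorem ev_polarization_two (u v : Vec) (a b : ℂ) : ev F (a • u + b • v) =
      a ^ 2 • ev F u + b ^ 2 • ev F v + (a * b) • (ev F (u + v) - ev F u - ev F v) := by
  have := ev_polarization hF u v 0 a b 0
  simpa using this

theorem ev_polarization_line (u v : Vec) (y : ℂ) : ev F (y • u + v) =
      y ^ 2 • ev F u + y • (ev F (u + v) - ev F u - ev F v) + ev F v := by
  have := ev_polarization_two hF u v y 1
  simp only [one_smul, one_pow, mul_one] at this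
  rw [this]
  abel

end Polarization

section Planes

/-- A polynomial that vanishes on the kernel of a linear form is a multiple of it. -/
theorem dvd_of_eval_eq_zero {φ : Vec →ₗ[ℂ] ℂ} (hφ : φ ≠ 0) {l P : MvPolynomial (Fin 3) ℂ}
    (hl : ∀ v, eval v l = φ v) (h : ∀ v, φ v = 0 → eval v P = 0) : l ∣ P := by
  obtain ⟨v, hv⟩ := LinearMap.surjective hφ 1
  -- The substitution x ↦ x − φ(x) v projects onto the kernel of φ, so it kills P; modulo l it is
  -- the identity.
  have h1 : bind₁ (fun i => X i - C (v i) * l) P = 0 := by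
    apply MvPolynomial.funext
    intro x
    rw [map_zero, ← aeval_complex, aeval_bind₁]
    have : (fun i => aeval x (X i - C (v i) * l)) = x - φ x • v := by
      funext i
      simp [aeval_complex, hl, mul_comm]
    rw [this, aeval_complex]
    exact h _ (by simp [hv])
  rw [← Ideal.mem_span_singleton, ← Ideal.Quotient.eq_zero_iff_mem]
  let π := Ideal.Quotient.mkₐ ℂ (Ideal.span {l})
  change π P = 0
  have h2 : π P = π (bind₁ (fun i => X i - C (v i) * l) P) := by
    have : π.comp (bind₁ fun i => X i - C (v i) * l) = π := by
      ext i
      simp only [AlgHom.comp_apply, bind₁_X_right]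
      rw [← sub_eq_zero, ← map_sub]
      refine Ideal.Quotient.eq_zero_iff_mem.2 (Ideal.mem_span_singleton.2 ⟨-C (v i), ?_⟩)
      ring
    exact (AlgHom.congr_fun this P).symm
  rw [h2, h1, map_zero]

theorem exists_ker_eq {W : Submodule ℂ Vec} (hW : Module.finrank ℂ W = 2) :
    ∃ φ : Vec →ₗ[ℂ] ℂ, φ ≠ 0 ∧ LinearMap.ker φ = W := by
  have h1 : W < ⊤ := by
    rw [lt_top_iff_ne_top]
    rintro rfl
    rw [finrank_top] at hW
    simp at hW
  obtain ⟨φ, hφ, hker⟩ := W.exists_le_ker_of_lt_top h1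
  exact ⟨φ, hφ, (Submodule.eq_of_le_of_finrank_eq hker (by
    rw [hW, finrank_ker_of_ne_zero hφ])).symm⟩

/-- Otherwise the linear form defining W would be a common factor of the entries. -/
theorem Reduced.exists_ev_ne_zero {G : Triple} (hG : Reduced G) {W : Submodule ℂ Vec}
    (hW : Module.finrank ℂ W = 2) : ∃ v ∈ W, ev G v ≠ 0 := by
  by_contra! h
  obtain ⟨φ, hφ, rfl⟩ := exists_ker_eq hW
  obtain ⟨l, hl, hlv⟩ := exists_linear_form_polynomial φ
  have h1 := hG l fun i => dvd_of_eval_eq_zero hφ hlv fun v hv => congrFun (h v hv) i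
  apply hφ
  ext v
  have h2 : l.totalDegree = 0 := by
    rw [MvPolynomial.isUnit_iff_totalDegree_of_isReduced] at h1
    exact h1.2
  by_cases hl0 : l = 0
  · rw [LinearMap.comp_apply, ← hlv, hl0]
    simp
  · rw [hl.totalDegree hl0] at h2
    omega

end Planes

section Quadratics

theorem eq_zero_of_infinite_quadratic {a b c : ℂ}
    (h : {y : ℂ | a * y ^ 2 + b * y + c = 0}.Infinite) : a = 0 ∧ b = 0 ∧ c = 0 := by
  have h1 : (Polynomial.C a * Polynomial.X ^ 2 + Polynomial.C b * Polynomial.X +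
      Polynomial.C c : Polynomial ℂ) = 0 := by
    apply Polynomial.eq_zero_of_infinite_isRoot
    refine h.mono fun y hy => ?_
    simpa [Polynomial.IsRoot] using hy
  refine ⟨?_, ?_, ?_⟩
  · simpa [Polynomial.coeff_X, Polynomial.coeff_C] using congrArg (Polynomial.coeff · 2) h1
  · simpa [Polynomial.coeff_X, Polynomial.coeff_C] using congrArg (Polynomial.coeff · 1) h1
  · simpa [Polynomial.coeff_X, Polynomial.coeff_C] using congrArg (Polynomial.coeff · 0) h1

/-- A rational function `(a y² + b y + c) / (β y + δ)` with `a ≠ 0` that is injective off a finite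
set is not in lowest terms. -/
theorem exists_common_zero {a b c β δ : ℂ} (ha : a ≠ 0) (hne : ¬ (β = 0 ∧ δ = 0)) {B : Set ℂ}
    (hB : B.Finite) (h : ∀ x y, x ∉ B → y ∉ B →
      (a * x ^ 2 + b * x + c) * (β * y + δ) = (a * y ^ 2 + b * y + c) * (β * x + δ) → x = y) :
    ∃ y, a * y ^ 2 + b * y + c = 0 ∧ β * y + δ = 0 := by
  by_contra! hno
  have hQ : {y : ℂ | 0 * y ^ 2 + β * y + δ = 0}.Finite := by
    by_contra h1
    obtain ⟨-, h2, h3⟩ := eq_zero_of_infinite_quadratic h1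
    exact hne ⟨h2, h3⟩
  have hD : {y : ℂ | a * β * y ^ 2 + 2 * a * δ * y + (b * δ - β * c) = 0}.Finite := by
    by_contra h1
    obtain ⟨h2, h3, -⟩ := eq_zero_of_infinite_quadratic h1
    exact hne ⟨(mul_eq_zero.1 h2).resolve_left ha,
      (mul_eq_zero.1 h3).resolve_left (mul_ne_zero two_ne_zero ha)⟩
  have hE : ∀ x ∈ B, {y : ℂ | (-(a * (β * x + δ))) * y ^ 2 +
      ((a * x ^ 2 + b * x + c) * β - b * (β * x + δ)) * y +
      ((a * x ^ 2 + b * x + c) * δ - c * (β * x + δ)) = 0}.Finite := by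
    intro x _
    by_contra h1
    obtain ⟨h2, h3, h4⟩ := eq_zero_of_infinite_quadratic h1
    have h5 : β * x + δ = 0 := (mul_eq_zero.1 (neg_eq_zero.1 h2)).resolve_left ha
    rw [h5, mul_zero, sub_zero] at h3 h4
    have h6 : a * x ^ 2 + b * x + c ≠ 0 := fun h6 => hno x h6 h5
    exact hne ⟨(mul_eq_zero.1 h3).resolve_left h6, (mul_eq_zero.1 h4).resolve_left h6⟩
  obtain ⟨y, hy⟩ := ((hQ.union (hD.union (hB.union (hB.biUnion hE)))).infinite_compl).nonempty
  simp only [Set.mem_compl_iff, Set.mem_union, Set.mem_iUnion, Set.mem_ofPred_eq, not_or,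
    not_exists] at hy
  obtain ⟨hy1, hy2, hy3, hy4⟩ := hy
  have hy1' : β * y + δ ≠ 0 := fun h => hy1 (by linear_combination h)
  -- By Vieta, y' is the other solution x of P(x)/Q(x) = P(y)/Q(y). The point y was chosen off the
  -- poles (hQ), off the critical points where y' = y (hD), and off the fibres through points of B
  -- (hE), so injectivity is contradicted.
  set y' := -y - (b * (β * y + δ) - β * (a * y ^ 2 + b * y + c)) / (a * (β * y + δ)) with hy'
  have hrel : (y' + y) * (a * (β * y + δ)) =
      -(b * (β * y + δ) - β * (a * y ^ 2 + b * y + c)) := by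
    rw [hy', sub_add_eq_add_sub, neg_add_cancel, zero_sub, neg_mul,
      div_mul_cancel₀ _ (mul_ne_zero ha hy1')]
  have hvieta : (a * y ^ 2 + b * y + c) * (β * y' + δ) =
      (a * y' ^ 2 + b * y' + c) * (β * y + δ) := by
    linear_combination (-(y' - y)) * hrel
  by_cases hmem : y' ∈ B
  · apply hy4 y' hmem
    linear_combination -hvieta
  · have hyy := h y y' hy3 hmem hvieta
    apply hy2
    rw [← hyy] at hrel
    linear_combination hrel

end Quadratics

/-! ### Existence of coordinates and reduction of the inverse -/

section Coordinates

theorem exists_mem_notMem_span {W : Submodule ℂ Vec} (hW : Module.finrank ℂ W = 2) (z : Vec) :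
    ∃ w ∈ W, w ∉ Submodule.span ℂ {z} := by
  by_contra! h
  have h1 := Submodule.finrank_mono (show W ≤ Submodule.span ℂ {z} from h)
  have h2 := finrank_span_le_card (R := ℂ) ({z} : Set Vec)
  rw [Set.toFinset_singleton, Finset.card_singleton] at h2
  omega

/-- Coordinates on three concurrent lines exist. -/
theorem nonempty_lineCoords {L : Fin 3 → Submodule ℂ Vec} (hL : IsConcurrentTriple L) :
    Nonempty (LineCoords L) := by
  obtain ⟨z, hz, hzL⟩ := hL.concurrent
  have hnot : ∀ i j, i ≠ j → ∀ w ∈ L i, w ∉ Submodule.span ℂ {z} → w ∉ L j := by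
    intro i j hij w hw hwz hwj
    apply hij
    apply hL.injective
    have h1 : LinearIndependent ℂ ![z, w] := by
      rw [LinearIndependent.pair_iff' hz]
      intro a ha
      exact hwz (Submodule.mem_span_singleton.2 ⟨a, ha⟩)
    have h2 : Module.finrank ℂ (Submodule.span ℂ (Set.range ![z, w])) = 2 := by
      rw [finrank_span_eq_card h1]
      rfl
    have h3 : ∀ k, w ∈ L k → Submodule.span ℂ (Set.range ![z, w]) = L k := by
      intro k hk
      apply Submodule.eq_of_le_of_finrank_eq _ (by rw [h2, hL.finrank_eq])
      rw [Submodule.span_le]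
      rintro _ ⟨m, rfl⟩
      fin_cases m
      · exact hzL k
      · exact hk
    rw [← h3 i hw, ← h3 j hwj]
  obtain ⟨u, hu, huz⟩ := exists_mem_notMem_span (hL.finrank_eq 0) z
  obtain ⟨v, hv, hvz⟩ := exists_mem_notMem_span (hL.finrank_eq 1) z
  obtain ⟨w, hw, hwz⟩ := exists_mem_notMem_span (hL.finrank_eq 2) z
  have hlt : L 0 < L 0 ⊔ L 1 := by
    refine lt_of_le_of_ne le_sup_left fun h => ?_
    exact hnot 1 0 (by decide) v hv hvz (h ▸ (le_sup_right : L 1 ≤ L 0 ⊔ L 1) hv)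
  have h1 := Submodule.finrank_lt_finrank_of_lt hlt
  have h2 : L 0 ⊔ L 1 = ⊤ := by
    apply Submodule.eq_top_of_finrank_eq
    have h3 := Submodule.finrank_le (L 0 ⊔ L 1)
    rw [hL.finrank_eq] at h1
    simp only [Module.finrank_fintype_fun_eq_card, Fintype.card_fin] at h3 ⊢
    omega
  -- A vector of the third plane splits as p + q along the first two; its negative serves as the
  -- third basis vector and makes the sum zero.
  obtain ⟨p, hp, q, hq, hpq⟩ := Submodule.mem_sup.1 (h2 ▸ Submodule.mem_top : w ∈ L 0 ⊔ L 1)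
  have hpz : p ∉ Submodule.span ℂ {z} := by
    intro h
    apply hnot 2 1 (by decide) w hw hwz
    rw [← hpq]
    refine (L 1).add_mem ?_ hq
    obtain ⟨a, rfl⟩ := Submodule.mem_span_singleton.1 h
    exact (L 1).smul_mem _ (hzL 1)
  have hqz : q ∉ Submodule.span ℂ {z} := by
    intro h
    apply hnot 2 0 (by decide) w hw hwz
    rw [← hpq]
    refine (L 0).add_mem hp ?_
    obtain ⟨a, rfl⟩ := Submodule.mem_span_singleton.1 h
    exact (L 0).smul_mem _ (hzL 0)
  refine ⟨⟨z, ![p, q, -w], hz, hzL, ?_, ?_, ?_⟩⟩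
  · intro i
    fin_cases i
    exacts [hp, hq, (L 2).neg_mem hw]
  · intro i
    fin_cases i
    · exact hpz
    · exact hqz
    · intro h
      exact hwz (neg_mem_iff.1 h)
  · simp [hpq]

end Coordinates

section Inverse

theorem reduced_X : Reduced fun i => (X i : MvPolynomial (Fin 3) ℂ) := by
  intro h hh
  by_contra hu
  have h0 : X 0 ∣ h :=
    ((X_prime (i := (0 : Fin 3)) (R := ℂ)).irreducible.dvd_iff.1 (hh 0)).resolve_left hu |>.dvd
  have := X_dvd_X.1 (h0.trans (hh 1))
  simp at this

/-- A reduced birational map has a reduced inverse. -/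
theorem exists_reduced_inverse {f g : PlaneMap} {F : Triple} {D : MvPolynomial (Fin 3) ℂ}
    (hF : ∀ i, f.coord i = D * F i) (hfg : f.IsInverse g) :
    ∃ (G : Triple) (e : ℕ) (h : MvPolynomial (Fin 3) ℂ), Reduced G ∧
      (∀ i, (G i).IsHomogeneous e) ∧ h ≠ 0 ∧ ∀ i, bind₁ F (G i) = h * X i := by
  obtain ⟨⟨h, h0, hh⟩, -⟩ := hfg
  obtain ⟨D', G, e, -, -, -, -, hG, he, hgG⟩ := exists_reduced g.ne_zero g.homogeneous
  set M := D ^ g.deg * bind₁ F D' with hM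
  have h1 : ∀ i, M * bind₁ F (G i) = h * X i := by
    intro i
    rw [← hh i, tripleComp, show f.coord = fun i => D * F i from funext hF,
      bind₁_mul_triple (g.homogeneous i), hgG i, map_mul, hM]
    ring
  obtain ⟨h', rfl⟩ := reduced_X.dvd_of_forall_dvd_mul fun i => ⟨_, (h1 i).symm⟩
  have hM0 := left_ne_zero_of_mul h0
  refine ⟨G, e, h', hG, he, right_ne_zero_of_mul h0, fun i => mul_left_cancel₀ hM0 ?_⟩
  rw [h1 i, mul_assoc]

end Inverse

/-! ### Classification of the quadratic maps properly fixing the cubic -/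

namespace LineCoords

variable {L : Fin 3 → Submodule ℂ Vec} (γ : LineCoords L)

theorem mem_span_z (hL : IsConcurrentTriple L) {v : Vec} (h : ∀ i, v ∈ L i) :
    ∃ a : ℂ, v = a • γ.z := by
  obtain ⟨a, b, rfl⟩ := (γ.mem_iff hL 0).1 (h 0)
  have := (γ.smul_vec_mem_iff hL (i := 0) (j := 1) (by decide)).1 (h 1)
  exact ⟨a, by rw [this, zero_smul, add_zero]⟩

/-- The mixed term of a quadratic map on a line through the center. -/
def mixed (F : Triple) (i : Fin 3) : Vec := ev F (γ.z + γ.w i) - ev F γ.z - ev F (γ.w i)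

theorem ev_vec {F : Triple} (hF : ∀ i, (F i).IsHomogeneous 2) (i : Fin 3) (y : ℂ) :
    ev F (γ.vec i y) = y ^ 2 • ev F γ.z + y • γ.mixed F i + ev F (γ.w i) :=
  ev_polarization_line hF _ _ y

variable {F : Triple} {f : PlaneMap}

/-- A quadratic map fixing the cubic permutes the lines, contracts none of them, and fixes the
center unless that is indeterminate. -/
theorem exists_perm (hL : IsConcurrentTriple L) (hF : Reduced F)
    (hd : ∀ i, (F i).IsHomogeneous 2) (hf : Proportional f.coord F) (hfix : f.ProperlyFixes L) :
    ∃ (τ : Equiv.Perm (Fin 3)) (a : ℂ) (b c β δ : Fin 3 → ℂ), a ≠ 0 ∧ ev F γ.z = a • γ.z ∧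
      (∀ i, γ.mixed F i = b i • γ.z + β i • γ.w (τ i)) ∧
      (∀ i, ev F (γ.w i) = c i • γ.z + δ i • γ.w (τ i)) ∧ ∀ i, ¬ (β i = 0 ∧ δ i = 0) := by
  have hz : ev F γ.z ≠ 0 := by
    intro h
    exact (hfix.2 γ.center γ.center_mem).1 ((PlaneMap.mk_mem_indet_iff hF hd hf γ.z_ne_zero).2 h)
  have himg : ∀ i y, ∃ j, ev F (γ.vec i y) ∈ L j := by
    intro i y
    by_cases h : ev F (γ.vec i y) = 0
    · exact ⟨0, by rw [h]; exact (L 0).zero_mem⟩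
    · have : Projectivization.mk ℂ _ h ∈ cubic L := by
        rw [← hfix.1]
        refine subset_zariskiClosure _ ⟨γ.pt i y, ⟨i, γ.pt_mem i y⟩, ?_⟩
        exact (PlaneMap.sends_mk_iff hF hd hf (γ.vec_ne_zero' i y)).2 ⟨h, rfl⟩
      obtain ⟨j, hj⟩ := this
      exact ⟨j, (mk_mem_pointsOf h).1 hj⟩
  have hex : ∀ i, ∃ j, ev F γ.z ∈ L j ∧ γ.mixed F i ∈ L j ∧ ev F (γ.w i) ∈ L j := by
    intro i
    -- Pigeonhole: infinitely many points of the line go to one line. The linear form of that line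
    -- is then a quadratic polynomial in y with infinitely many zeros.
    obtain ⟨j, hj⟩ : ∃ j, {y : ℂ | ev F (γ.vec i y) ∈ L j}.Infinite := by
      by_contra! h
      refine Set.infinite_univ (α := ℂ) ((Set.finite_iUnion h).subset fun y _ => ?_)
      obtain ⟨j, hj⟩ := himg i y
      exact Set.mem_iUnion.2 ⟨j, hj⟩
    obtain ⟨φ, -, hker⟩ := exists_ker_eq (hL.finrank_eq j)
    refine ⟨j, ?_⟩
    rw [← hker] at hj ⊢
    simp only [LinearMap.mem_ker] at hj ⊢
    apply eq_zero_of_infinite_quadratic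
    refine hj.mono fun y hy => ?_
    rw [Set.mem_ofPred_eq, γ.ev_vec hd] at hy
    simp only [map_add, map_smul, smul_eq_mul] at hy
    rw [Set.mem_ofPred_eq, ← hy]
    ring
  choose ρ hρ using hex
  -- If each line could be sent into a line other than L j, the closed set f(C) would lie in two
  -- lines. The second clause also excludes that a line is contracted to the center.
  have hsurj : ∀ j, ∃ i, ρ i = j ∧
      ∀ k ≠ j, ¬ (ev F γ.z ∈ L k ∧ γ.mixed F i ∈ L k ∧ ev F (γ.w i) ∈ L k) := by
    intro j
    by_contra! h
    have h1 : ∀ i, ∃ k ∈ Finset.univ.erase j,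
        ev F γ.z ∈ L k ∧ γ.mixed F i ∈ L k ∧ ev F (γ.w i) ∈ L k := by
      intro i
      by_cases hi : ρ i = j
      · obtain ⟨k, hk, h2⟩ := h i hi
        exact ⟨k, by simpa using hk, h2⟩
      · exact ⟨ρ i, by simpa using hi, hρ i⟩
    have h2 : γ.pt j 0 ∈ f.strictImage (cubic L) := by
      rw [hfix.1]
      exact ⟨j, γ.pt_mem j 0⟩
    obtain ⟨k, hk, h3⟩ := zariskiClosure_subset_iUnion (T := Finset.univ.erase j) (W := L) (by
      rintro q ⟨p, ⟨i, hi⟩, hpq⟩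
      rcases γ.eq_center_or_eq_pt hL hi with rfl | ⟨x, rfl⟩
      · obtain ⟨h4, rfl⟩ := (PlaneMap.sends_mk_iff hF hd hf γ.z_ne_zero).1 hpq
        obtain ⟨k, hk, hk1, -⟩ := h1 0
        exact ⟨k, hk, (mk_mem_pointsOf _).2 hk1⟩
      · obtain ⟨h4, rfl⟩ := (PlaneMap.sends_mk_iff hF hd hf (γ.vec_ne_zero' i x)).1 hpq
        obtain ⟨k, hk, hk1, hk2, hk3⟩ := h1 i
        refine ⟨k, hk, (mk_mem_pointsOf _).2 ?_⟩
        rw [γ.ev_vec hd]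
        exact (L k).add_mem ((L k).add_mem ((L k).smul_mem _ hk1) ((L k).smul_mem _ hk2)) hk3) h2
    rw [pt_eq_mk, mk_mem_pointsOf, γ.vec_mem_iff hL] at h3
    simp [h3] at hk
  have hbij : Function.Bijective ρ := by
    rw [← Finite.surjective_iff_bijective]
    intro j
    obtain ⟨i, hi, -⟩ := hsurj j
    exact ⟨i, hi⟩
  obtain ⟨a, ha⟩ := γ.mem_span_z hL (v := ev F γ.z) fun j => by
    obtain ⟨i, rfl⟩ := hbij.2 j
    exact (hρ i).1
  have h1 := fun i => (γ.mem_iff hL _).1 (hρ i).2.1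
  have h2 := fun i => (γ.mem_iff hL _).1 (hρ i).2.2
  choose b β hb using h1
  choose c δ hc using h2
  refine ⟨Equiv.ofBijective ρ hbij, a, b, c, β, δ, ?_, ha, hb, hc, ?_⟩
  · rintro rfl
    rw [zero_smul] at ha
    exact hz ha
  · rintro i ⟨hβ, hδ⟩
    obtain ⟨i', hi', h3⟩ := hsurj (ρ i)
    obtain rfl := hbij.1 hi'
    obtain ⟨k, hk⟩ : ∃ k, k ≠ ρ i' := exists_ne _
    apply h3 k hk
    rw [ha, hb, hc, hβ, hδ, zero_smul, add_zero, add_zero]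
    exact ⟨(L k).smul_mem _ (γ.z_mem k), (L k).smul_mem _ (γ.z_mem k),
      (L k).smul_mem _ (γ.z_mem k)⟩

/-- A polynomial map that is homogeneous and vanishes at infinitely many points of a line through
the center vanishes on it. -/
theorem ev_eq_zero_of_infinite (hL : IsConcurrentTriple L) {G : Triple} {e : ℕ}
    (he : ∀ i, (G i).IsHomogeneous e) {j : Fin 3} (h : {x : ℂ | ev G (γ.vec j x) = 0}.Infinite)
    {v : Vec} (hv : v ∈ L j) : ev G v = 0 := by
  funext k
  have h1 : ∀ x, eval (γ.vec j x) (G k) = 0 := by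
    intro x
    have : lineRestrict γ.z (γ.w j) (G k) = 0 := by
      apply Polynomial.eq_zero_of_infinite_isRoot
      refine h.mono fun y hy => ?_
      rw [Set.mem_ofPred_eq, Polynomial.IsRoot, eval_lineRestrict]
      exact congrFun hy k
    have h2 := eval_lineRestrict γ.z (γ.w j) (G k) x
    rw [this, Polynomial.eval_zero] at h2
    exact h2.symm
  have h2 : ∀ a b : ℂ, b ≠ 0 → eval (b • γ.w j + a • γ.z) (G k) = 0 := by
    intro a b hb
    have h3 : b • γ.w j + a • γ.z = b • γ.vec j (b⁻¹ * a) := by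
      rw [vec, smul_add, smul_smul, mul_inv_cancel_left₀ hb, add_comm]
    rw [h3, eval_smul_of_isHomogeneous (he k), h1, mul_zero]
  obtain ⟨a, b, rfl⟩ := (γ.mem_iff hL j).1 hv
  have h3 : lineRestrict (γ.w j) (a • γ.z) (G k) = 0 := by
    apply Polynomial.eq_zero_of_infinite_isRoot
    refine (Set.finite_singleton (0 : ℂ)).infinite_compl.mono fun y hy => ?_
    rw [Set.mem_ofPred_eq, Polynomial.IsRoot, eval_lineRestrict]
    exact h2 a y (by simpa using hy)
  have h4 := eval_lineRestrict (γ.w j) (a • γ.z) (G k) b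
  rw [h3, Polynomial.eval_zero, add_comm] at h4
  exact h4.symm

/-- A quadratic birational map that properly fixes the cubic is indeterminate at a point of each
line. -/
theorem exists_zero_on_line (hL : IsConcurrentTriple L) (hd : ∀ i, (F i).IsHomogeneous 2)
    {G : Triple} {e : ℕ} {h : MvPolynomial (Fin 3) ℂ} (hG : Reduced G)
    (he : ∀ i, (G i).IsHomogeneous e) (hGF : ∀ i, bind₁ F (G i) = h * X i)
    {i j : Fin 3} {a b c β δ : ℂ} (ha : a ≠ 0) (hz : ev F γ.z = a • γ.z)
    (hm : γ.mixed F i = b • γ.z + β • γ.w j) (hw : ev F (γ.w i) = c • γ.z + δ • γ.w j)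
    (hne : ¬ (β = 0 ∧ δ = 0)) : ∃ x, ev F (γ.vec i x) = 0 := by
  have hev : ∀ y, ev F (γ.vec i y) =
      (a * y ^ 2 + b * y + c) • γ.z + (β * y + δ) • γ.w j := by
    intro y
    rw [γ.ev_vec hd, hz, hm, hw]
    module
  have hGv : ∀ v, ev G (ev F v) = eval v h • v := by
    intro v
    rw [← ev_tripleComp]
    funext k
    simp only [ev, tripleComp, hGF, map_mul, eval_X, Pi.smul_apply, smul_eq_mul]
  suffices h1 : ∃ y, a * y ^ 2 + b * y + c = 0 ∧ β * y + δ = 0 by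
    obtain ⟨y, h1, h2⟩ := h1
    exact ⟨y, by rw [hev, h1, h2, zero_smul, zero_smul, add_zero]⟩
  by_contra hno
  have hQfin : {y : ℂ | 0 * y ^ 2 + β * y + δ = 0}.Finite := by
    by_contra h1
    obtain ⟨-, h2, h3⟩ := eq_zero_of_infinite_quadratic h1
    exact hne ⟨h2, h3⟩
  -- If h vanished on the line, G would vanish on the infinite image of that line, hence on all of L
  -- j, contrary to G being reduced.
  have hB : {y : ℂ | eval (γ.vec i y) h = 0}.Finite := by
    by_contra hinf
    have hzero : ∀ y, eval (γ.vec i y) h = 0 := by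
      have : lineRestrict γ.z (γ.w i) h = 0 := by
        apply Polynomial.eq_zero_of_infinite_isRoot
        refine Set.Infinite.mono (fun y hy => ?_) hinf
        rw [Set.mem_ofPred_eq, Polynomial.IsRoot, eval_lineRestrict]
        exact hy
      intro y
      have h2 := eval_lineRestrict γ.z (γ.w i) h y
      rw [this, Polynomial.eval_zero] at h2
      exact h2.symm
    obtain ⟨v, hv, hv0⟩ := hG.exists_ev_ne_zero (hL.finrank_eq j)
    apply hv0
    refine γ.ev_eq_zero_of_infinite hL he ?_ hv
    intro hfin
    have hfib : ∀ r ∈ {x : ℂ | ev G (γ.vec j x) = 0},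
        {y : ℂ | a * y ^ 2 + (b - r * β) * y + (c - r * δ) = 0}.Finite := by
      intro r _
      by_contra h1
      exact ha (eq_zero_of_infinite_quadratic h1).1
    obtain ⟨y, hy⟩ := ((hQfin.union (hfin.biUnion hfib)).infinite_compl).nonempty
    simp only [Set.mem_compl_iff, Set.mem_union, Set.mem_iUnion, Set.mem_ofPred_eq, not_or,
      not_exists] at hy
    obtain ⟨hy1, hy2⟩ := hy
    have hy1' : β * y + δ ≠ 0 := fun h => hy1 (by linear_combination h)
    refine hy2 ((a * y ^ 2 + b * y + c) / (β * y + δ)) ?_ ?_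
    · have h2 := hGv (γ.vec i y)
      rw [hzero, zero_smul, hev, show (a * y ^ 2 + b * y + c) • γ.z + (β * y + δ) • γ.w j =
        (β * y + δ) • γ.vec j ((a * y ^ 2 + b * y + c) / (β * y + δ)) by
          rw [vec, smul_add, smul_smul, mul_div_cancel₀ _ hy1'], ev_smul he] at h2
      exact (smul_eq_zero.1 h2).resolve_left (pow_ne_zero _ hy1')
    · have := div_mul_cancel₀ (a * y ^ 2 + b * y + c) hy1'
      linear_combination -this
  -- Where h ≠ 0 the restriction is injective: proportional values of F give, after applying G,
  -- proportional points.
  refine hno (exists_common_zero ha hne hB ?_)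
  intro x y hx hy hxy
  rw [Set.mem_ofPred_eq] at hx hy
  push Not at hno
  obtain ⟨κ, hκ⟩ : ∃ κ : ℂ, ev F (γ.vec i x) = κ • ev F (γ.vec i y) := by
    rw [hev, hev]
    by_cases hy0 : β * y + δ = 0
    · have hPy : a * y ^ 2 + b * y + c ≠ 0 := fun h => hno y h hy0
      have hQx : β * x + δ = 0 := by
        rw [hy0, mul_zero] at hxy
        exact (mul_eq_zero.1 hxy.symm).resolve_left hPy
      refine ⟨(a * x ^ 2 + b * x + c) / (a * y ^ 2 + b * y + c), ?_⟩
      rw [hQx, hy0, smul_add, smul_smul, div_mul_cancel₀ _ hPy]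
      simp
    · refine ⟨(β * x + δ) / (β * y + δ), ?_⟩
      rw [smul_add, smul_smul, smul_smul, div_mul_cancel₀ _ hy0]
      congr 2
      field_simp
      linear_combination hxy
  have h1 := congrArg (ev G) hκ
  rw [ev_smul he, hGv, hGv, smul_smul] at h1
  obtain ⟨h2, h3⟩ := γ.linearIndependent_pair i
    (a := eval (γ.vec i x) h * x - κ ^ e * eval (γ.vec i y) h * y)
    (b := eval (γ.vec i x) h - κ ^ e * eval (γ.vec i y) h) (by
      rw [← sub_eq_zero] at h1
      rw [← h1, vec, vec]
      module)
  apply mul_left_cancel₀ hx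
  linear_combination h2 - y * h3

end LineCoords

namespace LineCoords

variable {L : Fin 3 → Submodule ℂ Vec} (γ : LineCoords L)

/-- Points of indeterminacy on the three lines are not collinear. -/
theorem sum_ne_zero_of_zeros (hL : IsConcurrentTriple L) {F : Triple} (hF : Reduced F)
    (hd : ∀ i, (F i).IsHomogeneous 2) {t : Fin 3 → ℂ} (ht : ∀ i, ev F (γ.vec i (t i)) = 0) :
    ∑ i, t i ≠ 0 := by
  intro h0
  have hsum : γ.vec 0 (t 0) + γ.vec 1 (t 1) = (-1 : ℂ) • γ.vec 2 (t 2) := by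
    have h1 : γ.vec 0 (t 0) + γ.vec 1 (t 1) + γ.vec 2 (t 2) = 0 := by
      rw [Fin.sum_univ_three] at h0
      calc _ = (t 0 + t 1 + t 2) • γ.z + (γ.w 0 + γ.w 1 + γ.w 2) := by
            simp only [vec]; module
        _ = 0 := by rw [h0, γ.w_sum, zero_smul, add_zero]
    rw [neg_one_smul]
    exact eq_neg_of_add_eq_zero_left h1
  -- A quadratic form with three zeros on a projective line vanishes on that line.
  have hzero : ∀ a b : ℂ, ev F (a • γ.vec 0 (t 0) + b • γ.vec 1 (t 1)) = 0 := by
    intro a b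
    rw [ev_polarization_two hd, ht, ht, hsum, ev_smul hd, ht]
    simp
  have hli : LinearIndependent ℂ ![γ.vec 0 (t 0), γ.vec 1 (t 1)] := by
    rw [LinearIndependent.pair_iff]
    intro a b hab
    obtain ⟨-, h1, h2⟩ := γ.linearIndependent_zw hL (a := a * t 0 + b * t 1) (b := a) (c := b) (by
      rw [← hab, vec, vec]
      module)
    exact ⟨h1, h2⟩
  obtain ⟨v, hv, hv0⟩ := hF.exists_ev_ne_zero (finrank_span_eq_card hli)
  simp only [Matrix.range_cons, Matrix.range_empty, Set.union_empty, Set.singleton_union] at hv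
  obtain ⟨a, b, rfl⟩ := Submodule.mem_span_pair.1 hv
  exact hv0 (hzero a b)

/-- A quadratic birational map that properly fixes the cubic is a standard map. -/
theorem exists_std (hL : IsConcurrentTriple L) {f : PlaneMap} (hf : f.IsQuadraticBirational)
    (hfix : f.ProperlyFixes L) :
    ∃ (τ : Equiv.Perm (Fin 3)) (t s : Fin 3 → ℂ) (ht : ∑ i, t i ≠ 0) (hs : ∑ i, s i ≠ 0),
      Proportional f.coord (γ.stdTriple hL τ t s ht hs) := by
  obtain ⟨hdeg, g, hg⟩ := hf
  obtain ⟨D, F, e, k, hD, -, -, hF, hd, hfF⟩ := exists_reduced f.ne_zero f.homogeneous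
  obtain rfl : e = 2 := by rw [← hdeg, PlaneMap.degree, hF.tripleDegree_eq hd hD hfF]
  obtain ⟨G, e, h, hG, he, -, hGF⟩ := exists_reduced_inverse hfF hg
  have hprop := proportional_of_eq_mul hfF
  obtain ⟨τ, a, b, c, β, δ, ha, hz, hm, hw, hne⟩ := γ.exists_perm hL hF hd hprop hfix
  have hex := fun i => γ.exists_zero_on_line hL hd hG he hGF ha hz (hm i) (hw i) (hne i)
  choose t ht using hex
  have hS := γ.sum_ne_zero_of_zeros hL hF hd ht
  set N : Fin 3 → Fin 3 → Vec := fun i j => ev F (γ.vec i (t i) + γ.vec j (t j)) -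
    ev F (γ.vec i (t i)) - ev F (γ.vec j (t j)) with hN
  set m : Fin 3 → Vec := ![N 1 2, N 0 2, N 0 1] with hmdef
  set A := γ.frameGL hL 1 t hS with hA
  -- F vanishes at the three frame vectors, so only the mixed terms of the quadratic forms survive.
  -- These are the entries of J.
  have hFA : ∀ y : Vec, ev F ((A : Matrix (Fin 3) (Fin 3) ℂ).mulVec y) =
      ∑ i, cremona y i • m i := by
    intro y
    rw [hA, coe_frameGL, frame_mulVec, Fin.sum_univ_three, ev_polarization hd, Fin.sum_univ_three]
    simp only [Equiv.Perm.one_apply, ht, smul_zero, zero_add]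
    simp only [hmdef, hN, ht, cremona]
    simp only [Matrix.cons_val_zero, Matrix.cons_val_one, Matrix.cons_val]
    abel
  have hFz : (∑ i, t i) ^ 2 • ev F γ.z = ∑ i, m i := by
    rw [← ev_smul hd]
    have h1 := γ.frame_mulVec_const 1 t 1
    rw [one_mul] at h1
    rw [← h1]
    refine (hFA _).trans (Finset.sum_congr rfl fun i _ => ?_)
    have : cremona (fun _ => 1) i = 1 := by fin_cases i <;> simp [cremona]
    rw [this, one_smul]
  have hFvec : ∀ i r, ev F (γ.vec i (t i + r * ∑ j, t j)) = r • ((r + 1) • (∑ j, m j) - m i) := by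
    intro i r
    have h1 : γ.vec i (t i + r * ∑ j, t j) = (A : Matrix (Fin 3) (Fin 3) ℂ).mulVec
        (Pi.single i 1 + fun _ => r) := by
      rw [Matrix.mulVec_add, hA, coe_frameGL, frame_mulVec_single, frame_mulVec_const,
        Equiv.Perm.one_apply, vec, vec]
      module
    rw [h1, hFA, cremona_single_add_const]
    simp only [Pi.smul_apply, Pi.sub_apply, smul_eq_mul, mul_smul, sub_smul,
      Finset.sum_sub_distrib, ← Finset.smul_sum]
    congr 2
    rw [Finset.sum_eq_single i]
    · simp
    · intro j _ hj
      simp [hj]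
    · simp
  have hsum : ∑ i, m i = ((∑ i, t i) ^ 2 * a) • γ.z := by
    rw [← hFz, hz, smul_smul]
  -- At r = 1 the formula expresses m i through a value of F on Lᵢ, which lies in L (τ i), and the
  -- total Σ m, which is a multiple of z.
  have hmem : ∀ i, m i ∈ L (τ i) := by
    intro i
    have h1 := hFvec i 1
    rw [γ.ev_vec hd, hz, hm, hw, hsum, one_smul] at h1
    have h2 := (eq_sub_iff_add_eq.1 h1)
    rw [← eq_sub_iff_add_eq'] at h2
    rw [h2, γ.mem_iff hL]
    refine ⟨2 * ((∑ i, t i) ^ 2 * a) - ((t i + 1 * ∑ j, t j) ^ 2 * a + (t i + 1 * ∑ j, t j) * b i +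
      c i), -((t i + 1 * ∑ j, t j) * β i + δ i), ?_⟩
    module
  have hmc := fun i => (γ.mem_iff hL _).1 (hmem i)
  choose s' c' hs' using hmc
  have hsum' : (∑ i, s' i - (∑ i, t i) ^ 2 * a) • γ.z + ∑ i, c' (τ⁻¹ i) • γ.w i = 0 := by
    rw [← Equiv.sum_comp τ (fun i => c' (τ⁻¹ i) • γ.w i), sub_smul, ← hsum, Finset.sum_congr rfl fun i _ => hs' i,
      Finset.sum_add_distrib, Finset.sum_smul]
    simp
  obtain ⟨h1, h2⟩ := γ.eq_of_sum_eq_zero hL hsum'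
  -- As Σ m is a multiple of z, the components along the wᵢ cancel, so their coefficients agree and
  -- can be scaled to 1.
  have hc' : ∀ i, c' i = c' 0 := fun i => by simpa using h2 (τ i) (τ 0)
  -- A zero coefficient would contract the line to the center.
  have hc0 : c' 0 ≠ 0 := by
    intro h0
    apply hne 0
    have h3 : ∀ y, β 0 * y + δ 0 = 0 := by
      intro y
      have h4 := hFvec 0 ((y - t 0) / ∑ j, t j)
      rw [div_mul_cancel₀ _ hS, add_sub_cancel, γ.ev_vec hd, hz, hm, hw, hsum, hs', h0] at h4
      rw [← sub_eq_zero] at h4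
      refine (γ.linearIndependent_pair (τ 0) (a := (y ^ 2 * a + y * b 0 + c 0) -
        (y - t 0) / (∑ j, t j) * (((y - t 0) / (∑ j, t j) + 1) * ((∑ i, t i) ^ 2 * a) - s' 0))
        (b := β 0 * y + δ 0) (Eq.trans ?_ h4)).2
      module
    have h4 := h3 0
    have h5 := h3 1
    rw [mul_zero, zero_add] at h4
    rw [h4, mul_one, add_zero] at h5
    exact ⟨h5, h4⟩
  have hs : ∑ i, s' i / c' 0 ≠ 0 := by
    rw [← Finset.sum_div]
    refine div_ne_zero ?_ hc0
    rw [sub_eq_zero.1 h1]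
    exact mul_ne_zero (pow_ne_zero _ hS) ha
  refine ⟨τ, t, fun i => s' i / c' 0, hS, hs, hprop.trans (G := F) ?_ hF.ne_zero⟩
  refine proportional_of_eq_mul (c := C (c' 0)) fun k => ?_
  apply MvPolynomial.funext
  intro x
  rw [map_mul, eval_C]
  have h3 : ev F x = c' 0 • ev (γ.stdTriple hL τ t (fun i => s' i / c' 0) hS hs) x := by
    rw [stdTriple, ev_basicTriple, coe_frameGL, frame_mulVec, Finset.smul_sum, ← mulVec_inv_mulVec A x,
      hFA, inv_mulVec_mulVec]
    refine Finset.sum_congr rfl fun i _ => ?_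
    rw [hs' i, hc' i, vec, smul_comm (c' 0)]
    congr 1
    rw [smul_add, smul_smul, mul_div_cancel₀ _ hc0]
  exact congrFun h3 k

end LineCoords

/-! ### Roots of unity among the roots of χₙ -/

section RootsOfUnity

/-- A root of unity congruent to one modulo two is a sign. -/
theorem eq_one_or_eq_neg_one_of_eq_one_add_two_mul {ζ β : ℂ} {m : ℕ} (hm : 0 < m)
    (hζ : ζ ^ m = 1) (hβ : IsIntegral ℤ β) (h : ζ = 1 + 2 * β) : ζ = 1 ∨ ζ = -1 := by
  by_cases hβ0 : β = 0
  · left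
    rw [h, hβ0, mul_zero, add_zero]
  right
  have hint : IsIntegral ℚ β := hβ.tower_top
  have : FiniteDimensional ℚ (IntermediateField.adjoin ℚ {β}) :=
    IntermediateField.adjoin.finiteDimensional hint
  have : NumberField (IntermediateField.adjoin ℚ {β}) := ⟨⟩
  set x := IntermediateField.AdjoinSimple.gen ℚ β with hx
  have hxβ : (x : ℂ) = β := IntermediateField.AdjoinSimple.coe_gen ℚ β
  have hnorm : ∀ w : ℂ, (1 + 2 * w) ^ m = 1 → ‖1 + 2 * w‖ = 1 := fun w hw =>
    Complex.norm_eq_one_of_pow_eq_one hw hm.ne'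
  -- Kronecker's theorem: each conjugate of 2β is a root of unity minus 1, so each conjugate of β
  -- has norm at most 1. Then |β| = |1 + 2β| = 1 forces β = −1.
  obtain ⟨k, hk, hk1⟩ := NumberField.Embeddings.pow_eq_one_of_norm_le_one
    (IntermediateField.adjoin ℚ {β}) ℂ (x := x)
    (fun h0 => hβ0 (by rw [← hxβ, h0]; rfl))
    (by
      rw [← isIntegral_algebraMap_iff (FaithfulSMul.algebraMap_injective _ ℂ)]
      change IsIntegral ℤ (x : ℂ)
      rwa [hxβ])
    (fun φ => by
      have h1 : (1 + 2 * x) ^ m = 1 := by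
        apply FaithfulSMul.algebraMap_injective _ ℂ
        rw [map_pow, map_add, map_one, map_mul, map_ofNat]
        change (1 + 2 * (x : ℂ)) ^ m = 1
        rw [hxβ, ← h, hζ]
      have h2 := congrArg φ h1
      simp only [map_pow, map_add, map_one, map_mul, map_ofNat] at h2
      have h3 := hnorm _ h2
      have h4 : 2 * φ x = (1 + 2 * φ x) - 1 := by ring
      have h5 := norm_sub_le (1 + 2 * φ x) 1
      rw [← h4, norm_mul, h3] at h5
      norm_num at h5
      linarith)
  have hβ1 : ‖β‖ = 1 := by
    apply Complex.norm_eq_one_of_pow_eq_one (n := k) _ hk.ne'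
    rw [← hxβ]
    exact_mod_cast congrArg (Subtype.val) hk1
  have h1 := hnorm β (h ▸ hζ)
  have h2 : β.re ^ 2 + β.im ^ 2 = 1 := by
    have := Complex.sq_norm β
    rw [hβ1, Complex.normSq_apply] at this
    linarith
  have h3 : (1 + 2 * β.re) ^ 2 + (2 * β.im) ^ 2 = 1 := by
    have := Complex.sq_norm (1 + 2 * β)
    rw [h1, Complex.normSq_apply] at this
    simp at this
    linarith
  have h4 : β.re = -1 := by linarith
  have h5 : β.im = 0 := by
    rw [h4] at h2
    exact pow_eq_zero_iff two_ne_zero |>.1 (by linarith)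
  have h6 : β = -1 := Complex.ext (by simp [h4]) (by simp [h5])
  rw [h, h6]
  norm_num

/-- The only roots of unity that are roots of `χₙ` are `1` and `-1`. -/
theorem IsChiRoot.eq_one_or_eq_neg_one {a : ℂ} {n m : ℕ} (ha : IsChiRoot n a) (hm : 0 < m)
    (ham : a ^ m = 1) (h2 : ¬ 2 ∣ n) (h3 : ¬ 3 ∣ n) : a = 1 ∨ a = -1 := by
  have hint : IsIntegral ℤ a := IsIntegral.of_pow hm (ham ▸ isIntegral_one)
  -- The equation χₙ(a) = 0 says that the root of unity aⁿ⁺¹ is congruent to 1 modulo 2.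
  have hζ : a ^ (n + 1) = 1 + 2 * (a ^ n - a) := by
    unfold IsChiRoot at ha
    linear_combination ha
  rcases eq_one_or_eq_neg_one_of_eq_one_add_two_mul hm
    (by rw [← pow_mul, mul_comm, pow_mul, ham, one_pow]) ((hint.pow n).sub hint) hζ with h | h
  · have h4 : a ^ n = a := by linear_combination (h - hζ) / 2
    rw [pow_succ, h4] at h
    exact mul_self_eq_one_iff.1 h
  · exfalso
    have h4 : a ^ n = a - 1 := by linear_combination (h - hζ) / 2
    rw [pow_succ, h4] at h
    -- In this case a² − a + 1 = 0. As n is ±1 modulo 6, aⁿ is a or a⁵, and neither equals a − 1.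
    have h5 : a ^ 6 = 1 := by linear_combination (a ^ 4 + a ^ 3 - a - 1) * h
    have h6 : a ^ n = a ^ (n % 6) := by
      conv_lhs => rw [← Nat.div_add_mod n 6, pow_add, pow_mul, h5, one_pow, one_mul]
    have h7 : n % 6 = 1 ∨ n % 6 = 5 := by omega
    rcases h7 with h7 | h7
    · rw [h7, pow_one, h4] at h6
      norm_num at h6
    · rw [h7, h4] at h6
      have h8 : a = 1 := by linear_combination (h6 + (a ^ 3 + a ^ 2 - 1) * h) / 2
      rw [h8] at h
      norm_num at h

theorem IsChiRoot.ne_zero {a : ℂ} {n : ℕ} (hn : 4 ≤ n) (ha : IsChiRoot n a) : a ≠ 0 := by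
  rintro rfl
  rw [IsChiRoot, zero_pow (by omega), zero_pow (by omega)] at ha
  norm_num at ha

end RootsOfUnity

/-! ### Permutations of the lines and twisted affine equations -/

section Perm

theorem perm_pow_six (τ : Equiv.Perm (Fin 3)) : τ ^ 6 = 1 := by
  have h : Fintype.card (Equiv.Perm (Fin 3)) = 6 := by
    rw [Fintype.card_perm, Fintype.card_fin]
    rfl
  rw [← h, pow_card_eq_one]

theorem perm_pow_three {τ : Equiv.Perm (Fin 3)} (h : ∀ i, τ i ≠ i) : τ ^ 3 = 1 := by
  decide +revert

theorem perm_pow_mod (τ : Equiv.Perm (Fin 3)) (n : ℕ) : τ ^ n = τ ^ (n % 6) := by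
  conv_lhs => rw [← Nat.div_add_mod n 6, pow_add, pow_mul, perm_pow_six, one_pow, one_mul]

/-- n² ≡ 1 modulo 6, a multiple of the order of every permutation. The n-th power map of S₃ is
therefore an involution, and each σ arises from exactly one τ. -/
theorem perm_pow_pow {n : ℕ} (h2 : ¬ 2 ∣ n) (h3 : ¬ 3 ∣ n) (τ : Equiv.Perm (Fin 3)) :
    (τ ^ n) ^ n = τ := by
  rw [← pow_mul, perm_pow_mod, Nat.mul_mod]
  have : n % 6 = 1 ∨ n % 6 = 5 := by omega
  rcases this with h | h <;> rw [h] <;> simp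

/-- Six steps bring every line back to itself and multiply c by a⁶. -/
theorem eq_zero_of_twisted {a : ℂ} (ha : a ^ 6 ≠ 1) {τ : Equiv.Perm (Fin 3)} {c : Fin 3 → ℂ}
    (hc : ∀ i, c (τ i) = a * c i) : c = 0 := by
  have h2 : ∀ k i, c ((τ ^ k) i) = a ^ k * c i := by
    intro k
    induction k with
    | zero => simp
    | succ k ih =>
      intro i
      rw [pow_succ', Equiv.Perm.mul_apply, hc, ih]
      ring
  funext i
  have h3 := h2 6 i
  rw [perm_pow_six, Equiv.Perm.one_apply] at h3
  have h4 : (1 - a ^ 6) * c i = 0 := by linear_combination h3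
  exact (mul_eq_zero.1 h4).resolve_left (sub_ne_zero.2 ha.symm)

/-- The equation `c ∘ τ = a c + b` is solvable unless `a⁶ = 1`. -/
theorem exists_twisted_fixed {a : ℂ} (ha : a ^ 6 ≠ 1) (τ : Equiv.Perm (Fin 3)) (b : Fin 3 → ℂ) :
    ∃ c : Fin 3 → ℂ, ∀ i, c (τ i) = a * c i + b i := by
  let T : (Fin 3 → ℂ) →ₗ[ℂ] (Fin 3 → ℂ) := LinearMap.funLeft ℂ ℂ τ - a • LinearMap.id
  have hT : Function.Injective T := by
    rw [← LinearMap.ker_eq_bot, LinearMap.ker_eq_bot']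
    exact fun c hc => eq_zero_of_twisted ha fun i => sub_eq_zero.1 (congrFun hc i)
  obtain ⟨c, hc⟩ := LinearMap.injective_iff_surjective.1 hT b
  refine ⟨c, fun i => ?_⟩
  have := congrFun hc i
  simp [T, LinearMap.funLeft] at this
  linear_combination this

end Perm

/-! ### The multiplier of a map with orbit data (n, n, n) -/

section OrbitArithmetic

open LineCoords

variable {τ : Equiv.Perm (Fin 3)} {t s : Fin 3 → ℂ} {a : ℂ}

theorem orb_succ (i : Fin 3) (k : ℕ) (ha : a = -(∑ j, s j) / ∑ j, t j) :
    orb τ t s i (k + 1) = s ((τ ^ (k + 1)) i) - (∑ j, s j) - a * t ((τ ^ (k + 1)) i) +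
      a * orb τ t s i k := by
  rw [orb, next, ha]
  ring

/-- At each step the permutation only reorders the three summands, so the sum obeys a scalar
recursion free of τ. -/
theorem sum_orb_succ (ht : ∑ i, t i ≠ 0) (ha : a = -(∑ j, s j) / ∑ j, t j) (k : ℕ) :
    ∑ i, orb τ t s i (k + 1) = a * ∑ i, orb τ t s i k - ∑ i, s i := by
  simp_rw [orb_succ _ _ ha, Finset.sum_add_distrib, ← Finset.mul_sum]
  rw [Equiv.sum_comp (τ ^ (k + 1)) (fun j => s j - (∑ j, s j) - a * t j)]
  simp only [Finset.sum_sub_distrib, ← Finset.mul_sum, Finset.sum_const, Finset.card_univ,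
    Fintype.card_fin, nsmul_eq_mul]
  have : a * ∑ j, t j = -∑ j, s j := by rw [ha, div_mul_cancel₀ _ ht]
  push_cast
  linear_combination -this

theorem sum_orb (ht : ∑ i, t i ≠ 0) (ha : a = -(∑ j, s j) / ∑ j, t j) (k : ℕ) :
    (a - 1) * ∑ i, orb τ t s i k = (∑ i, s i) * (a ^ k * (a - 2) + 1) := by
  induction k with
  | zero =>
    simp only [orb]
    ring
  | succ k ih =>
    rw [sum_orb_succ ht ha]
    linear_combination a * ih

theorem sum_orb_of_eq_one (ht : ∑ i, t i ≠ 0) (ha : 1 = -(∑ j, s j) / ∑ j, t j) (k : ℕ) :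
    ∑ i, orb τ t s i k = (∑ i, s i) * (1 - k) := by
  induction k with
  | zero => simp [orb]
  | succ k ih =>
    rw [sum_orb_succ ht ha, ih]
    push_cast
    ring

variable {m : ℕ} (ht : ∑ i, t i ≠ 0) (hs : ∑ i, s i ≠ 0) (ha : a = -(∑ j, s j) / ∑ j, t j)
  (hend : ∀ i, orb τ t s i m = t ((τ ^ (m + 1)) i))
include ht ha hend

theorem sum_orb_end : a * ∑ i, orb τ t s i m = -∑ i, s i := by
  rw [Finset.sum_congr rfl fun i _ => hend i, Equiv.sum_comp (τ ^ (m + 1)) t, ha,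
    div_mul_cancel₀ _ ht]

include hs

/-- The sum of the endpoints is computed twice: from the recursion, and as Σ tᵢ = −S/a. Equating and
cancelling S leaves χₙ(a) = 0 with n = m + 1. -/
theorem isChiRoot_of_orb : IsChiRoot (m + 1) a := by
  have h1 := sum_orb (τ := τ) ht ha m
  have h2 := sum_orb_end ht ha hend
  apply mul_left_cancel₀ hs
  rw [mul_zero]
  linear_combination (a - 1) * h2 - a * h1

/-- With slope 1 the sums form an arithmetic progression, which fits the endpoints only for m = 2.
-/
theorem ne_one_of_orb (hm : 3 ≤ m) : a ≠ 1 := by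
  rintro rfl
  have h1 := sum_orb_of_eq_one (τ := τ) ht ha m
  have h2 := sum_orb_end ht ha hend
  rw [h1, one_mul] at h2
  have h3 : ((m : ℂ) - 2) = 0 := by
    apply mul_left_cancel₀ hs
    linear_combination -h2
  have h4 : (m : ℂ) = (2 : ℕ) := by
    push_cast
    linear_combination h3
  have := Nat.cast_injective h4
  omega

omit ht hs in
-- With slope −1 orbits are periodic: with period 2 on a line fixed by τ, with period 6 if τ is a
-- 3-cycle. The end condition then forces some orbit to meet the indeterminacy locus already at its
-- first point.
theorem ne_neg_one_of_orb (hm : 3 ≤ m) (h2 : ¬ 2 ∣ m + 1) (h3 : ¬ 3 ∣ m + 1)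
    (hne : ∀ i, ∀ k < m, orb τ t s i k ≠ t ((τ ^ (k + 1)) i)) : a ≠ -1 := by
  rintro rfl
  by_cases hfix : ∃ i, τ i = i
  · obtain ⟨i, hi⟩ := hfix
    have hpow : ∀ k : ℕ, (τ ^ k) i = i := fun k =>
      Function.IsFixedPt.perm_pow (e := τ) hi k
    have hper : ∀ k : ℕ, orb τ t s i (2 * k) = s i := by
      intro k
      induction k with
      | zero => rfl
      | succ k ih =>
        rw [show 2 * (k + 1) = 2 * k + 1 + 1 by ring, orb_succ i _ ha, orb_succ i _ ha, ih, hpow,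
          hpow]
        ring
    obtain ⟨k, hk⟩ : ∃ k, m = 2 * k := ⟨m / 2, by omega⟩
    have h4 := hend i
    rw [hpow, hk, hper] at h4
    have h5 := hne i 0 (by omega)
    rw [hpow] at h5
    exact h5 h4
  · push Not at hfix
    have h6 := perm_pow_three hfix
    have hred : ∀ k, τ ^ (k + 3) = τ ^ k := fun k => by rw [pow_add, h6, mul_one]
    have hper : ∀ i k, orb τ t s i (k + 6) = orb τ t s i k := by
      intro i k
      rw [orb_succ i _ ha, orb_succ i _ ha, orb_succ i _ ha, orb_succ i _ ha, orb_succ i _ ha,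
        orb_succ i _ ha, hred (k + 3), hred (k + 2), hred (k + 1), hred k]
      ring_nf
    have hper' : ∀ i q r, orb τ t s i (r + 6 * q) = orb τ t s i r := by
      intro i q r
      induction q with
      | zero => rfl
      | succ q ih => rw [show r + 6 * (q + 1) = r + 6 * q + 6 by ring, hper, ih]
    have h7 : m % 6 = 0 ∨ m % 6 = 4 := by omega
    rcases h7 with h7 | h7
    · have h8 := hend 0
      rw [show m = 0 + 6 * (m / 6) by omega, hper', zero_add, perm_pow_mod,
        show (6 * (m / 6) + 1) % 6 = 0 + 1 by omega] at h8
      exact hne 0 0 (by omega) h8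
    -- Going four steps along the 3-cycle, the slope −1 cancels all terms but these. Applied at τ 0,
    -- this puts the first point s 0 at the indeterminate parameter t (τ 0).
    · have h9 : ∀ i, s ((τ ^ 2) i) = t i := by
        intro i
        have h8 := hend i
        rw [show m = 4 + 6 * (m / 6) by omega, hper', perm_pow_mod,
          show (4 + 6 * (m / 6) + 1) % 6 = 2 + 3 by omega, hred, orb_succ i _ ha, orb_succ i _ ha,
          orb_succ i _ ha, orb_succ i _ ha, show 3 + 1 = 1 + 3 from rfl, hred,
          show 2 + 1 = 0 + 3 from rfl, hred, orb] at h8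
        simp only [zero_add, pow_zero, Equiv.Perm.one_apply, Nat.reduceAdd, pow_one] at h8
        linear_combination h8
      have h10 := h9 (τ 0)
      rw [← Equiv.Perm.mul_apply, ← pow_succ, h6, Equiv.Perm.one_apply] at h10
      apply hne 0 0 (by omega)
      rw [orb, zero_add, pow_one, h10]

theorem pow_ne_one_of_orb (hm : 3 ≤ m) (h2 : ¬ 2 ∣ m + 1) (h3 : ¬ 3 ∣ m + 1)
    (hne : ∀ i, ∀ k < m, orb τ t s i k ≠ t ((τ ^ (k + 1)) i)) {k : ℕ} (hk : 0 < k) :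
    a ^ k ≠ 1 := by
  intro h
  rcases (isChiRoot_of_orb ht hs ha hend).eq_one_or_eq_neg_one hk h h2 h3 with h1 | h1
  · exact ne_one_of_orb ht hs ha hend hm h1
  · exact ne_neg_one_of_orb ha hend hm h2 h3 hne h1

end OrbitArithmetic

/-- The frame of a basic map is determined by its base points only up to scaling of columns, and
this does not move the coordinate lines. Orbit data given by another frame can thus be read in the
standard one. -/
theorem imageLine_eq_of_imagePoint_eq {A A' : GL (Fin 3) ℂ}
    (h : ∀ i, imagePoint A i = imagePoint A' i) (i : Fin 3) : imageLine A i = imageLine A' i := by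
  have h1 : ∀ j, ∃ k : ℂ, k ≠ 0 ∧ ∀ r, (A : Matrix (Fin 3) (Fin 3) ℂ) r j =
      k * (A' : Matrix (Fin 3) (Fin 3) ℂ) r j := by
    intro j
    obtain ⟨k, hk⟩ := (Projectivization.mk_eq_mk_iff' ℂ _ _ (mulVec_single_ne_zero A j)
      (mulVec_single_ne_zero A' j)).1 (h j)
    refine ⟨k, ?_, fun r => ?_⟩
    · rintro rfl
      rw [zero_smul] at hk
      exact mulVec_single_ne_zero A j hk.symm
    · simpa using (congrFun hk r).symm
  choose k hk0 hk using h1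
  ext p
  induction p using Projectivization.ind with | h v hv => ?_
  rw [mk_mem_imageLine, mk_mem_imageLine]
  set y := ((A⁻¹ : GL (Fin 3) ℂ) : Matrix (Fin 3) (Fin 3) ℂ).mulVec v with hy
  have h2 : v = (A' : Matrix (Fin 3) (Fin 3) ℂ).mulVec (fun j => k j * y j) := by
    rw [← mulVec_inv_mulVec A v, ← hy]
    funext r
    simp only [Matrix.mulVec, dotProduct]
    refine Finset.sum_congr rfl fun j _ => ?_
    rw [hk]
    ring
  rw [h2, inv_mulVec_mulVec, mul_eq_zero_iff_left (hk0 i)]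

/-! ### Realization, normalization and uniqueness of the parameters -/

namespace LineCoords

variable {L : Fin 3 → Submodule ℂ Vec} (γ : LineCoords L)

section Realization

variable (hL : IsConcurrentTriple L) (τ : Equiv.Perm (Fin 3)) (t s : Fin 3 → ℂ)
  (ht : ∑ i, t i ≠ 0) (hs : ∑ i, s i ≠ 0)

/-- The orbit data of a standard map are determined by the orbits of the parameters. -/
theorem orb_of_realizes {f : PlaneMap} (hf : Proportional f.coord (γ.stdTriple hL τ t s ht hs))
    {m : ℕ} {σ : Equiv.Perm (Fin 3)} (h : f.Realizes L (m + 1) σ) (i : Fin 3) :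
    (∀ k < m, orb τ t s i k ≠ t ((τ ^ (k + 1)) i)) ∧ (τ ^ (m + 1)) i = σ i ∧
      orb τ t s i m = t (σ i) := by
  obtain ⟨-, -, p, hp, Tp, Tm, hbasic, hTp, horb⟩ := h
  have hpt : ∀ i, p i = γ.pt i (t i) := by
    intro i
    have h1 : p i ∈ f.indet := by
      rw [indet_eq_range_imagePoint (A := Tp) (B := Tm) hbasic]
      exact ⟨i, hTp i⟩
    rw [γ.std_indet hL τ t s ht hs hf] at h1
    obtain ⟨j, hj : γ.pt j (t j) = p i⟩ := h1
    have h2 := hp i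
    rw [← hj, pt_eq_mk, mk_mem_pointsOf, γ.vec_mem_iff hL] at h2
    rw [← hj, h2]
  have hline : ∀ i, imageLine Tp i = imageLine (γ.frameGL hL 1 t ht) i :=
    imageLine_eq_of_imagePoint_eq fun i => by
      rw [hTp, hpt, imagePoint_frameGL]
      rfl
  have h1 := horb i
  rw [hline, hpt] at h1
  exact (γ.std_hasOrbitLength_iff hL τ t s ht hs hf i (σ i) m).1 h1

/-- The standard map. -/
def stdMap : PlaneMap := basicMap (γ.frameGL hL 1 t ht) (γ.frameGL hL τ s hs)

theorem proportional_stdMap :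
    Proportional (γ.stdMap hL τ t s ht hs).coord (γ.stdTriple hL τ t s ht hs) :=
  fun _ _ => mul_comm _ _

theorem stdMap_realizes {m : ℕ} {σ : Equiv.Perm (Fin 3)}
    (h : ∀ i, (∀ k < m, orb τ t s i k ≠ t ((τ ^ (k + 1)) i)) ∧ (τ ^ (m + 1)) i = σ i ∧
      orb τ t s i m = t (σ i)) : (γ.stdMap hL τ t s ht hs).Realizes L (m + 1) σ := by
  have hf := γ.proportional_stdMap hL τ t s ht hs
  refine ⟨basicMap_isQuadraticBirational _ _, γ.std_properlyFixes hL τ t s ht hs hf,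
    fun i => γ.pt i (t i), fun i => γ.pt_mem i _, γ.frameGL hL 1 t ht, γ.frameGL hL τ s hs,
    hf, fun i => γ.imagePoint_frameGL hL 1 t ht i, fun i => ?_⟩
  exact (γ.std_hasOrbitLength_iff hL τ t s ht hs hf i (σ i) m).2 (h i)

/-- At its (m + 1)-st point each orbit is indeterminate; from then on the strict image is empty and
contributes nothing. -/
theorem std_baseLocus {f : PlaneMap} (hf : Proportional f.coord (γ.stdTriple hL τ t s ht hs))
    {m : ℕ} (hne : ∀ i, ∀ k < m, orb τ t s i k ≠ t ((τ ^ (k + 1)) i))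
    (hend : ∀ i, orb τ t s i m = t ((τ ^ (m + 1)) i)) :
    f.baseLocus = {q | ∃ k ≤ m, ∃ i, q = γ.pt ((τ ^ (k + 1)) i) (orb τ t s i k)} := by
  have hiter : ∀ i, ∀ k ≤ m, f.strictImage^[k + 1] (imageLine (γ.frameGL hL 1 t ht) i) =
      {γ.pt ((τ ^ (k + 1)) i) (orb τ t s i k)} := fun i k hk =>
    γ.std_iterate hL τ t s ht hs hf i k fun l hl => hne i l (by omega)
  have hempty : ∀ i k, f.strictImage^[m + 2 + k] (imageLine (γ.frameGL hL 1 t ht) i) = ∅ := by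
    intro i k
    induction k with
    | zero =>
      rw [add_zero, Function.iterate_succ_apply', hiter i m le_rfl]
      exact PlaneMap.strictImage_singleton_of_mem_indet
        ((γ.std_pt_mem_indet_iff hL τ t s ht hs hf).2 (hend i))
    | succ k ih =>
      rw [← add_assoc, Function.iterate_succ_apply', ih, PlaneMap.strictImage_empty]
  ext q
  constructor
  · rintro ⟨W, hW, ⟨r, hr⟩, j, hj, hq⟩
    obtain ⟨i, rfl⟩ := exists_eq_exceptionalPlane hf hW hr
    rw [pointsOf_exceptionalPlane] at hq
    by_cases hjm : j ≤ m + 1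
    · obtain ⟨k, rfl⟩ : ∃ k, j = k + 1 := ⟨j - 1, by omega⟩
      rw [hiter i k (by omega), Set.singleton_eq_singleton_iff] at hq
      exact ⟨k, by omega, i, hq.symm⟩
    · obtain ⟨k, rfl⟩ : ∃ k, j = m + 2 + k := ⟨j - (m + 2), by omega⟩
      rw [hempty] at hq
      exact absurd hq.symm (Set.singleton_ne_empty q)
  · rintro ⟨k, hk, i, rfl⟩
    refine ⟨exceptionalPlane (γ.frameGL hL 1 t ht) i, finrank_exceptionalPlane _ _,
      ⟨imagePoint (γ.frameGL hL τ s hs) i, ?_⟩, k + 1, by omega, ?_⟩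
    · rw [pointsOf_exceptionalPlane, strictImage_imageLine hf]
    · rw [pointsOf_exceptionalPlane, hiter i k hk]

end Realization

/-- The coordinates in which the section `i ↦ γ.pt i (c i)` is the section `i ↦ (i, 1)`. -/
def normalize (c : Fin 3 → ℂ) (hc : ∑ i, c i ≠ 0) : LineCoords L where
  z := ((∑ i, c i) / 3) • γ.z
  w i := γ.vec i (c i - (∑ i, c i) / 3)
  z_ne_zero := smul_ne_zero (div_ne_zero hc (by norm_num)) γ.z_ne_zero
  z_mem i := (L i).smul_mem _ (γ.z_mem i)
  w_mem i := γ.vec_mem i _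
  w_notMem i h := by
    obtain ⟨a, ha⟩ := Submodule.mem_span_singleton.1 h
    have := (γ.linearIndependent_pair i (a := c i - (∑ i, c i) / 3 - a * ((∑ i, c i) / 3))
      (b := 1) (by
        rw [← sub_eq_zero.2 ha.symm, vec]
        module)).2
    exact one_ne_zero this
  w_sum := by
    have h : γ.vec 0 (c 0 - (∑ i, c i) / 3) + γ.vec 1 (c 1 - (∑ i, c i) / 3) +
        γ.vec 2 (c 2 - (∑ i, c i) / 3) =
        (c 0 + c 1 + c 2 - ∑ i, c i) • γ.z + (γ.w 0 + γ.w 1 + γ.w 2) := by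
      simp only [vec]
      module
    rw [h, γ.w_sum, Fin.sum_univ_three, sub_self, zero_smul, add_zero]

theorem normalize_pt (c : Fin 3 → ℂ) (hc : ∑ i, c i ≠ 0) (i : Fin 3) (x : ℂ) :
    (γ.normalize c hc).pt i x = γ.pt i ((∑ i, c i) / 3 * (x - 1) + c i) := by
  refine mk_eq_mk_of_smul 1 ?_
  simp only [normalize, vec, one_smul]
  module

/-- In suitable coordinates, a map with orbit data `n, n, n` is normalized, and its multiplier is a
root of `χₙ` but not a root of unity. -/
theorem exists_isNormalizedOn (hL : IsConcurrentTriple L) {n : ℕ} (hn : 4 ≤ n) (h2 : ¬ 2 ∣ n)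
    (h3 : ¬ 3 ∣ n) {σ : Equiv.Perm (Fin 3)} {f : PlaneMap} (h : f.Realizes L n σ) :
    ∃ (γ : LineCoords L) (α : ℂ), IsChiRoot n α ∧ (∀ m : ℕ, 0 < m → α ^ m ≠ 1) ∧
      f.IsNormalizedOn γ α := by
  obtain ⟨m, rfl⟩ : ∃ m, n = m + 1 := ⟨n - 1, by omega⟩
  obtain ⟨γ⟩ := nonempty_lineCoords hL
  obtain ⟨τ, t, s, ht, hs, hf⟩ := γ.exists_std hL h.1 h.2.1
  have horb := γ.orb_of_realizes hL τ t s ht hs hf h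
  have hend : ∀ i, orb τ t s i m = t ((τ ^ (m + 1)) i) := fun i => by
    rw [(horb i).2.1, (horb i).2.2]
  obtain ⟨a, ha⟩ : ∃ a, a = -(∑ j, s j) / ∑ j, t j := ⟨_, rfl⟩
  have hroot := isChiRoot_of_orb ht hs ha hend
  have hunit : ∀ k : ℕ, 0 < k → a ^ k ≠ 1 := fun k hk =>
    pow_ne_one_of_orb ht hs ha hend (by omega) h2 h3 (fun i => (horb i).1) hk
  -- The points γᵢ(cᵢ) form a section of the three lines that f permutes.
  obtain ⟨c, hc⟩ := exists_twisted_fixed (hunit 6 (by norm_num)) τ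
    (fun i => s i - (∑ j, s j) - a * t i)
  have hat : a * ∑ j, t j = -∑ j, s j := by rw [ha, div_mul_cancel₀ _ ht]
  -- Summing the equations for c gives Σ c = a Σ c − S, so the invariant section is not collinear
  -- and can be rescaled to 1.
  have hΓ : ∑ i, c i ≠ 0 := by
    intro h0
    apply hs
    have h4 := Equiv.sum_comp τ c
    rw [Finset.sum_congr rfl fun i _ => hc i, Finset.sum_add_distrib, ← Finset.mul_sum, h0] at h4
    simp only [Finset.sum_sub_distrib, ← Finset.mul_sum, Finset.sum_const, Finset.card_univ,
      Fintype.card_fin, nsmul_eq_mul] at h4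
    push_cast at h4
    linear_combination -h4 - hat
  refine ⟨γ.normalize c hΓ, a, hroot, hunit, τ, fun i x hx => ?_⟩
  rw [normalize_pt] at hx ⊢
  rw [γ.std_pt_mem_indet_iff hL τ t s ht hs hf] at hx
  have h4 := γ.std_sends_pt hL τ t s ht hs hf hx
  rw [normalize_pt]
  convert h4 using 2
  rw [hc, next, show (∑ j, s j) / ∑ j, t j = -a by rw [ha]; ring]
  ring

section Normalized

variable (hL : IsConcurrentTriple L) {α : ℂ}

theorem sum_const_ne_zero {x : ℂ} (hx : x ≠ 0) : ∑ _i : Fin 3, x ≠ 0 := by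
  rw [Finset.sum_const, Finset.card_univ, Fintype.card_fin, nsmul_eq_mul]
  exact mul_ne_zero (by norm_num) hx

theorem next_const (h0 : α ≠ 0) (h1 : α ≠ 1) (i : Fin 3) (x : ℂ) :
    next (fun _ => α⁻¹ - 1) (fun _ => α - 1) i x = α * (x - 1) + 1 := by
  have h2 : 1 - α ≠ 0 := sub_ne_zero.2 h1.symm
  have h3 : α⁻¹ - 1 = (1 - α) / α := by field_simp
  simp only [next, Finset.sum_const, Finset.card_univ, Fintype.card_fin, nsmul_eq_mul, h3]
  field_simp
  push_cast
  ring

theorem orb_const (h0 : α ≠ 0) (h1 : α ≠ 1) (τ : Equiv.Perm (Fin 3)) (i : Fin 3) (k : ℕ) :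
    orb τ (fun _ => α⁻¹ - 1) (fun _ => α - 1) i k = 1 + α ^ k * (α - 2) := by
  induction k with
  | zero =>
    rw [orb]
    ring
  | succ k ih =>
    rw [orb, next_const h0 h1, ih]
    ring

theorem orb_const_end {m : ℕ} (h0 : α ≠ 0) (hα : IsChiRoot (m + 1) α) :
    1 + α ^ m * (α - 2) = α⁻¹ - 1 := by
  apply mul_left_cancel₀ h0
  rw [mul_sub α α⁻¹, mul_inv_cancel₀ h0]
  unfold IsChiRoot at hα
  linear_combination hα

/-- Meeting the endpoint earlier would give αᵏ (α − 2) = αᵐ (α − 2), hence a root of unity. -/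
theorem orb_const_ne {m : ℕ} (h0 : α ≠ 0) (hα : IsChiRoot (m + 1) α)
    (hunit : ∀ k : ℕ, 0 < k → α ^ k ≠ 1) {k : ℕ} (hk : k < m) :
    1 + α ^ k * (α - 2) ≠ α⁻¹ - 1 := by
  intro h
  have h1 := orb_const_end h0 hα
  have h2 : α - 2 ≠ 0 := by
    intro h2
    rw [h2, mul_zero, add_zero] at h
    have h3 : α = 2 := by linear_combination h2
    rw [h3] at h
    norm_num at h
  rw [← h] at h1
  apply hunit (m - k) (by omega)
  apply mul_left_cancel₀ (pow_ne_zero k h0)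
  rw [← pow_add, show k + (m - k) = m by omega, mul_one]
  apply mul_right_cancel₀ h2
  linear_combination h1

/-- The parameters of a normalized map with orbit data `n, n, n`. -/
theorem params_of_isNormalizedOn {m : ℕ} (h2 : ¬ 2 ∣ m + 1) (h3 : ¬ 3 ∣ m + 1) (h0 : α ≠ 0)
    (hunit : ∀ k : ℕ, 0 < k → α ^ k ≠ 1)
    {τ : Equiv.Perm (Fin 3)} {t s : Fin 3 → ℂ} {ht : ∑ i, t i ≠ 0} {hs : ∑ i, s i ≠ 0}
    {f : PlaneMap} (hf : Proportional f.coord (γ.stdTriple hL τ t s ht hs))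
    {σ : Equiv.Perm (Fin 3)} (h : f.Realizes L (m + 1) σ) (hnorm : f.IsNormalizedOn γ α) :
    τ = σ ^ (m + 1) ∧ t = (fun _ => α⁻¹ - 1) ∧ s = fun _ => α - 1 := by
  have horb := γ.orb_of_realizes hL τ t s ht hs hf h
  have hτ : τ ^ (m + 1) = σ := Equiv.ext fun i => (horb i).2.1
  have hnext : ∀ i x, x ≠ t i → next t s i x = α * (x - 1) + 1 := by
    obtain ⟨τ', hτ'⟩ := hnorm
    intro i x hx
    have h4 := hτ' i x (by rwa [γ.std_pt_mem_indet_iff hL τ t s ht hs hf])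
    have h5 := γ.std_sends_unique hL τ t s ht hs hf h4 (γ.std_sends_pt hL τ t s ht hs hf hx)
    exact ((γ.pt_eq_pt_iff hL).1 h5).2.symm
  have hslope : (∑ j, s j) / ∑ j, t j = -α := by
    have h4 := hnext 0 (t 0 + 1) (by simp)
    have h5 := hnext 0 (t 0 + 2) (by simp)
    rw [next] at h4 h5
    linear_combination h4 - h5
  have hsκ : ∀ i, s i = (∑ j, s j) + α * t i + 1 - α := by
    intro i
    have h4 := hnext i (t i + 1) (by simp)
    rw [next, hslope] at h4
    linear_combination h4
  have hκ : ∑ j, s j = -α * ∑ j, t j := by rw [← hslope, div_mul_cancel₀ _ ht]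
  have hκ' : ∑ j, s j = 3 * (α - 1) := by
    have h4 : ∑ i, s i = ∑ i, ((∑ j, s j) + α * t i + 1 - α) :=
      Finset.sum_congr rfl fun i _ => hsκ i
    simp only [Finset.sum_sub_distrib, Finset.sum_add_distrib, ← Finset.mul_sum, Finset.sum_const,
      Finset.card_univ, Fintype.card_fin, nsmul_eq_mul] at h4
    push_cast at h4
    linear_combination -h4 - hκ
  have hlin : ∀ i k, orb τ t s i k = 1 + α ^ k * (s i - 1) := by
    intro i k
    induction k with
    | zero =>
      rw [orb]
      ring
    | succ k ih =>
      rw [orb, next, hslope, ih, hsκ]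
      ring
  have hu : ∀ i, t (σ i) - 1 = α ^ (m + 1) * (t i - 1) + 3 * α ^ m * (α - 1) := by
    intro i
    rw [← (horb i).2.2, hlin, hsκ, hκ']
    ring
  have hpow : 1 - α ^ (m + 1) ≠ 0 := sub_ne_zero.2 (hunit _ (by omega)).symm
  -- u is the constant solution of the recursion for t − 1. The difference t − 1 − u is multiplied
  -- by αⁿ under σ, so it vanishes.
  obtain ⟨u, hu'⟩ : ∃ u, u * (1 - α ^ (m + 1)) = 3 * α ^ m * (α - 1) :=
    ⟨_, div_mul_cancel₀ _ hpow⟩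
  have hconst : (fun i => t i - 1 - u) = 0 := by
    refine eq_zero_of_twisted (a := α ^ (m + 1)) (τ := σ)
      (by rw [← pow_mul]; exact hunit _ (by omega)) fun i => ?_
    linear_combination hu i - hu'
  have htu : ∀ i, t i = 1 + u := fun i => by
    have h4 : t i - 1 - u = 0 := congrFun hconst i
    linear_combination h4
  -- The constant comes from Σ s = −α Σ t together with Σ s = 3(α − 1).
  have ht' : ∀ i, t i = α⁻¹ - 1 := by
    intro i
    have h4 : ∑ j, t j = 3 * (1 + u) := by
      rw [Finset.sum_congr rfl fun j _ => htu j, Finset.sum_const, Finset.card_univ,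
        Fintype.card_fin, nsmul_eq_mul]
      norm_num
    rw [htu]
    apply mul_left_cancel₀ h0
    rw [mul_sub α α⁻¹, mul_inv_cancel₀ h0]
    rw [h4, hκ'] at hκ
    linear_combination hκ / 3
  refine ⟨?_, funext ht', funext fun i => ?_⟩
  · rw [← hτ, perm_pow_pow h2 h3]
  · rw [hsκ, hκ', ht']
    have := mul_inv_cancel₀ h0
    linear_combination this

end Normalized

end LineCoords

/-! ### Multiplicity of a form at a point -/

section Multiplicity

theorem aeval_congr {R : Type*} [CommRing R] [Algebra ℂ R] {a b : Fin 3 → R}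
    (P : MvPolynomial (Fin 3) ℂ) (h : ∀ i, a i = b i) : aeval a P = aeval b P := by
  rw [funext h]

/-- The polynomial `P` vanishes to order at least `m` at the point `q` of the projective plane:
`P (y q + e x)` is divisible by `e ^ m`. -/
def MultGE (q : Vec) (m : ℕ) (P : MvPolynomial (Fin 3) ℂ) : Prop :=
  ∀ (R : Type) [CommRing R] [Algebra ℂ R] (e y : R) (x : Fin 3 → R),
    e ^ m ∣ aeval (fun i => y * algebraMap ℂ R (q i) + e * x i) P

/-- Polynomials in the variables `e`, `y`, `x₁`, `x₂`, `x₃`. -/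
abbrev GenericRing : Type := MvPolynomial (Option (Option (Fin 3))) ℂ

/-- The generic point `y q + e x` near `q`. -/
def genericPoint (q : Vec) (i : Fin 3) : GenericRing :=
  X (some none) * algebraMap ℂ _ (q i) + X none * X (some (some i))

/-- Every choice of ring, e, y and x is a specialization of the generic point. The generic ring is a
domain in which e is prime, so factors can be cancelled there. -/
theorem multGE_iff_generic {q : Vec} {m : ℕ} {P : MvPolynomial (Fin 3) ℂ} :
    MultGE q m P ↔ (X none : GenericRing) ^ m ∣ aeval (genericPoint q) P := by
  refine ⟨fun h => h GenericRing _ _ _, fun h R _ _ e y x => ?_⟩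
  let φ : GenericRing →ₐ[ℂ] R := aeval fun o => o.elim e fun o => o.elim y x
  have h1 := map_dvd φ h
  rw [map_pow, comp_aeval_apply] at h1
  rw [show φ (X none) = e by simp [φ]] at h1
  exact h1.trans (aeval_congr P fun i => by simp [φ, genericPoint]).dvd

theorem prime_generic : Prime (X none : GenericRing) := X_prime

theorem not_dvd_of_eval_ne_zero {u : GenericRing} (a : Option (Option (Fin 3)) → ℂ)
    (ha : a none = 0) (hu : eval a u ≠ 0) : ¬ (X none : GenericRing) ∣ u := by
  rintro ⟨v, rfl⟩
  rw [map_mul, eval_X, ha, zero_mul] at hu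
  exact hu rfl

theorem MultGE.mul {q : Vec} {m k : ℕ} {P Q : MvPolynomial (Fin 3) ℂ} (hP : MultGE q m P)
    (hQ : MultGE q k Q) : MultGE q (m + k) (P * Q) := fun R _ _ e y x => by
  rw [map_mul, pow_add]
  exact mul_dvd_mul (hP R e y x) (hQ R e y x)

theorem MultGE.pow {q : Vec} {m : ℕ} {P : MvPolynomial (Fin 3) ℂ} (hP : MultGE q m P) (k : ℕ) :
    MultGE q (m * k) (P ^ k) := fun R _ _ e y x => by
  rw [map_pow, pow_mul]
  exact pow_dvd_pow_of_dvd (hP R e y x) k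

theorem multGE_zero (q : Vec) (P : MvPolynomial (Fin 3) ℂ) : MultGE q 0 P := fun R _ _ e y x => by
  rw [pow_zero]
  exact one_dvd _

theorem MultGE.mono {q : Vec} {m k : ℕ} {P : MvPolynomial (Fin 3) ℂ} (hP : MultGE q m P)
    (h : k ≤ m) : MultGE q k P := fun R _ _ e y x => (pow_dvd_pow e h).trans (hP R e y x)

/-- A factor nonzero at q has an expansion that survives e = 0, so the prime e does not divide it.
-/
theorem MultGE.of_mul_left {q : Vec} {m : ℕ} {u P : MvPolynomial (Fin 3) ℂ}
    (h : MultGE q m (u * P)) (hu : eval q u ≠ 0) : MultGE q m P := by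
  rw [multGE_iff_generic] at h ⊢
  rw [map_mul] at h
  refine prime_generic.pow_dvd_of_dvd_mul_left m
    (not_dvd_of_eval_ne_zero (fun o => o.elim 0 fun o => o.elim 1 0) rfl ?_) h
  have h1 : eval (fun o => o.elim 0 fun o => o.elim 1 0) (aeval (genericPoint q) u) =
      eval q u := by
    rw [← coe_aeval_eq_eval, RingHom.coe_coe, comp_aeval_apply, ← aeval_complex]
    exact aeval_congr u fun i => by simp [genericPoint]
  rwa [h1]

theorem eval_eq_zero_of_multGE {q : Vec} {P : MvPolynomial (Fin 3) ℂ} (h : MultGE q 1 P) :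
    eval q P = 0 := by
  have := h ℂ 0 1 0
  simpa [aeval_complex] using this

theorem multGE_X_of_eq_zero {q : Vec} {i : Fin 3} (h : q i = 0) : MultGE q 1 (X i) :=
  fun R _ _ e y x => by simp [h]

theorem MultGE.of_X_pow_mul {q : Vec} {i : Fin 3} (hi : q i = 0) {a m : ℕ}
    {P : MvPolynomial (Fin 3) ℂ} (h : MultGE q (a + m) (X i ^ a * P)) : MultGE q m P := by
  rw [multGE_iff_generic] at h ⊢
  have h1 : aeval (genericPoint q) (X i ^ a : MvPolynomial (Fin 3) ℂ) =
      X none ^ a * X (some (some i)) ^ a := by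
    rw [map_pow, aeval_X, genericPoint, hi, map_zero, mul_zero, zero_add, mul_pow]
  rw [map_mul, h1, pow_add, mul_assoc] at h
  have h2 := (mul_dvd_mul_iff_left (pow_ne_zero a prime_generic.ne_zero)).1 h
  refine prime_generic.pow_dvd_of_dvd_mul_left m
    (not_dvd_of_eval_ne_zero (fun o => o.elim 0 fun _ => 1) rfl ?_) h2
  simp

theorem MultGE.smul {q : Vec} {m : ℕ} {P : MvPolynomial (Fin 3) ℂ} (h : MultGE q m P) (c : ℂ) :
    MultGE (c • q) m P := fun R _ _ e y x => by
  refine (h R e (y * algebraMap ℂ R c) x).trans (aeval_congr P fun i => ?_).dvd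
  simp [mul_assoc]

theorem multGE_smul_iff {q : Vec} {m : ℕ} {P : MvPolynomial (Fin 3) ℂ} {c : ℂ} (hc : c ≠ 0) :
    MultGE (c • q) m P ↔ MultGE q m P := by
  refine ⟨fun h => ?_, fun h => h.smul c⟩
  simpa [smul_smul, inv_mul_cancel₀ hc] using h.smul c⁻¹

theorem MultGE.comp_linear {q : Vec} {m : ℕ} {P : MvPolynomial (Fin 3) ℂ}
    (A : Matrix (Fin 3) (Fin 3) ℂ) (h : MultGE (A.mulVec q) m P) :
    MultGE q m (bind₁ (linearTriple A) P) := fun R _ _ e y x => by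
  rw [aeval_bind₁]
  refine (h R e y fun i => ∑ j, algebraMap ℂ R (A i j) * x j).trans
    (aeval_congr P fun i => ?_).dvd
  simp only [linearTriple, Matrix.mulVec, dotProduct, map_sum, map_mul, aeval_X, algHom_C,
    Finset.mul_sum, ← Finset.sum_add_distrib]
  exact Finset.sum_congr rfl fun j _ => by ring

theorem multGE_comp_linear_iff {q : Vec} {m : ℕ} {P : MvPolynomial (Fin 3) ℂ}
    (A : GL (Fin 3) ℂ) :
    MultGE q m (bind₁ (linearTriple (A : Matrix (Fin 3) (Fin 3) ℂ)) P) ↔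
      MultGE ((A : Matrix (Fin 3) (Fin 3) ℂ).mulVec q) m P := by
  refine ⟨fun h => ?_, fun h => h.comp_linear _⟩
  rw [← inv_mulVec_mulVec A q] at h
  have h1 := h.comp_linear _
  change MultGE _ _ ((linEquiv A⁻¹) (linEquiv A P)) at h1
  rwa [show linEquiv A⁻¹ (linEquiv A P) = P from (linEquiv A).symm_apply_apply P] at h1

end Multiplicity

/-! ### Multiplicities under the Cremona involution -/

section Cremona

theorem cremonaTriple_comp_self (P : MvPolynomial (Fin 3) ℂ) {d : ℕ} (hP : P.IsHomogeneous d) :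
    bind₁ cremonaTriple (bind₁ cremonaTriple P) = (∏ i, X i) ^ d * P := by
  rw [bind₁_bind₁]
  have h : (fun i => bind₁ cremonaTriple (cremonaTriple i)) =
      fun i => (∏ j, X j : MvPolynomial (Fin 3) ℂ) * X i := by
    funext i
    fin_cases i <;> simp [cremonaTriple, Fin.prod_univ_three] <;> ring
  rw [h, bind₁_mul_triple hP]
  congr 1
  exact congrArg (fun f => f P) bind₁_X_left

/-- J(x) has the shape y eᵢ + xᵢ v, so near the contracted line xᵢ plays the role of the small
parameter e. -/
theorem X_pow_dvd_of_multGE {P : MvPolynomial (Fin 3) ℂ} {i : Fin 3} {m : ℕ}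
    (h : MultGE (Pi.single i 1) m P) : X i ^ m ∣ bind₁ cremonaTriple P := by
  fin_cases i
  · refine (h (MvPolynomial (Fin 3) ℂ) (X 0) (X 1 * X 2) ![0, X 2, X 1]).trans
      (aeval_congr P fun j => ?_).dvd
    fin_cases j <;> simp [cremonaTriple]
  · refine (h (MvPolynomial (Fin 3) ℂ) (X 1) (X 0 * X 2) ![X 2, 0, X 0]).trans
      (aeval_congr P fun j => ?_).dvd
    fin_cases j <;> simp [cremonaTriple, mul_comm]
  · refine (h (MvPolynomial (Fin 3) ℂ) (X 2) (X 0 * X 1) ![X 1, X 0, 0]).trans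
      (aeval_congr P fun j => ?_).dvd
    fin_cases j <;> simp [cremonaTriple, mul_comm]

/-- Up to a factor prime to e, the generic point near eᵢ is J of a point whose i-th coordinate is
divisible by e. -/
theorem multGE_of_X_pow_dvd {P : MvPolynomial (Fin 3) ℂ} {d : ℕ} (hP : P.IsHomogeneous d)
    {i : Fin 3} {m : ℕ} (h : X i ^ m ∣ bind₁ cremonaTriple P) : MultGE (Pi.single i 1) m P := by
  rw [multGE_iff_generic]
  suffices H : ∃ (c : GenericRing) (v : Fin 3 → GenericRing), X none ∣ v i ∧
      eval (fun o => o.elim 0 fun _ => 1) c ≠ 0 ∧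
      ∀ j, aeval v (cremonaTriple j) = c * genericPoint (Pi.single i 1) j by
    obtain ⟨c, v, h1, h2, h3⟩ := H
    have h4 := map_dvd (aeval v : _ →ₐ[ℂ] GenericRing) h
    rw [map_pow, aeval_X, aeval_bind₁, funext h3, aeval_mul_of_isHomogeneous hP] at h4
    refine prime_generic.pow_dvd_of_dvd_mul_left m (fun h5 => ?_)
      ((pow_dvd_pow_of_dvd h1 m).trans h4)
    exact not_dvd_of_eval_ne_zero _ rfl h2 (prime_generic.dvd_of_dvd_pow h5)
  set g : Fin 3 → GenericRing := fun j => X (some (some j)) with hg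
  set Y : GenericRing := X (some none) + X none * g i with hY
  fin_cases i
  · refine ⟨Y * g 1 * g 2, ![X none * g 1 * g 2, Y * g 2, Y * g 1], ?_, ?_, fun j => ?_⟩
    · exact ⟨g 1 * g 2, by simp [mul_assoc]⟩
    · simp [hY, hg]
    · fin_cases j <;> simp [cremonaTriple, genericPoint, hY, hg] <;> ring
  · refine ⟨Y * g 0 * g 2, ![Y * g 2, X none * g 0 * g 2, Y * g 0], ?_, ?_, fun j => ?_⟩
    · exact ⟨g 0 * g 2, by simp [mul_assoc]⟩
    · simp [hY, hg]
    · fin_cases j <;> simp [cremonaTriple, genericPoint, hY, hg] <;> ring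
  · refine ⟨Y * g 0 * g 1, ![Y * g 1, Y * g 0, X none * g 0 * g 1], ?_, ?_, fun j => ?_⟩
    · exact ⟨g 0 * g 1, by simp [mul_assoc]⟩
    · simp [hY, hg]
    · fin_cases j <;> simp [cremonaTriple, genericPoint, hY, hg] <;> ring

theorem X_pow_dvd_iff_multGE {P : MvPolynomial (Fin 3) ℂ} {d : ℕ} (hP : P.IsHomogeneous d)
    {i : Fin 3} {m : ℕ} : X i ^ m ∣ bind₁ cremonaTriple P ↔ MultGE (Pi.single i 1) m P :=
  ⟨multGE_of_X_pow_dvd hP, X_pow_dvd_of_multGE⟩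

theorem not_X_dvd_X {i j : Fin 3} (h : i ≠ j) : ¬ (X i : MvPolynomial (Fin 3) ℂ) ∣ X j := by
  rwa [X_dvd_X]

/-- The preceding criterion is applied to P ∘ J: since P ∘ J ∘ J = (x₁x₂x₃)ᵈ P, xᵢ occurs in it d
times more often than in P. -/
theorem multGE_comp_cremona_single {P : MvPolynomial (Fin 3) ℂ} {d : ℕ} (hP : P.IsHomogeneous d)
    {i : Fin 3} {m : ℕ} :
    MultGE (Pi.single i 1) (d + m) (bind₁ cremonaTriple P) ↔ X i ^ m ∣ P := by
  rw [← X_pow_dvd_iff_multGE (IsHomogeneous.bind₁ hP cremonaTriple_isHomogeneous), cremonaTriple_comp_self P hP,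
    ← Finset.mul_prod_erase _ _ (Finset.mem_univ i), mul_pow, mul_assoc, pow_add,
    mul_dvd_mul_iff_left (pow_ne_zero _ (X_ne_zero i))]
  refine ⟨fun h => (X_prime (i := i)).pow_dvd_of_dvd_mul_left m (fun h1 => ?_) h, fun h => h.mul_left _⟩
  obtain ⟨j, hj, h2⟩ := (X_prime (i := i)).exists_mem_finset_dvd ((X_prime (i := i)).dvd_of_dvd_pow h1)
  exact not_X_dvd_X (Finset.ne_of_mem_erase hj).symm h2

theorem MultGE.comp_cremona {P : MvPolynomial (Fin 3) ℂ} {q : Vec} {m : ℕ}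
    (h : MultGE (cremona q) m P) : MultGE q m (bind₁ cremonaTriple P) := fun R _ _ e y x => by
  rw [aeval_bind₁]
  let a : Fin 3 → R := fun i => algebraMap ℂ R (q i)
  refine (h R e (y ^ 2) ![y * (a 1 * x 2 + a 2 * x 1) + e * x 1 * x 2,
    y * (a 0 * x 2 + a 2 * x 0) + e * x 0 * x 2,
    y * (a 0 * x 1 + a 1 * x 0) + e * x 0 * x 1]).trans (aeval_congr P fun j => ?_).dvd
  fin_cases j <;> simp [cremonaTriple, cremona, a] <;> ring

theorem multGE_comp_cremona_iff {P : MvPolynomial (Fin 3) ℂ} {d : ℕ} (hP : P.IsHomogeneous d)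
    {q : Vec} (hq : ∀ i, q i ≠ 0) {m : ℕ} :
    MultGE q m (bind₁ cremonaTriple P) ↔ MultGE (cremona q) m P := by
  refine ⟨fun h => ?_, fun h => h.comp_cremona⟩
  have h1 : MultGE (cremona (cremona q)) m (bind₁ cremonaTriple P) := by
    rw [cremona_cremona]
    exact h.smul _
  have h2 := h1.comp_cremona
  rw [cremonaTriple_comp_self P hP] at h2
  refine h2.of_mul_left ?_
  have := hq 0
  have := hq 1
  have := hq 2
  simp [Fin.prod_univ_three, cremona, *]

end Cremona

/-! ### Degree and multiplicities of a reduced triple under composition -/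

section Step

/-- The triple `G` has multiplicity `m` at `q`. -/
def IsMult (q : Vec) (m : ℕ) (G : Triple) : Prop := ∀ k, (∀ l, MultGE q k (G l)) ↔ k ≤ m

theorem isMult_comp_linear_iff {q : Vec} {m : ℕ} {G : Triple} (A : GL (Fin 3) ℂ) :
    IsMult q m (tripleComp G (linearTriple (A : Matrix (Fin 3) (Fin 3) ℂ))) ↔
      IsMult ((A : Matrix (Fin 3) (Fin 3) ℂ).mulVec q) m G := by
  simp only [IsMult, tripleComp, multGE_comp_linear_iff]

theorem isMult_smul_iff {q : Vec} {m : ℕ} {G : Triple} {c : ℂ} (hc : c ≠ 0) :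
    IsMult (c • q) m G ↔ IsMult q m G := by
  simp only [IsMult, multGE_smul_iff hc]

/-- At eᵢ each coordinate xⱼ with j ≠ i has multiplicity exactly one, and xᵢ is nonzero there. -/
theorem pow_mul_cofactor_iff {i : Fin 3} {ν : Fin 3 → ℕ} {m : ℕ} {P : MvPolynomial (Fin 3) ℂ} :
    MultGE (Pi.single i 1) (∑ j ∈ Finset.univ.erase i, ν j + m) ((∏ j, X j ^ ν j) * P) ↔
      MultGE (Pi.single i 1) m P := by
  have key : ∀ s : Finset (Fin 3), i ∉ s → ∀ {m : ℕ} {P : MvPolynomial (Fin 3) ℂ},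
      (MultGE (Pi.single i 1) (∑ j ∈ s, ν j + m) ((∏ j ∈ s, X j ^ ν j) * P) ↔
      MultGE (Pi.single i 1) m P) := by
    intro s
    induction s using Finset.induction_on with
    | empty => simp
    | insert a s ha ih =>
      intro hi m P
      rw [Finset.mem_insert, not_or] at hi
      rw [Finset.sum_insert ha, Finset.prod_insert ha, mul_assoc, add_assoc]
      have h0 : (Pi.single i 1 : Vec) a = 0 := Pi.single_eq_of_ne (Ne.symm hi.1) _
      rw [← ih hi.2 (m := m) (P := P)]
      refine ⟨fun h => h.of_X_pow_mul h0, fun h => ?_⟩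
      have h1 := ((multGE_X_of_eq_zero h0).pow (ν a)).mul h
      rwa [one_mul] at h1
  rw [← key _ (Finset.notMem_erase i Finset.univ) (m := m) (P := P), ← Finset.mul_prod_erase _ _ (Finset.mem_univ i),
    mul_assoc]
  refine ⟨fun h => h.of_mul_left (by simp), fun h => ?_⟩
  simpa using (multGE_zero (Pi.single i 1) (X i ^ ν i)).mul h

theorem prod_X_pow_isHomogeneous (ν : Fin 3 → ℕ) :
    (∏ j, X j ^ ν j : MvPolynomial (Fin 3) ℂ).IsHomogeneous (∑ j, ν j) :=
  IsHomogeneous.prod _ _ _ fun j _ => by simpa using (isHomogeneous_X ℂ j).pow (ν j)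

theorem prod_X_pow_ne_zero (ν : Fin 3 → ℕ) : (∏ j, X j ^ ν j : MvPolynomial (Fin 3) ℂ) ≠ 0 :=
  Finset.prod_ne_zero_iff.2 fun j _ => pow_ne_zero _ (X_ne_zero j)

variable {Q : Triple} {d : ℕ}

theorem prod_X_pow_dvd {ν : Fin 3 → ℕ} (hν : ∀ i, IsMult (Pi.single i 1) (ν i) Q) (l : Fin 3) :
    (∏ j, X j ^ ν j) ∣ bind₁ cremonaTriple (Q l) := by
  refine Finset.prod_dvd_of_isRelPrime (fun a _ b _ hab => ?_) fun j _ =>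
    X_pow_dvd_of_multGE (((hν j) _).2 le_rfl l)
  refine IsRelPrime.pow ?_
  rw [X_prime.irreducible.isRelPrime_iff_not_dvd]
  exact not_X_dvd_X hab

theorem bind₁_cremonaTriple_ne_zero {P : MvPolynomial (Fin 3) ℂ} (hP : P.IsHomogeneous d)
    (h0 : P ≠ 0) : bind₁ cremonaTriple P ≠ 0 := by
  intro h
  have h1 := cremonaTriple_comp_self P hP
  rw [h, map_zero] at h1
  exact mul_ne_zero (pow_ne_zero d (Finset.prod_ne_zero_iff.2 fun j _ => X_ne_zero j)) h0 h1.symm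

theorem dvd_prod_X_of_comp_cremona_dvd {h : MvPolynomial (Fin 3) ℂ} {e : ℕ}
    (he : h.IsHomogeneous e) (h1 : bind₁ cremonaTriple h ∣ (∏ i, X i) ^ d) :
    h ∣ (∏ i, X i) ^ (2 * d) := by
  have h2 := map_dvd (bind₁ cremonaTriple) h1
  rw [cremonaTriple_comp_self _ he, map_pow] at h2
  have h3 : bind₁ cremonaTriple (∏ i, X i) = (∏ i, X i : MvPolynomial (Fin 3) ℂ) ^ 2 := by
    rw [Fin.prod_univ_three, map_mul, map_mul, bind₁_X_right, bind₁_X_right, bind₁_X_right]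
    simp only [cremonaTriple, Matrix.cons_val]
    ring
  rw [h3, ← pow_mul] at h2
  exact (dvd_mul_left _ _).trans h2

theorem exists_X_dvd_of_dvd_prod_X {h : MvPolynomial (Fin 3) ℂ} {k : ℕ}
    (h1 : h ∣ (∏ i, X i) ^ k) (hu : ¬ IsUnit h) : ∃ i, X i ∣ h := by
  have h0 : h ≠ 0 := by
    intro h0
    rw [h0, zero_dvd_iff] at h1
    exact pow_ne_zero _ (Finset.prod_ne_zero_iff.2 fun j _ => X_ne_zero j) h1
  obtain ⟨p, hp, hph⟩ := WfDvdMonoid.exists_irreducible_factor hu h0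
  have hp' : Prime p := hp.prime
  have h2 : p ∣ ∏ i : Fin 3, X i := hp'.dvd_of_dvd_pow (hph.trans h1)
  rw [Prime.dvd_finsetProd_iff hp'] at h2
  obtain ⟨i, -, hi⟩ := h2
  have h3 : (X i : MvPolynomial (Fin 3) ℂ) ∣ p := hp.dvd_symm X_prime.irreducible hi
  exact ⟨i, h3.trans hph⟩

/-- Applying J again shows that a common factor divides a power of x₁x₂x₃. If it is not a unit, some
xᵢ could be split off once more, contrary to νᵢ being the exact multiplicity. -/
theorem Reduced.of_cremona (hQ : Reduced Q) (hd : ∀ i, (Q i).IsHomogeneous d) {ν : Fin 3 → ℕ}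
    (hν : ∀ i, IsMult (Pi.single i 1) (ν i) Q) {Q' : Triple}
    (hQ' : ∀ l, bind₁ cremonaTriple (Q l) = (∏ j, X j ^ ν j) * Q' l) : Reduced Q' := by
  intro h hh
  have h1 : bind₁ cremonaTriple h ∣ (∏ i, X i) ^ d := by
    refine hQ.dvd_of_forall_dvd_mul fun l => ?_
    rw [← cremonaTriple_comp_self _ (hd l), hQ' l, map_mul]
    exact (map_dvd _ (hh l)).mul_left _
  obtain ⟨e, he⟩ : ∃ e, h.IsHomogeneous e := by
    obtain ⟨l, hl⟩ := hQ.exists_ne_zero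
    obtain ⟨a, ha⟩ := hh l
    have h3 : bind₁ cremonaTriple (Q l) = h * ((∏ j, X j ^ ν j) * a) := by
      rw [hQ' l, ha, mul_left_comm]
    have h4 := bind₁_cremonaTriple_ne_zero (hd l) hl
    have h5 := IsHomogeneous.bind₁ (hd l) cremonaTriple_isHomogeneous
    rw [h3] at h4 h5
    obtain ⟨e, he, -⟩ := isHomogeneous_of_mul h5 h4
    exact ⟨e, he⟩
  by_contra hu
  obtain ⟨i, hi⟩ := exists_X_dvd_of_dvd_prod_X (dvd_prod_X_of_comp_cremona_dvd he h1) hu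
  have h5 : ν i + 1 ≤ ν i := by
    refine (hν i _).1 fun l => multGE_of_X_pow_dvd (hd l) ?_
    rw [hQ' l, pow_succ]
    exact mul_dvd_mul (Finset.dvd_prod_of_mem _ (Finset.mem_univ i)) (hi.trans (hh l))
  exact absurd h5 (Nat.not_succ_le_self _)

/-- Composition of a reduced triple with the standard Cremona involution, and its
multiplicities. -/
theorem exists_cremona_step (hQ : Reduced Q) (hd : ∀ i, (Q i).IsHomogeneous d) {ν : Fin 3 → ℕ}
    (hν : ∀ i, IsMult (Pi.single i 1) (ν i) Q) :
    ∃ (Q' : Triple) (d' : ℕ), Reduced Q' ∧ (∀ i, (Q' i).IsHomogeneous d') ∧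
      (∀ l, bind₁ cremonaTriple (Q l) = (∏ j, X j ^ ν j) * Q' l) ∧
      d' + ∑ j, ν j = 2 * d ∧
      (∀ q : Vec, (∀ i, q i ≠ 0) → ∀ m, IsMult (cremona q) m Q → IsMult q m Q') ∧
      ∀ i, ∃ m, IsMult (Pi.single i 1) m Q' ∧ m + ∑ j, ν j = d + ν i := by
  choose Q' hQ' using prod_X_pow_dvd hν
  have hred := hQ.of_cremona hd hν hQ'
  have hhom : ∀ l, ((∏ j, X j ^ ν j) * Q' l).IsHomogeneous (2 * d) := fun l =>
    hQ' l ▸ IsHomogeneous.bind₁ (hd l) cremonaTriple_isHomogeneous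
  have hle : ∑ j, ν j ≤ 2 * d := by
    obtain ⟨l, hl⟩ := hred.exists_ne_zero
    obtain ⟨e, he, hed⟩ := isHomogeneous_of_mul (hhom l) (mul_ne_zero (prod_X_pow_ne_zero ν) hl)
    rwa [← he.inj_right (prod_X_pow_isHomogeneous ν) (prod_X_pow_ne_zero ν)]
  refine ⟨Q', 2 * d - ∑ j, ν j, hred, fun l => ?_, hQ', by omega, fun q hq m hm k => ?_,
    fun i => ?_⟩
  · refine isHomogeneous_right_of_mul ?_ (prod_X_pow_isHomogeneous ν) (prod_X_pow_ne_zero ν)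
    rw [Nat.add_sub_cancel' hle]
    exact hhom l
  · rw [← hm k]
    refine forall_congr' fun l => ?_
    rw [← multGE_comp_cremona_iff (hd l) hq, hQ' l]
    refine ⟨fun h => ?_, fun h => h.of_mul_left ?_⟩
    · simpa using (multGE_zero q _).mul h
    · simpa [Finset.prod_eq_zero_iff] using fun i h => absurd h (hq i)
  · have hs := Finset.add_sum_erase Finset.univ ν (Finset.mem_univ i)
    -- Before cancellation the multiplicity at eᵢ is exactly d, because xᵢ is not a common factor of
    -- Q. Removing the product of the xⱼ to the powers νⱼ lowers it by the sum of the νⱼ with j ≠ i.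
    have key : ∀ k, (∀ l, MultGE (Pi.single i 1) (d + k) (bind₁ cremonaTriple (Q l))) ↔ k = 0 := by
      intro k
      simp only [multGE_comp_cremona_single (hd _)]
      refine ⟨fun h => ?_, fun h => by simp [h]⟩
      by_contra hk
      exact X_prime.not_isUnit (hQ (X i) fun l => (dvd_pow_self _ hk).trans (h l))
    have hle' : ∑ j ∈ Finset.univ.erase i, ν j ≤ d := by
      by_contra! hlt
      obtain ⟨k, hk⟩ := Nat.exists_eq_add_of_lt hlt
      have h1 := (key (k + 1)).1 fun l => by
        rw [← add_assoc, ← hk, hQ' l, ← add_zero (∑ j ∈ Finset.univ.erase i, ν j),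
          pow_mul_cofactor_iff]
        exact multGE_zero _ _
      omega
    refine ⟨d - ∑ j ∈ Finset.univ.erase i, ν j, fun k => ?_, by omega⟩
    have h1 : (∀ l, MultGE (Pi.single i 1) k (Q' l)) ↔
        ∀ l, MultGE (Pi.single i 1) (∑ j ∈ Finset.univ.erase i, ν j + k)
          (bind₁ cremonaTriple (Q l)) := by
      simp only [hQ', pow_mul_cofactor_iff]
    rw [h1]
    constructor
    · intro h
      by_contra! hlt
      obtain ⟨c, hc⟩ : ∃ c, ∑ j ∈ Finset.univ.erase i, ν j + k = d + (c + 1) :=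
        ⟨∑ j ∈ Finset.univ.erase i, ν j + k - d - 1, by omega⟩
      rw [hc] at h
      have := (key _).1 h
      omega
    · intro h l
      exact (((key 0).2 rfl) l).mono (by omega)

/-- The coordinates of a vector with respect to the columns of `A`. -/
abbrev framePart (A : GL (Fin 3) ℂ) (v : Vec) : Vec :=
  ((A⁻¹ : GL (Fin 3) ℂ) : Matrix (Fin 3) (Fin 3) ℂ).mulVec v

/-- Composition of a reduced triple with a basic map, and its multiplicities. -/
theorem exists_basic_step {G : Triple} (A B : GL (Fin 3) ℂ) (hG : Reduced G)
    (hd : ∀ i, (G i).IsHomogeneous d) {ν : Fin 3 → ℕ}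
    (hν : ∀ i, IsMult ((B : Matrix (Fin 3) (Fin 3) ℂ).mulVec (Pi.single i 1)) (ν i) G) :
    ∃ (G' : Triple) (d' : ℕ) (h : MvPolynomial (Fin 3) ℂ), h ≠ 0 ∧ Reduced G' ∧
      (∀ i, (G' i).IsHomogeneous d') ∧ (∀ l, tripleComp G (basicTriple A B) l = h * G' l) ∧
      d' + ∑ j, ν j = 2 * d ∧
      (∀ q : Vec, (∀ i, framePart A q i ≠ 0) →
        ∀ m, IsMult (ev (basicTriple A B) q) m G → IsMult q m G') ∧
      ∀ i, ∃ m, IsMult ((A : Matrix (Fin 3) (Fin 3) ℂ).mulVec (Pi.single i 1)) m G' ∧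
        m + ∑ j, ν j = d + ν i := by
  obtain ⟨Q', d', h1, h2, h3, h4, h5, h6⟩ := exists_cremona_step
    (hG.comp_linear B) (d := d)
    (fun i => one_mul d ▸ IsHomogeneous.bind₁ (hd i) (linearTriple_isHomogeneous _))
    fun i => (isMult_comp_linear_iff B).2 (hν i)
  refine ⟨tripleComp Q' (linearTriple ((A⁻¹ : GL (Fin 3) ℂ) : Matrix (Fin 3) (Fin 3) ℂ)), d',
    linEquiv A⁻¹ (∏ j, X j ^ ν j), ?_, h1.comp_linear _, fun i => ?_, fun l => ?_, h4,
    fun q hq m hm => ?_, fun i => ?_⟩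
  · rw [Ne, EmbeddingLike.map_eq_zero_iff]
    exact prod_X_pow_ne_zero ν
  · exact one_mul d' ▸ IsHomogeneous.bind₁ (h2 i) (linearTriple_isHomogeneous _)
  · rw [basicTriple, ← tripleComp_assoc, ← tripleComp_assoc]
    change bind₁ _ (bind₁ cremonaTriple _) = _
    rw [h3 l, map_mul]
    rfl
  · rw [isMult_comp_linear_iff]
    refine h5 _ hq m ((isMult_comp_linear_iff B).2 ?_)
    rwa [ev_basicTriple] at hm
  · obtain ⟨m, hm, hm'⟩ := h6 i
    refine ⟨m, ?_, hm'⟩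
    rwa [isMult_comp_linear_iff, inv_mulVec_mulVec]

end Step

/-! ### The degrees of the iterates -/

section DegreeSequence

/-- The multiplicity formulas describe composition with f on the right, while the iterates are
defined by composition on the left. -/
theorem iterTriple_succ' (f : PlaneMap) (k : ℕ) :
    f.iterTriple (k + 1) = tripleComp (f.iterTriple k) f.coord := by
  have hsucc : ∀ k, f.iterTriple (k + 1) = tripleComp f.coord (f.iterTriple k) := fun _ => rfl
  induction k with
  | zero =>
    have h : ∀ x, ev (f.iterTriple 0) x = x := fun x => funext fun i => eval_X i
    refine ext_ev fun x => ?_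
    rw [hsucc, ev_tripleComp, ev_tripleComp, h, h]
  | succ k ih => rw [hsucc (k + 1), ih, ← tripleComp_assoc, ← hsucc k, ih]

theorem isMult_X {q : Vec} (hq : q ≠ 0) : IsMult q 0 fun i => X i := by
  intro k
  constructor
  · intro h
    by_contra! hk
    apply hq
    ext l
    have h1 : MultGE q 1 (X l) := (h l).mono hk
    have h2 := eval_eq_zero_of_multGE h1
    rwa [eval_X] at h2
  · intro h l
    rw [Nat.le_zero.1 h]
    exact multGE_zero _ _

namespace LineCoords

variable {L : Fin 3 → Submodule ℂ Vec} (γ : LineCoords L)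

/-- The reduced form of the triple `F` has degree `d`, and the sum of its multiplicities at the
three points with parameter `p j` is `S j`, for `j ≤ m`. -/
def HasProfile (p : ℕ → ℂ) (m : ℕ) (F : Triple) (d : ℕ) (S : ℕ → ℕ) : Prop :=
  ∃ (G : Triple) (h : MvPolynomial (Fin 3) ℂ) (N : ℕ → Fin 3 → ℕ), h ≠ 0 ∧ Reduced G ∧
    (∀ i, (G i).IsHomogeneous d) ∧ (∀ i, F i = h * G i) ∧
    ∀ j ≤ m, (∀ l, IsMult (γ.vec l (p j)) (N j l) G) ∧ S j = ∑ l, N j l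

variable (hL : IsConcurrentTriple L) (τ : Equiv.Perm (Fin 3)) {a b : ℂ}
  (ha : ∑ _i : Fin 3, a ≠ 0) (hb : ∑ _i : Fin 3, b ≠ 0)

/-- Away from the exceptional lines f carries one orbit triple to the next and preserves
multiplicities, so the sums shift by one. At the last triple, the indeterminacy points, summing d +
νᵢ − Σ ν over i gives 3d − 2 Σ ν. -/
theorem HasProfile.step {p : ℕ → ℂ} {m : ℕ} {F : Triple} {d : ℕ} {S : ℕ → ℕ}
    (h : γ.HasProfile p m F d S) (h0 : p 0 = b) (hm : p m = a)
    (hp : ∀ j < m, ∀ i, next (fun _ => a) (fun _ => b) i (p j) = p (j + 1))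
    (hne : ∀ j < m, p j ≠ a) (hne' : ∀ j < m, p j ≠ a - ∑ _i : Fin 3, a) :
    ∃ d' S', γ.HasProfile p m
      (tripleComp F (γ.stdTriple hL τ (fun _ => a) (fun _ => b) ha hb)) d' S' ∧
      d' + S 0 = 2 * d ∧ (∀ j < m, S' j = S (j + 1)) ∧ S' m + 2 * S 0 = 3 * d := by
  obtain ⟨G, u, N, hu, hG, hd, hF, hN⟩ := h
  obtain ⟨G', d', u', hu', hG', hd', hF', hdeg, hmult, hend⟩ := exists_basic_step
    (γ.frameGL hL 1 (fun _ => a) ha) (γ.frameGL hL τ (fun _ => b) hb) hG hd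
    (ν := fun i => N 0 (τ i)) fun i => by
      rw [coe_frameGL, frame_mulVec_single, ← h0]
      exact (hN 0 (Nat.zero_le _)).1 (τ i)
  choose M hM hMsum using hend
  have hsum : ∀ g : Fin 3 → ℕ, ∑ i, g (τ i) = ∑ i, g i := fun g => Equiv.sum_comp τ g
  rw [hsum, ← (hN 0 (Nat.zero_le _)).2] at hdeg
  refine ⟨d', fun j => if j < m then S (j + 1) else ∑ i, M i, ⟨G',
    bind₁ (γ.stdTriple hL τ (fun _ => a) (fun _ => b) ha hb) u * u',
    fun j l => if j < m then N (j + 1) (τ l) else M l,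
    mul_ne_zero (bind₁_basicTriple_ne_zero _ _ hu) hu', hG', hd', fun l => ?_, fun j hj => ?_⟩,
    hdeg, fun j hj => if_pos hj, ?_⟩
  · rw [mul_assoc, ← hF' l, tripleComp, hF l, map_mul]
    rfl
  · rcases hj.lt_or_eq with hj | rfl
    · simp only [if_pos hj]
      refine ⟨fun l => hmult _ (fun i => ?_) _ ?_, ?_⟩
      · rw [framePart, inv_frameGL_mulVec_vec, Pi.add_apply]
        rcases eq_or_ne i l with rfl | hil
        · rw [Pi.single_eq_same]
          intro h
          -- The parameter a − 3a is where the line meets its own exceptional line Eᵢ.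
          apply hne' j hj
          have h1 : 1 + (p j - a) / ∑ _i : Fin 3, a = 0 := h
          have h2 := div_mul_cancel₀ (p j - a) ha
          rw [eq_neg_of_add_eq_zero_right h1] at h2
          linear_combination -h2
        · rw [Pi.single_eq_of_ne hil, zero_add]
          exact div_ne_zero (sub_ne_zero.2 (hne j hj)) ha
      · have h1 := γ.ev_stdTriple_vec hL τ (fun _ => a) (fun _ => b) ha hb l (p j)
        rw [stdTriple] at h1
        rw [h1, isMult_smul_iff (neg_ne_zero.2 (div_ne_zero (sub_ne_zero.2 (hne j hj)) ha)), hp j hj]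
        exact (hN (j + 1) hj).1 (τ l)
      · rw [(hN (j + 1) hj).2, hsum]
    · simp only [lt_irrefl, if_false, and_true]
      intro l
      have h1 := hM l
      rwa [coe_frameGL, frame_mulVec_single, ← hm] at h1
  · simp only [lt_irrefl, if_false]
    have h1 : ∑ i, (M i + ∑ j, N 0 (τ j)) = ∑ i, (d + N 0 (τ i)) :=
      Finset.sum_congr rfl fun i _ => hMsum i
    rw [Finset.sum_add_distrib, Finset.sum_add_distrib, hsum, ← (hN 0 (Nat.zero_le _)).2] at h1
    simp only [Finset.sum_const, Finset.card_univ, Fintype.card_fin, smul_eq_mul] at h1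
    omega

theorem HasProfile.tripleDegree_eq {p : ℕ → ℂ} {m : ℕ} {F : Triple} {d : ℕ} {S : ℕ → ℕ}
    (h : γ.HasProfile p m F d S) : tripleDegree F = d := by
  obtain ⟨G, u, N, hu, hG, hd, hF, -⟩ := h
  exact hG.tripleDegree_eq hd hu hF

/-- The degrees of the iterates of a map whose exceptional lines have orbits of length `m + 1`
along the points with parameters `p 0, …, p m`. -/
theorem exists_degree_sequence {p : ℕ → ℂ} {m : ℕ} (h0 : p 0 = b) (hm : p m = a)
    (hp : ∀ j < m, ∀ i, next (fun _ => a) (fun _ => b) i (p j) = p (j + 1))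
    (hne : ∀ j < m, p j ≠ a) (hne' : ∀ j < m, p j ≠ a - ∑ _i : Fin 3, a) :
    ∃ (d : ℕ → ℕ) (S : ℕ → ℕ → ℕ),
      (∀ k, tripleDegree ((γ.stdMap hL τ (fun _ => a) (fun _ => b) ha hb).iterTriple k) = d k) ∧
      d 0 = 1 ∧ (∀ j, S 0 j = 0) ∧ (∀ k, d (k + 1) + S k 0 = 2 * d k) ∧
      (∀ k, ∀ j < m, S (k + 1) j = S k (j + 1)) ∧ ∀ k, S (k + 1) m + 2 * S k 0 = 3 * d k := by
  set f := γ.stdMap hL τ (fun _ => a) (fun _ => b) ha hb with hf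
  have hstep : ∀ k (x : ℕ × (ℕ → ℕ)), γ.HasProfile p m (f.iterTriple k) x.1 x.2 →
      ∃ x' : ℕ × (ℕ → ℕ), γ.HasProfile p m (f.iterTriple (k + 1)) x'.1 x'.2 ∧
        x'.1 + x.2 0 = 2 * x.1 ∧ (∀ j < m, x'.2 j = x.2 (j + 1)) ∧
        x'.2 m + 2 * x.2 0 = 3 * x.1 := by
    intro k x hx
    obtain ⟨d', S', h1, h2⟩ := hx.step γ hL τ ha hb h0 hm hp hne hne'
    refine ⟨(d', S'), ?_, h2⟩
    rw [iterTriple_succ']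
    exact h1
  have hzero : γ.HasProfile p m (f.iterTriple 0) 1 fun _ => 0 :=
    ⟨_, 1, fun _ _ => 0, one_ne_zero, reduced_X, isHomogeneous_X ℂ, fun i => (one_mul _).symm,
      fun j _ => ⟨fun l => isMult_X (γ.vec_ne_zero' l (p j)), by simp⟩⟩
  choose! g hg using hstep
  let x : ℕ → ℕ × (ℕ → ℕ) := fun k => Nat.rec (1, fun _ => 0) g k
  have hx : ∀ k, γ.HasProfile p m (f.iterTriple k) (x k).1 (x k).2 := by
    intro k
    induction k with
    | zero => exact hzero
    | succ k ih => exact (hg k _ ih).1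
  exact ⟨fun k => (x k).1, fun k => (x k).2, fun k => (hx k).tripleDegree_eq, rfl, fun _ => rfl,
    fun k => (hg k _ (hx k)).2.1, fun k => (hg k _ (hx k)).2.2.1, fun k => (hg k _ (hx k)).2.2.2⟩

end LineCoords

/-- The recursion of the degrees. -/
theorem degree_recursion {d : ℕ → ℕ} {S : ℕ → ℕ → ℕ} {m : ℕ} (h0 : d 0 = 1)
    (hS0 : ∀ j, S 0 j = 0) (hd : ∀ k, d (k + 1) + S k 0 = 2 * d k)
    (hS : ∀ k, ∀ j < m, S (k + 1) j = S k (j + 1))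
    (hSm : ∀ k, S (k + 1) m + 2 * S k 0 = 3 * d k) :
    (∀ k ≤ m + 1, d k = 2 ^ k) ∧
      ∀ k, d (k + m + 2) + 2 * d (k + 1) = 2 * d (k + m + 1) + d k := by
  -- Multiplicity sums travel down the orbit, so what enters at its end affects the degree only m
  -- steps later.
  have hshift : ∀ j ≤ m, ∀ k, S (k + j) 0 = S k j := by
    intro j
    induction j with
    | zero => exact fun _ _ => rfl
    | succ j ih =>
      intro hj k
      rw [← hS k j (by omega), ← ih (by omega) (k + 1)]
      congr 1
      omega
  constructor
  · intro k
    induction k with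
    | zero => exact fun _ => h0
    | succ k ih =>
      intro hk
      have h1 := hd k
      have h2 := hshift k (by omega) 0
      rw [Nat.zero_add, hS0] at h2
      rw [h2, ih (by omega)] at h1
      rw [pow_succ]
      omega
  · intro k
    have h1 := hshift m le_rfl (k + 1)
    have h2 := hSm k
    have h3 := hd k
    have h4 : d (k + m + 2) + S (k + m + 1) 0 = 2 * d (k + m + 1) := hd (k + m + 1)
    rw [show k + 1 + m = k + m + 1 by omega] at h1
    omega

end DegreeSequence

/-! ### Growth of solutions of the degree recursion -/

section Growth

theorem nonneg_of_recursion {N : ℕ} {a x : ℕ → ℝ} (ha : ∀ i < N, 0 ≤ a i)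
    (hx : ∀ k, x (k + N) = ∑ i ∈ Finset.range N, a i * x (k + i))
    (h : ∀ k < N, 0 ≤ x k) (k : ℕ) : 0 ≤ x k := by
  induction k using Nat.strong_induction_on with
  | _ k ih =>
    rcases lt_or_ge k N with hk | hk
    · exact h k hk
    · obtain ⟨l, rfl⟩ := Nat.exists_eq_add_of_le' hk
      rw [hx]
      refine Finset.sum_nonneg fun i hi => ?_
      rw [Finset.mem_range] at hi
      exact mul_nonneg (ha i hi) (ih _ (by omega))

/-- The largest real root of `χₙ` lies strictly between `1` and `2`. -/
theorem exists_isGreatest_chiRoot {n : ℕ} (hn : 4 ≤ n) :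
    ∃ δ : ℝ, 1 < δ ∧ δ < 2 ∧ IsGreatest {x : ℝ | IsChiRoot n x} δ := by
  have hcont : Continuous fun x : ℝ => x ^ (n + 1) - 2 * x ^ n + 2 * x - 1 := by fun_prop
  have hlt : ∀ x : ℝ, IsChiRoot n x → x < 2 := by
    intro x hx
    by_contra! h
    have h1 : x ^ n * (x - 2) + 2 * x - 1 = 0 := by
      rw [← hx, pow_succ]
      ring
    have h2 : 0 ≤ x ^ n * (x - 2) := mul_nonneg (by positivity) (by linarith)
    linarith
  obtain ⟨y, ⟨hy1, hy2⟩, hy⟩ : ∃ y ∈ Set.Icc (3 / 2 : ℝ) 2, IsChiRoot n y := by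
    refine intermediate_value_Icc (by norm_num) hcont.continuousOn ⟨?_, ?_⟩
    -- χₙ(3/2) = 2 − (3/2)ⁿ/2 is negative once (3/2)ⁿ > 4, which holds from n = 4 on.
    · have h1 : (3 / 2 : ℝ) ^ 4 ≤ (3 / 2) ^ n := pow_le_pow_right₀ (by norm_num) hn
      rw [pow_succ]
      norm_num at h1 ⊢
      linarith
    · rw [pow_succ]
      norm_num
      linarith [show (2 : ℝ) ^ n * 2 = 2 * 2 ^ n by ring]
  have hcomp : IsCompact ({x : ℝ | IsChiRoot n x} ∩ Set.Icc 1 2) :=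
    isCompact_Icc.inter_left (isClosed_eq hcont continuous_const)
  obtain ⟨δ, ⟨hδ, hδ1, -⟩, hδ2⟩ := hcomp.exists_isGreatest ⟨y, hy, by linarith, hy2⟩
  have hyδ : y ≤ δ := hδ2 ⟨hy, by linarith, hy2⟩
  refine ⟨δ, by linarith, hlt δ hδ, hδ, fun x hx => ?_⟩
  rcases le_total x 1 with h | h
  · linarith
  · exact hδ2 ⟨hx, h, (hlt x hx).le⟩

variable {m : ℕ} {δ : ℝ}

/-- The coefficients of the recursion that is left after dividing `χₙ` by `(t - 1) (t - δ⁻¹)`. -/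
def recCoeff (δ : ℝ) (i : ℕ) : ℝ := (δ ^ (i + 2) - 2 * δ ^ (i + 1) + δ) / (δ - 1)

theorem recCoeff_zero (h1 : 1 < δ) : recCoeff δ 0 = δ := by
  rw [recCoeff, div_eq_iff (by linarith)]
  ring

theorem recCoeff_sub (h1 : 1 < δ) (i : ℕ) : recCoeff δ i - δ⁻¹ * recCoeff δ (i + 1) = 1 := by
  have h2 : δ - 1 ≠ 0 := by linarith
  have h3 : δ ≠ 0 := by linarith
  rw [recCoeff, recCoeff]
  field_simp
  ring

theorem recCoeff_last (h1 : 1 < δ) (hδ : IsChiRoot (m + 2) δ) : recCoeff δ m = 1 - δ⁻¹ := by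
  have h2 : δ - 1 ≠ 0 := by linarith
  have h3 : δ ≠ 0 := by linarith
  rw [recCoeff]
  field_simp
  unfold IsChiRoot at hδ
  linear_combination hδ

/-- The last coefficient is 1 − δ⁻¹ > 0, and each earlier one is 1 plus δ⁻¹ times its successor. -/
theorem recCoeff_nonneg (h1 : 1 < δ) (hδ : IsChiRoot (m + 2) δ) {i : ℕ} (hi : i ≤ m) :
    0 ≤ recCoeff δ i := by
  have h2 : δ⁻¹ < 1 := inv_lt_one_of_one_lt₀ h1
  have h3 : 0 < δ⁻¹ := by positivity
  induction hi using Nat.decreasingInduction with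
  | self =>
    rw [recCoeff_last h1 hδ]
    linarith
  | of_succ k hk ih =>
    have := recCoeff_sub h1 k
    have := mul_nonneg h3.le ih
    linarith

/-- A solution of the recursion of the degrees is nonnegative if its initial values are
sufficiently convex. -/
theorem nonneg_of_degree_recursion (h1 : 1 < δ) (hδ : IsChiRoot (m + 2) δ) {D : ℕ → ℝ}
    (hD : ∀ k, D (k + m + 3) = 2 * D (k + m + 2) - 2 * D (k + 1) + D k)
    (h : ∀ k ≤ m, 0 ≤ D (k + 2) - D (k + 1) - δ⁻¹ * (D (k + 1) - D k))
    (hD1 : 0 ≤ D 1 - D 0) (hD0 : 0 ≤ D 0) (k : ℕ) : 0 ≤ D k := by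
  have h3 : 0 < δ⁻¹ := by positivity
  -- The differences ΔD(k+1) − δ⁻¹ ΔD(k) satisfy the recursion with coefficients `recCoeff`, as this
  -- telescoping sum shows for j = m. Nonnegativity passes from them to ΔD and then to D.
  have htel : ∀ k j, ∑ i ∈ Finset.range (j + 1), recCoeff δ i *
      (D (k + i + 2) - D (k + i + 1) - δ⁻¹ * (D (k + i + 1) - D (k + i))) =
      recCoeff δ j * (D (k + j + 2) - D (k + j + 1)) + D (k + j + 1) - 2 * D (k + 1) + D k := by
    intro k j
    induction j with
    | zero =>
      rw [Finset.sum_range_one, recCoeff_zero h1]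
      simp only [add_zero]
      have := mul_inv_cancel₀ (show δ ≠ 0 by linarith)
      linear_combination -(D (k + 1) - D k) * this
    | succ j ih =>
      rw [Finset.sum_range_succ, ih]
      have := recCoeff_sub h1 j
      simp only [← add_assoc]
      linear_combination (D (k + j + 2) - D (k + j + 1)) * this
  have hx : ∀ k, 0 ≤ D (k + 2) - D (k + 1) - δ⁻¹ * (D (k + 1) - D k) := by
    refine nonneg_of_recursion (N := m + 1) (a := recCoeff δ)
      (fun i hi => recCoeff_nonneg h1 hδ (by omega)) (fun k => ?_) fun k hk => h k (by omega)
    rw [htel k m, recCoeff_last h1 hδ]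
    have := hD k
    simp only [← add_assoc]
    rw [show k + m + 1 + 2 = k + m + 3 by omega, this, show k + m + 1 + 1 = k + m + 2 by omega]
    ring
  have hy : ∀ k, 0 ≤ D (k + 1) - D k := by
    intro k
    induction k with
    | zero => exact hD1
    | succ k ih =>
      have := hx k
      have := mul_nonneg h3.le ih
      linarith
  induction k with
  | zero => exact hD0
  | succ k ih =>
    have := hy k
    linarith

/-- Both D − δᵏ and c δᵏ − D solve the recursion, so it suffices to check their first values, where
D k = 2ᵏ. -/
theorem degree_bounds (h1 : 1 < δ) (h2 : δ < 2) (hδ : IsChiRoot (m + 2) δ) {D : ℕ → ℝ}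
    (hD : ∀ k, D (k + m + 3) = 2 * D (k + m + 2) - 2 * D (k + 1) + D k)
    (h : ∀ k ≤ m + 2, D k = 2 ^ k) :
    (∀ k, δ ^ k ≤ D k) ∧ ∃ c : ℝ, 0 < c ∧ ∀ k, D k ≤ c * δ ^ k := by
  have hinv : δ⁻¹ < 1 := inv_lt_one_of_one_lt₀ h1
  have hinv0 : 0 < δ⁻¹ := by positivity
  have hpow : ∀ k, δ ^ (k + m + 3) = 2 * δ ^ (k + m + 2) - 2 * δ ^ (k + 1) + δ ^ k := by
    intro k
    unfold IsChiRoot at hδ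
    have : δ ^ k * (δ ^ (m + 2 + 1) - 2 * δ ^ (m + 2) + 2 * δ - 1) = 0 := by rw [hδ, mul_zero]
    linear_combination this
  have hconv : ∀ k, δ ^ (k + 2) - δ ^ (k + 1) - δ⁻¹ * (δ ^ (k + 1) - δ ^ k) =
      δ ^ k * ((δ - 1) * (δ - δ⁻¹)) := fun k => by ring
  have hconv' : ∀ k ≤ m, D (k + 2) - D (k + 1) - δ⁻¹ * (D (k + 1) - D k) =
      2 ^ k * (2 - δ⁻¹) := fun k hk => by
    rw [h _ (by omega), h _ (by omega), h _ (by omega)]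
    ring
  have hfac : 0 < (δ - 1) * (δ - δ⁻¹) := mul_pos (by linarith) (by linarith)
  constructor
  · intro k
    have h3 : 0 ≤ D k - δ ^ k := by
      refine nonneg_of_degree_recursion (D := fun k => D k - δ ^ k) h1 hδ (fun k => ?_)
        (fun k hk => ?_) ?_ ?_ k
      · simp only [hD, hpow]
        ring
      · have h4 : δ ^ k * ((δ - 1) * (δ - δ⁻¹)) ≤ 2 ^ k * (1 * (2 - δ⁻¹)) :=
          mul_le_mul (pow_le_pow_left₀ (by linarith) h2.le k)
            (mul_le_mul (by linarith) (by linarith) (by linarith) (by linarith)) hfac.le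
            (by positivity)
        have h5 := hconv k
        have h6 := hconv' k hk
        linarith
      · simp only [h 1 (by omega), h 0 (by omega)]
        norm_num
        linarith
      · simp only [h 0 (by omega)]
        norm_num
    linarith
  -- The three summands ensure, in turn, the m + 1 convexity conditions, the condition on D 1 − D 0
  -- = 1, and the one on D 0 = 1.
  · obtain ⟨c, hc⟩ : ∃ c : ℝ, c = 2 ^ m * 2 / ((δ - 1) * (δ - δ⁻¹)) + (δ - 1)⁻¹ + 1 := ⟨_, rfl⟩
    have hp1 : 0 < 2 ^ m * 2 / ((δ - 1) * (δ - δ⁻¹)) := div_pos (by positivity) hfac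
    have hp2 : 0 < (δ - 1)⁻¹ := inv_pos.2 (by linarith)
    refine ⟨c, by linarith, fun k => ?_⟩
    have h3 : 0 ≤ c * δ ^ k - D k := by
      refine nonneg_of_degree_recursion (D := fun k => c * δ ^ k - D k) h1 hδ (fun k => ?_)
        (fun k hk => ?_) ?_ ?_ k
      · simp only [hD, hpow]
        ring
      · have h4 : 2 ^ k * (2 - δ⁻¹) ≤ 2 ^ m * 2 :=
          mul_le_mul (pow_le_pow_right₀ (by norm_num) hk) (by linarith) (by linarith)
            (by positivity)
        have h5 : 2 ^ m * 2 ≤ c * ((δ - 1) * (δ - δ⁻¹)) := by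
          rw [← div_le_iff₀ hfac]
          linarith
        have h6 : c * ((δ - 1) * (δ - δ⁻¹)) ≤ c * (δ ^ k * ((δ - 1) * (δ - δ⁻¹))) := by
          refine mul_le_mul_of_nonneg_left ?_ (by linarith)
          exact le_mul_of_one_le_left hfac.le (one_le_pow₀ h1.le)
        have h7 : c * (δ ^ (k + 2) - δ ^ (k + 1) - δ⁻¹ * (δ ^ (k + 1) - δ ^ k)) =
            c * (δ ^ k * ((δ - 1) * (δ - δ⁻¹))) := by rw [hconv k]
        have h8 := hconv' k hk
        linarith
      · have h4 : (δ - 1)⁻¹ * (δ - 1) ≤ c * (δ - 1) :=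
          mul_le_mul_of_nonneg_right (by linarith) (by linarith)
        rw [inv_mul_cancel₀ (by linarith)] at h4
        simp only [h 1 (by omega), h 0 (by omega)]
        linarith
      · simp only [h 0 (by omega)]
        norm_num
        linarith
    linarith

theorem tendsto_rpow_of_bounds {δ c : ℝ} (h0 : 0 < δ) (hc : 0 < c) {D : ℕ → ℝ}
    (h1 : ∀ k, δ ^ k ≤ D k) (h2 : ∀ k, D k ≤ c * δ ^ k) :
    Tendsto (fun k : ℕ => D k ^ (1 / (k : ℝ))) atTop (𝓝 δ) := by
  have hroot : ∀ k : ℕ, 0 < k → (δ ^ k) ^ (1 / (k : ℝ)) = δ := fun k hk => by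
    rw [one_div, Real.pow_rpow_inv_natCast h0.le hk.ne']
  have hlim : Tendsto (fun k : ℕ => c ^ (1 / (k : ℝ)) * δ) atTop (𝓝 δ) := by
    have h3 : Tendsto (fun k : ℕ => c ^ (1 / (k : ℝ))) atTop (𝓝 1) := by
      have h4 : Tendsto (fun k : ℕ => 1 / (k : ℝ)) atTop (𝓝 0) :=
        tendsto_one_div_atTop_nhds_zero_nat
      simpa using (tendsto_const_nhds (x := c)).rpow h4 (Or.inl hc.ne')
    simpa using h3.mul_const δ
  refine tendsto_of_tendsto_of_tendsto_of_le_of_le' tendsto_const_nhds hlim ?_ ?_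
  · filter_upwards [eventually_gt_atTop 0] with k hk
    calc δ = (δ ^ k) ^ (1 / (k : ℝ)) := (hroot k hk).symm
      _ ≤ _ := Real.rpow_le_rpow (by positivity) (h1 k) (by positivity)
  · filter_upwards [eventually_gt_atTop 0] with k hk
    calc D k ^ (1 / (k : ℝ)) ≤ (c * δ ^ k) ^ (1 / (k : ℝ)) :=
          Real.rpow_le_rpow ((by positivity : (0 : ℝ) ≤ δ ^ k).trans (h1 k)) (h2 k) (by positivity)
      _ = c ^ (1 / (k : ℝ)) * δ := by
          rw [Real.mul_rpow hc.le (by positivity), hroot k hk]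

end Growth

/-! ### The six normalized maps -/

section NormalizedMaps

variable {α : ℂ} {m : ℕ}

theorem IsChiRoot.ne_two (hα : IsChiRoot m α) : α ≠ 2 := by
  rintro rfl
  rw [IsChiRoot, pow_succ] at hα
  have : (3 : ℂ) = 0 := by linear_combination hα
  norm_num at this

namespace LineCoords

variable {L : Fin 3 → Submodule ℂ Vec} (γ : LineCoords L) (hL : IsConcurrentTriple L)

theorem hasDynamicalDegree_stdMap (h0 : α ≠ 0) (hα : IsChiRoot (m + 2) α)
    (hunit : ∀ k : ℕ, 0 < k → α ^ k ≠ 1) {δ : ℝ} (hδ1 : 1 < δ) (hδ2 : δ < 2)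
    (hδ : IsChiRoot (m + 2) δ) (τ : Equiv.Perm (Fin 3)) (ht : ∑ _i : Fin 3, (α⁻¹ - 1) ≠ 0)
    (hs : ∑ _i : Fin 3, (α - 1) ≠ 0) :
    (γ.stdMap hL τ (fun _ => α⁻¹ - 1) (fun _ => α - 1) ht hs).HasDynamicalDegree δ := by
  have h1 : α ≠ 1 := by simpa using hunit 1 one_pos
  have h2 := hα.ne_two
  obtain ⟨d, S, hd, hd0, hS0, hdS, hS, hSm⟩ := γ.exists_degree_sequence hL τ ht hs
    (p := fun j => 1 + α ^ j * (α - 2)) (m := m + 1) (by ring) (orb_const_end h0 hα)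
    (fun j _ i => by
      rw [next_const h0 h1]
      ring)
    (fun j hj => orb_const_ne h0 hα hunit hj) fun j _ h => by
      have h3 : ∑ _i : Fin 3, (α⁻¹ - 1) = 3 * (α⁻¹ - 1) := by
        rw [Fin.sum_univ_three]
        ring
      have h4 := mul_inv_cancel₀ h0
      -- An orbit point on its line's own exceptional line would make α a root of unity or 2.
      have h5 : (α ^ (j + 1) - 1) * (α - 2) = 0 := by
        rw [h3] at h
        linear_combination α * h - 2 * h4
      rcases mul_eq_zero.1 h5 with h6 | h6
      · exact hunit (j + 1) j.succ_pos (sub_eq_zero.1 h6)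
      · exact h2 (sub_eq_zero.1 h6)
  obtain ⟨hpow, hrec⟩ := degree_recursion hd0 hS0 hdS hS hSm
  obtain ⟨hlow, c, hc, hup⟩ := degree_bounds (D := fun k => (d k : ℝ)) hδ1 hδ2 hδ
    (fun k => by
      have h3 : ((d (k + m + 3) + 2 * d (k + 1) : ℕ) : ℝ) = (2 * d (k + m + 2) + d k : ℕ) :=
        congrArg _ (hrec k)
      push_cast at h3
      linarith)
    fun k hk => by
      have h3 := hpow k hk
      simp only [h3, Nat.cast_pow, Nat.cast_ofNat]
  simp only [PlaneMap.HasDynamicalDegree, hd]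
  exact tendsto_rpow_of_bounds (by linarith) hc hlow hup

theorem stdMap_isNormalizedOn (h0 : α ≠ 0) (h1 : α ≠ 1) (τ : Equiv.Perm (Fin 3))
    (ht : ∑ _i : Fin 3, (α⁻¹ - 1) ≠ 0) (hs : ∑ _i : Fin 3, (α - 1) ≠ 0) :
    (γ.stdMap hL τ (fun _ => α⁻¹ - 1) (fun _ => α - 1) ht hs).IsNormalizedOn γ α := by
  refine ⟨τ, fun i x hx => ?_⟩
  have hf := γ.proportional_stdMap hL τ (fun _ => α⁻¹ - 1) (fun _ => α - 1) ht hs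
  rw [γ.std_pt_mem_indet_iff hL τ _ _ ht hs hf] at hx
  have h2 := γ.std_sends_pt hL τ _ _ ht hs hf (i := i) hx
  rwa [next_const h0 h1] at h2

theorem not_same_stdMap {τ τ' : Equiv.Perm (Fin 3)} {t s : Fin 3 → ℂ} (hne : τ ≠ τ')
    (ht : ∑ i, t i ≠ 0) (hs : ∑ i, s i ≠ 0) :
    ¬ (γ.stdMap hL τ t s ht hs).Same (γ.stdMap hL τ' t s ht hs) := by
  intro h
  apply hne
  ext i : 1
  have h1 := γ.std_sends_pt hL τ' t s ht hs (γ.proportional_stdMap hL τ' t s ht hs)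
    (i := i) (x := t i + 1) (by simp)
  have h2 := γ.std_sends_pt hL τ t s ht hs (γ.proportional_stdMap hL τ t s ht hs)
    (i := i) (x := t i + 1) (by simp)
  have h3 := γ.std_sends_pt hL τ' t s ht hs (f := γ.stdMap hL τ t s ht hs) h
    (i := i) (x := t i + 1) (by simp)
  have h4 := γ.std_sends_unique hL τ t s ht hs (γ.proportional_stdMap hL τ t s ht hs) h2 h3
  exact ((γ.pt_eq_pt_iff hL).1 h4).1

/-- The parameters do not depend on the line, so each orbit step contributes a whole triple of
points and τ drops out. -/
theorem baseLocus_stdMap (h0 : α ≠ 0) (h1 : α ≠ 1) (hα : IsChiRoot (m + 1) α)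
    (hunit : ∀ k : ℕ, 0 < k → α ^ k ≠ 1) (τ : Equiv.Perm (Fin 3))
    (ht : ∑ _i : Fin 3, (α⁻¹ - 1) ≠ 0) (hs : ∑ _i : Fin 3, (α - 1) ≠ 0) :
    (γ.stdMap hL τ (fun _ => α⁻¹ - 1) (fun _ => α - 1) ht hs).baseLocus =
      {q | ∃ k ≤ m, ∃ i, q = γ.pt i (1 + α ^ k * (α - 2))} := by
  rw [γ.std_baseLocus hL τ _ _ ht hs (γ.proportional_stdMap hL τ _ _ ht hs) (m := m)
    (fun i k hk => by
      rw [orb_const h0 h1]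
      exact orb_const_ne h0 hα hunit hk)
    fun i => by
      rw [orb_const h0 h1]
      exact orb_const_end h0 hα]
  ext q
  simp only [orb_const h0 h1, Set.mem_ofPred_eq]
  refine exists_congr fun k => and_congr_right fun _ => ⟨?_, ?_⟩
  · rintro ⟨i, hi⟩
    exact ⟨_, hi⟩
  · rintro ⟨i, hi⟩
    exact ⟨(τ ^ (k + 1)).symm i, by rwa [Equiv.apply_symm_apply]⟩

theorem realizes_stdMap (h0 : α ≠ 0) (h1 : α ≠ 1) (hα : IsChiRoot (m + 1) α)
    (hunit : ∀ k : ℕ, 0 < k → α ^ k ≠ 1) (h2 : ¬ 2 ∣ m + 1) (h3 : ¬ 3 ∣ m + 1)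
    (σ : Equiv.Perm (Fin 3)) (ht : ∑ _i : Fin 3, (α⁻¹ - 1) ≠ 0)
    (hs : ∑ _i : Fin 3, (α - 1) ≠ 0) :
    (γ.stdMap hL (σ ^ (m + 1)) (fun _ => α⁻¹ - 1) (fun _ => α - 1) ht hs).Realizes L (m + 1) σ := by
  refine γ.stdMap_realizes hL _ _ _ ht hs fun i => ⟨fun k hk => ?_, ?_, ?_⟩
  · rw [orb_const h0 h1]
    exact orb_const_ne h0 hα hunit hk
  · rw [perm_pow_pow h2 h3]
  · rw [orb_const h0 h1]
    exact orb_const_end h0 hα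

theorem same_stdMap (h0 : α ≠ 0) (hunit : ∀ k : ℕ, 0 < k → α ^ k ≠ 1) (h2 : ¬ 2 ∣ m + 1)
    (h3 : ¬ 3 ∣ m + 1) {σ : Equiv.Perm (Fin 3)} (ht : ∑ _i : Fin 3, (α⁻¹ - 1) ≠ 0)
    (hs : ∑ _i : Fin 3, (α - 1) ≠ 0) {g : PlaneMap} (hg : g.Realizes L (m + 1) σ)
    (hnorm : g.IsNormalizedOn γ α) :
    g.Same (γ.stdMap hL (σ ^ (m + 1)) (fun _ => α⁻¹ - 1) (fun _ => α - 1) ht hs) := by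
  obtain ⟨τ, t, s, ht', hs', hf⟩ := γ.exists_std hL hg.1 hg.2.1
  obtain ⟨rfl, rfl, rfl⟩ := γ.params_of_isNormalizedOn hL h2 h3 h0 hunit hf hg hnorm
  exact hf

end LineCoords

end NormalizedMaps

end PlaneCremona

end

open PlaneCremona in
theorem theoremT (L : Fin 3 → Submodule ℂ Vec) (hL : IsConcurrentTriple L)
    (n : ℕ) (hn : 4 ≤ n) (h2 : ¬ 2 ∣ n) (h3 : ¬ 3 ∣ n) :
    -- quadratic maps properly fixing the cubic are basic, with one base point on each line
    (∀ f : PlaneMap, f.IsQuadraticBirational → f.ProperlyFixes L →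
      ∃ Tp Tm : GL (Fin 3) ℂ, f.IsBasicVia Tp Tm ∧ ∀ i, imagePoint Tp i ∈ pointsOf (L i)) ∧
    -- in suitable coordinates, every map with the given orbit data is normalized
    (∀ (σ : Equiv.Perm (Fin 3)) (f : PlaneMap), f.Realizes L n σ →
      ∃ (γ : LineCoords L) (α : ℂ), IsChiRoot n α ∧ (∀ m : ℕ, 0 < m → α ^ m ≠ 1) ∧
        f.IsNormalizedOn γ α) ∧
    -- coordinates exist
    Nonempty (LineCoords L) ∧
    -- for each choice of coordinates and multiplier there are exactly six normalized maps
    ∃ δ : ℝ, 1 < δ ∧ IsGreatest {x : ℝ | IsChiRoot n x} δ ∧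
      ∀ (γ : LineCoords L) (α : ℂ), IsChiRoot n α → (∀ m : ℕ, 0 < m → α ^ m ≠ 1) →
        ∃ f : Equiv.Perm (Fin 3) → PlaneMap,
          (∀ σ, (f σ).Realizes L n σ ∧ (f σ).IsNormalizedOn γ α ∧
            ∀ g : PlaneMap, g.Realizes L n σ → g.IsNormalizedOn γ α → g.Same (f σ)) ∧
          (∀ σ σ', σ ≠ σ' → ¬ (f σ).Same (f σ')) ∧
          (∀ σ σ', (f σ).baseLocus = (f σ').baseLocus ∧ (f σ).indet = (f σ').indet) ∧
          (∀ σ, (f σ).HasDynamicalDegree δ) := by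
  refine ⟨fun f hq hfix => ?_, fun σ f hf => ?_, nonempty_lineCoords hL, ?_⟩
  · obtain ⟨γ⟩ := nonempty_lineCoords hL
    obtain ⟨τ, t, s, ht, hs, hf⟩ := γ.exists_std hL hq hfix
    refine ⟨γ.frameGL hL 1 t ht, γ.frameGL hL τ s hs, hf, fun i => ?_⟩
    rw [γ.imagePoint_frameGL]
    exact γ.pt_mem i (t i)
  · exact LineCoords.exists_isNormalizedOn hL hn h2 h3 hf
  · obtain ⟨δ, hδ1, hδ2, hδ⟩ := exists_isGreatest_chiRoot hn
    refine ⟨δ, hδ1, hδ, fun γ α hα hunit => ?_⟩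
    have h0 : α ≠ 0 := hα.ne_zero hn
    have h1 : α ≠ 1 := by simpa using hunit 1 one_pos
    have ht : ∑ _i : Fin 3, (α⁻¹ - 1) ≠ 0 :=
      LineCoords.sum_const_ne_zero (sub_ne_zero.2 fun h => h1 (inv_eq_one.1 h))
    have hs : ∑ _i : Fin 3, (α - 1) ≠ 0 := LineCoords.sum_const_ne_zero (sub_ne_zero.2 h1)
    obtain ⟨m, rfl⟩ : ∃ m, n = m + 2 := ⟨n - 2, by omega⟩
    -- The permutation of the lines must have n-th power σ; as n² ≡ 1 mod 6, this is σⁿ.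
    refine ⟨fun σ => γ.stdMap hL (σ ^ (m + 2)) (fun _ => α⁻¹ - 1) (fun _ => α - 1) ht hs,
      fun σ => ⟨γ.realizes_stdMap hL h0 h1 hα hunit h2 h3 σ ht hs,
        γ.stdMap_isNormalizedOn hL h0 h1 _ ht hs,
        fun g hg hnorm => γ.same_stdMap hL h0 hunit h2 h3 ht hs hg hnorm⟩,
      fun σ σ' hne => γ.not_same_stdMap hL (fun h => hne ?_) ht hs,
      fun σ σ' => ⟨?_, ?_⟩,
      fun σ => γ.hasDynamicalDegree_stdMap hL h0 hα hunit hδ1 hδ2 hδ.1 _ ht hs⟩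
    · rw [← perm_pow_pow h2 h3 σ, h, perm_pow_pow h2 h3]
    · rw [γ.baseLocus_stdMap hL h0 h1 hα hunit, γ.baseLocus_stdMap hL h0 h1 hα hunit]
    · rw [γ.std_indet hL _ _ _ ht hs (γ.proportional_stdMap hL _ _ _ ht hs),
        γ.std_indet hL _ _ _ ht hs (γ.proportional_stdMap hL _ _ _ ht hs)]
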